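/- Let $N\in\mathbb N\cup\{\infty\}$ and let $A,B$ be row-finite $N\times N$ integer matrices such that $A_{i,j}\ge 0$ for all $i,j$, $A$ has no zero row, and $B_{i,j}=0$ whenever $A_{i,j}=0$; if $N=\infty$, assume also that $A$ has no zero column. **The groupoid.** Let $E$ be the graph with vertices $1,\dots,N$ and edges $e_{i,j,n}$, $0\le n<A_{i,j}$, from $i=s(e_{i,j,n})$ to $j=r(e_{i,j,n})$; let $E^n$ be the set of its paths of length $n$, and $E^\infty$ its infinite path space, a subspace of the product of copies of the discrete set $E^1$. For a finite path $\alpha$ of length $|\alpha|$ with range $r(\alpha)$ put $Z(\alpha)=\{\alpha y\in E^\infty\}$. For $m\in\mathbb Z$ write $mB_{i,j}+n=kA_{i,j}+l$ with $0\le l<A_{i,j}$ and put $\kappa_m(e_{i,j,n})=e_{i,j,l}$, $\varphi(m,e_{i,j,n})=k$; extend to paths by $\kappa_m(e\alpha)=\kappa_m(e)\kappa_{\varphi(m,e)}(\alpha)$, $\varphi(m,e\alpha)=\varphi(\varphi(m,e),\alpha)$. Assume that $(A,B)$ is pseudo free: $\kappa_m(e)=e$ and $\varphi(m,e)=0$ for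 an edge $e$ imply $m=0$. The Katsura–Exel–Pardo groupoid $\mathcal G_{A,B}$ consists of the classes $[\alpha,m,\beta;x]$, where $\alpha,\beta$ are finite paths with $r(\alpha)=r(\beta)$, $m\in\mathbb Z$, $x\in Z(\beta)$, for the equivalence relation generated by $(\alpha,m,\beta;x)\sim(\alpha\kappa_m(\gamma),\varphi(m,\gamma),\beta\gamma;x)$ for $x=\beta\gamma y$, $\gamma$ an edge. Its unit space is $E^\infty$, with $s([\alpha,m,\beta;\beta y])=\beta y$, $r([\alpha,m,\beta;\beta y])=\alpha\kappa_m(y)$; its product is $[\alpha,m',\beta;\beta\kappa_m(y)][\beta,m,\gamma;\gamma y]=[\alpha,m'+m,\gamma;\gamma y]$; its topology is generated by the sets $Z(\alpha,m,\beta;Z(\beta))=\{[\alpha,m,\beta;x]:x\in Z(\beta)\}$. It is a Hausdorff étale groupoid. Let $\rho:\mathcal G_{A,B}\to\mathbb Z$, $\rho([\alpha,m,\beta;x])=|\alpha|-|\beta|$, and $\mathcal H_{A,B}=\ker\rho$. **Homology.** For a Hausdorff étale groupoid $\mathcal G$, $H_0(\mathcal G)=\operatorname{coker}\delta_1$ and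 $H_1(\mathcal G)=\ker\delta_1/\operatorname{im}\delta_2$, where $\delta_1=s_*-r_*:C_c(\mathcal G,\mathbb Z)\to C_c(\mathcal G^{(0)},\mathbb Z)$ and $\delta_2=(d_0)_*-(d_1)_*+(d_2)_*:C_c(\mathcal G^{(2)},\mathbb Z)\to C_c(\mathcal G,\mathbb Z)$ with $d_0(g,h)=h$, $d_1(g,h)=gh$, $d_2(g,h)=g$ and $\pi_*f(y)=\sum_{\pi(x)=y}f(x)$. The skew product $\mathcal G_{A,B}\times_\rho\mathbb Z$ has the product $(g,k)(h,k+\rho(g))=(gh,k)$, and $\hat\rho^1$ denotes the maps induced on its homology by $(g,k)\mapsto(g,k+1)$. **Inductive limits.** For a row-finite integer matrix $M$, $\mathbb Z_M$ is the inductive limit of the sequence $\mathbb Z^{(N)}\to\mathbb Z^{(N)}\to\cdots$, indexed by $i=0,1,2,\dots$, where $\mathbb Z^{(N)}$ is the free abelian group with basis $(\mathbf 1_v)_v$ indexed by the vertices and every map is $\mathbf 1_v\mapsto\sum_w M_{v,w}\mathbf 1_w$; $\varphi^M_{i,\infty}:\mathbb Z^{(N)}\to\mathbb Z_M$ are the canonical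 maps. **Claim.** (0) For $j=0,1$ the embedding $\mathcal H_{A,B}\to\mathcal G_{A,B}\times_\rho\mathbb Z$, $g\mapsto(g,0)$, induces an isomorphism $H_j(\mathcal H_{A,B})\to H_j(\mathcal G_{A,B}\times_\rho\mathbb Z)$. Let $\Psi$ be its inverse and $\tilde\rho^1=\Psi\circ\hat\rho^1\circ\Psi^{-1}$ on $H_j(\mathcal H_{A,B})$. (1) There is an isomorphism $\Phi_A:H_0(\mathcal H_{A,B})\to\mathbb Z_A$ with $\Phi_A([\mathbf 1_{Z(\alpha)}])=\varphi^A_{n,\infty}(\mathbf 1_{r(\alpha)})$ for all $n\ge 0$ and $\alpha\in E^n$; and for every such $\Phi_A$ one has $\Phi_A\circ\tilde\rho^1\circ\Phi_A^{-1}(\varphi^A_{i,\infty}(x))=\varphi^A_{i+1,\infty}(x)$ for all $i\ge 0$ and $x\in\mathbb Z^{(N)}$. (2) There is an isomorphism $\Phi_B:H_1(\mathcal H_{A,B})\to\mathbb Z_B$ with $\Phi_B([\mathbf 1_{Z(\alpha,1,\alpha;Z(\alpha))}])=\varphi^B_{n,\infty}(\mathbf 1_{r(\alpha)})$ for all $n\ge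 0$ and $\alpha\in E^n$; and for every such $\Phi_B$ one has $\Phi_B\circ\tilde\rho^1\circ\Phi_B^{-1}(\varphi^B_{i,\infty}(x))=\varphi^B_{i+1,\infty}(x)$ for all $i\ge 0$ and $x\in\mathbb Z^{(N)}$. -/

import Mathlib

open Set Topology
open scoped CompactlySupported

noncomputable section

namespace KEP

section Pushforward

variable {X Y Z : Type*} [TopologicalSpace X] [TopologicalSpace Y] [TopologicalSpace Z]

/-- The sum of `f` along the fibres of `π`, `y ↦ ∑_{π x = y} f x`. -/
def fibreSum (π : X → Y) (f : X → ℤ) (y : Y) : ℤ := ∑ᶠ x ∈ π ⁻¹' {y}, f x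

theorem fibre_finite [T2Space Y] {π : X → Y} (hπ : IsLocalHomeomorph π) (f : C_c(X, ℤ)) (y : Y) :
    (π ⁻¹' {y} ∩ tsupport f).Finite := by
  refine IsCompact.finite ?_ ?_
  · exact f.hasCompactSupport.isCompact.inter_left (isClosed_singleton.preimage hπ.continuous)
  · refine (IsLocalHomeomorphOn.isDiscrete_of_image (f := π)
      (fun x _ => hπ x) (Set.Finite.isDiscrete ?_))
    refine (Set.finite_singleton y).subset ?_
    rintro _ ⟨x, hx, rfl⟩
    exact hx.1

theorem fibre_finite' [T2Space Y] {π : X → Y} (hπ : IsLocalHomeomorph π) (f : C_c(X, ℤ)) (y : Y) :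
    (π ⁻¹' {y} ∩ Function.support f).Finite :=
  (fibre_finite hπ f y).subset (inter_subset_inter_right _ (subset_tsupport _))

theorem fibreSum_continuous [T2Space X] [T2Space Y] {π : X → Y} (hπ : IsLocalHomeomorph π)
    (f : C_c(X, ℤ)) : Continuous (fibreSum π f) := by
  rw [← IsLocallyConstant.iff_continuous, IsLocallyConstant.iff_eventually_eq]
  intro y₀
  have hF := fibre_finite hπ f y₀
  obtain ⟨U, hU, hUd⟩ := hF.t2_separation
  have hV : ∀ x : X, ∃ V : Set X, IsOpen V ∧ x ∈ V ∧ V ⊆ U x ∧ V.InjOn π ∧ ∀ z ∈ V, f z = f x := by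
    intro x
    obtain ⟨e, hxe, rfl⟩ := hπ x
    refine ⟨U x ∩ e.source ∩ f ⁻¹' {f x}, ((hU x).2.inter e.open_source).inter
      ((isOpen_discrete _).preimage f.continuous), ⟨⟨(hU x).1, hxe⟩, rfl⟩,
      fun z hz => hz.1.1, e.injOn.mono (fun z hz => hz.1.2), fun z hz => hz.2⟩
  choose V hVo hxV hVU hVi hVf using hV
  set F := π ⁻¹' {y₀} ∩ tsupport f with hFdef
  have hKc : IsCompact (tsupport f \ ⋃ x ∈ F, V x) :=
    f.hasCompactSupport.isCompact.diff (isOpen_biUnion fun x _ => hVo x)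
  have hcl : IsClosed (π '' (tsupport f \ ⋃ x ∈ F, V x)) := (hKc.image hπ.continuous).isClosed
  have hy₀ : y₀ ∉ π '' (tsupport f \ ⋃ x ∈ F, V x) := by
    rintro ⟨x, ⟨hx1, hx2⟩, hx3⟩
    exact hx2 (mem_biUnion (show x ∈ F from ⟨hx3, hx1⟩) (hxV x))
  have hW : ∀ᶠ y in 𝓝 y₀, ∀ x ∈ F, y ∈ π '' V x := by
    rw [Filter.eventually_all_finite hF]
    intro x hx
    refine (hπ.isOpenMap _ (hVo x)).mem_nhds ⟨x, hxV x, hx.1⟩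
  filter_upwards [hW, hcl.isOpen_compl.mem_nhds hy₀] with y hy1 hy2
  have ht : ∀ x : X, ∃ z, x ∈ F → z ∈ V x ∧ π z = y := by
    intro x
    by_cases hx : x ∈ F
    · obtain ⟨z, hz, hz'⟩ := hy1 x hx
      exact ⟨z, fun _ => ⟨hz, hz'⟩⟩
    · exact ⟨x, fun h => absurd h hx⟩
  choose t ht using ht
  have h1 : fibreSum π f y₀ = ∑ᶠ x ∈ F, f x := by
    refine finsum_mem_inter_support_eq' _ _ _ ?_
    intro x hx
    exact ⟨fun h => ⟨h, subset_tsupport _ hx⟩, fun h => h.1⟩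
  have h2 : fibreSum π f y = ∑ᶠ x ∈ π ⁻¹' {y} ∩ ⋃ x ∈ F, V x, f x := by
    refine finsum_mem_inter_support_eq' _ _ _ ?_
    intro x hx
    refine ⟨fun h => ⟨h, ?_⟩, fun h => h.1⟩
    by_contra hn
    exact hy2 ⟨x, ⟨subset_tsupport _ hx, hn⟩, h⟩
  rw [h1, h2]
  symm
  refine finsum_mem_eq_of_bijOn t ⟨?_, ?_, ?_⟩ ?_
  · intro x hx
    exact ⟨(ht x hx).2, mem_biUnion hx (ht x hx).1⟩
  · intro x hx x' hx' h
    by_contra hne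
    refine Set.disjoint_left.1 (hUd hx hx' hne) (hVU x (ht x hx).1) ?_
    rw [h]
    exact hVU x' (ht x' hx').1
  · rintro z ⟨hz1, hz2⟩
    obtain ⟨x, hx, hzx⟩ := mem_iUnion₂.1 hz2
    refine ⟨x, hx, hVi x (ht x hx).1 hzx ?_⟩
    rw [(ht x hx).2]
    exact hz1.symm
  · intro x hx
    exact (hVf x _ (ht x hx).1).symm

theorem fibreSum_hasCompactSupport [T2Space Y] {π : X → Y} (hπ : IsLocalHomeomorph π)
    (f : C_c(X, ℤ)) : HasCompactSupport (fibreSum π f) := by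
  refine HasCompactSupport.intro (f.hasCompactSupport.isCompact.image hπ.continuous) ?_
  intro y hy
  refine finsum_mem_eq_zero_of_forall_eq_zero fun x hx => ?_
  by_contra hne
  exact hy ⟨x, subset_tsupport _ hne, hx⟩

/-- The homomorphism `π_* : C_c(X, ℤ) → C_c(Y, ℤ)`, `π_*(f)(y) = ∑_{π x = y} f x`, of a local
homeomorphism `π` between Hausdorff spaces. -/
def push [T2Space X] [T2Space Y] (π : X → Y) (hπ : IsLocalHomeomorph π) :
    C_c(X, ℤ) →+ C_c(Y, ℤ) where
  toFun f := ⟨⟨fibreSum π f, fibreSum_continuous hπ f⟩, fibreSum_hasCompactSupport hπ f⟩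
  map_zero' := by
    ext y
    exact finsum_mem_eq_zero_of_forall_eq_zero fun x _ => rfl
  map_add' f g := by
    ext y
    exact finsum_mem_add_distrib' (fibre_finite' hπ f y) (fibre_finite' hπ g y)

theorem push_apply [T2Space X] [T2Space Y] (π : X → Y) (hπ : IsLocalHomeomorph π)
    (f : C_c(X, ℤ)) (y : Y) : push π hπ f y = ∑ᶠ x ∈ π ⁻¹' {y}, f x := rfl

theorem push_push [T2Space X] [T2Space Y] [T2Space Z] {π : X → Y} (hπ : IsLocalHomeomorph π)
    {τ : Y → Z} (hτ : IsLocalHomeomorph τ) (f : C_c(X, ℤ)) :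
    push τ hτ (push π hπ f) = push (τ ∘ π) (hτ.comp hπ) f := by
  ext z
  have hfin := fibre_finite' (hτ.comp hπ) f z
  set S := (τ ∘ π) ⁻¹' {z} ∩ Function.support f with hS
  have h2 : ∀ y ∈ τ ⁻¹' {z}, push π hπ f y = ∑ᶠ x ∈ S ∩ π ⁻¹' {y}, f x := by
    intro y hy
    refine finsum_mem_inter_support_eq' _ _ _ ?_
    intro x hx
    refine ⟨fun h => ⟨⟨?_, hx⟩, h⟩, fun h => h.2⟩
    have : π x = y := h
    simpa [this] using hy
  have h3 : push τ hτ (push π hπ f) z = ∑ᶠ y ∈ π '' S, ∑ᶠ x ∈ S ∩ π ⁻¹' {y}, f x := by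
    rw [push_apply, finsum_mem_congr rfl h2]
    refine finsum_mem_inter_support_eq' _ _ _ ?_
    intro y hy
    constructor
    · intro _
      by_contra hn
      refine hy (finsum_mem_eq_zero_of_forall_eq_zero fun x hx => ?_)
      exact absurd ⟨x, hx.1, hx.2⟩ hn
    · rintro ⟨x, hx, rfl⟩
      exact hx.1
  rw [h3, ← finsum_mem_biUnion]
  · rw [push_apply]
    refine finsum_mem_inter_support_eq' _ _ _ ?_
    intro x hx
    constructor
    · intro h
      obtain ⟨_, _, h'⟩ := mem_iUnion₂.1 h
      exact h'.1.1
    · intro h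
      exact mem_biUnion (mem_image_of_mem π (show x ∈ S from ⟨h, hx⟩)) ⟨⟨h, hx⟩, rfl⟩
  · intro y _ y' _ hne
    refine Set.disjoint_left.2 fun x hx hx' => hne ?_
    rw [← show π x = y from hx.2, ← show π x = y' from hx'.2]
  · exact hfin.image π
  · intro y _
    exact hfin.inter_of_left _

theorem push_congr [T2Space X] [T2Space Y] {π τ : X → Y} (hπ : IsLocalHomeomorph π)
    (hτ : IsLocalHomeomorph τ) (h : π = τ) : push π hπ = push τ hτ := by
  subst h
  rfl

/-- The indicator function `1_S` of a compact open set `S`. -/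
def ind [T2Space X] (S : Set X) (hc : IsCompact S) (ho : IsOpen S) : C_c(X, ℤ) where
  toFun := S.indicator 1
  continuous_toFun := continuous_const.indicator (by
    intro x hx
    rw [(show IsClopen S from ⟨hc.isClosed, ho⟩).frontier_eq] at hx
    exact absurd hx (Set.notMem_empty x))
  hasCompactSupport' := HasCompactSupport.intro hc fun _ hx => Set.indicator_of_notMem hx _

theorem push_ind [T2Space X] [T2Space Y] {π : X → Y} (hπ : IsLocalHomeomorph π) {S : Set X}
    (hc : IsCompact S) (ho : IsOpen S) (hi : S.InjOn π) {T : Set Y} (hT : π '' S = T)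
    (hc' : IsCompact T) (ho' : IsOpen T) :
    push π hπ (ind S hc ho) = ind T hc' ho' := by
  subst hT
  ext y
  rw [push_apply]
  change ∑ᶠ x ∈ π ⁻¹' {y}, S.indicator 1 x = (π '' S).indicator 1 y
  by_cases hy : y ∈ π '' S
  · obtain ⟨x, hx, rfl⟩ := hy
    rw [Set.indicator_of_mem (mem_image_of_mem π hx)]
    have : ∑ᶠ z ∈ π ⁻¹' {π x}, S.indicator (1 : X → ℤ) z
        = ∑ᶠ z ∈ ({x} : Set X), S.indicator (1 : X → ℤ) z := by
      refine finsum_mem_inter_support_eq' _ _ _ ?_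
      intro z hz
      have hzS : z ∈ S := by
        by_contra hn
        exact hz (Set.indicator_of_notMem hn _)
      exact ⟨fun h => hi hzS hx h, fun h => congrArg π h⟩
    rw [this, finsum_mem_singleton, Set.indicator_of_mem hx]
    rfl
  · rw [Set.indicator_of_notMem hy]
    refine finsum_mem_eq_zero_of_forall_eq_zero fun x hx => ?_
    refine Set.indicator_of_notMem (fun hxS => hy ⟨x, hxS, hx⟩) _

end Pushforward

section Groupoids

theorem isLocalHomeomorph_of_isOpenMap {X Y : Type*} [TopologicalSpace X] [TopologicalSpace Y]
    {f : X → Y} (hc : Continuous f) (ho : IsOpenMap f) (hi : ∀ x, ∃ U ∈ 𝓝 x, U.InjOn f) :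
    IsLocalHomeomorph f := by
  rw [isLocalHomeomorph_iff_isOpenEmbedding_restrict]
  intro x
  obtain ⟨U, hU, hUi⟩ := hi x
  obtain ⟨W, hWU, hW, hxW⟩ := mem_nhds_iff.1 hU
  refine ⟨W, hW.mem_nhds hxW, .of_continuous_injective_isOpenMap
    (hc.comp continuous_subtype_val) ?_ (ho.comp hW.isOpenMap_subtype_val)⟩
  exact (hUi.mono hWU).injective

theorem exists_injOn {X Y : Type*} [TopologicalSpace X] [TopologicalSpace Y] {f : X → Y}
    (hf : IsLocalHomeomorph f) (x : X) : ∃ U ∈ 𝓝 x, U.InjOn f := by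
  obtain ⟨e, hx, rfl⟩ := hf x
  exact ⟨e.source, e.open_source.mem_nhds hx, e.injOn⟩

theorem isOpenEmbedding_prodMk_zero (X : Type*) [TopologicalSpace X] :
    IsOpenEmbedding fun x : X => (x, (0 : ℤ)) := by
  refine .of_continuous_injective_isOpenMap (by fun_prop)
    (fun x y h => congrArg Prod.fst h) fun U hU => ?_
  convert hU.prod (isOpen_discrete {(0 : ℤ)}) using 1
  ext ⟨x, k⟩
  constructor
  · rintro ⟨y, hy, h⟩
    cases h
    exact ⟨hy, rfl⟩
  · rintro ⟨hx, hk⟩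
    have hk : k = 0 := hk
    exact ⟨x, hx, by rw [hk]⟩

/-- A Hausdorff étale groupoid with space of arrows `G` and unit space `X`; the unit at `x` is
`one x`, and `mul g h` is defined when `s(g) = r(h)`. -/
structure EtaleGroupoid (G X : Type*) [TopologicalSpace G] [TopologicalSpace X] where
  src : G → X
  rng : G → X
  one : X → G
  inv : G → G
  mul : (g h : G) → src g = rng h → G
  src_one : ∀ x, src (one x) = x
  rng_one : ∀ x, rng (one x) = x
  src_inv : ∀ g, src (inv g) = rng g
  rng_inv : ∀ g, rng (inv g) = src g
  src_mul : ∀ g h p, src (mul g h p) = src h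
  rng_mul : ∀ g h p, rng (mul g h p) = rng g
  mul_assoc : ∀ g h k (p : src g = rng h) (q : src h = rng k),
    mul (mul g h p) k ((src_mul g h p).trans q) = mul g (mul h k q) (p.trans (rng_mul h k q).symm)
  one_mul : ∀ g, mul (one (rng g)) g (src_one _) = g
  mul_one : ∀ g, mul g (one (src g)) (rng_one _).symm = g
  inv_mul : ∀ g, mul (inv g) g (src_inv g) = one (src g)
  mul_inv : ∀ g, mul g (inv g) (rng_inv g).symm = one (rng g)
  t2_arrows : T2Space G
  t2_units : T2Space X
  continuous_one : Continuous one
  continuous_inv : Continuous inv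
  continuous_mul : Continuous fun p : {p : G × G // src p.1 = rng p.2} => mul p.1.1 p.1.2 p.2
  isLocalHomeomorph_src : IsLocalHomeomorph src

namespace EtaleGroupoid

variable {G X : Type*} [TopologicalSpace G] [TopologicalSpace X] (𝒢 : EtaleGroupoid G X)

theorem mul_congr {g g' h h' : G} (hg : g = g') (hh : h = h') (p : 𝒢.src g = 𝒢.rng h)
    (p' : 𝒢.src g' = 𝒢.rng h') : 𝒢.mul g h p = 𝒢.mul g' h' p' := by
  subst hg
  subst hh
  rfl

theorem inv_inv (g : G) : 𝒢.inv (𝒢.inv g) = g := by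
  have h1 := 𝒢.mul_assoc (𝒢.inv (𝒢.inv g)) (𝒢.inv g) g (𝒢.src_inv _) (𝒢.src_inv _)
  have h2 := 𝒢.one_mul g
  have h3 := 𝒢.mul_one (𝒢.inv (𝒢.inv g))
  rw [𝒢.mul_congr (𝒢.inv_mul (𝒢.inv g)) rfl _ ((𝒢.src_one _).trans (𝒢.src_inv g)),
    𝒢.mul_congr rfl (𝒢.inv_mul g) _
      (((𝒢.src_inv _).trans (𝒢.rng_inv g)).trans (𝒢.rng_one _).symm)] at h1
  rw [𝒢.mul_congr (g' := 𝒢.one (𝒢.rng g)) (by rw [𝒢.src_inv]) rfl _ (𝒢.src_one _), h2] at h1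
  refine (Eq.trans h1 ?_).symm
  refine Eq.trans ?_ h3
  exact 𝒢.mul_congr rfl (by rw [𝒢.src_inv, 𝒢.rng_inv]) _ _

theorem isLocalHomeomorph_inv : IsLocalHomeomorph 𝒢.inv :=
  (Homeomorph.mk ⟨𝒢.inv, 𝒢.inv, 𝒢.inv_inv, 𝒢.inv_inv⟩ 𝒢.continuous_inv
    𝒢.continuous_inv).isLocalHomeomorph

theorem isLocalHomeomorph_rng : IsLocalHomeomorph 𝒢.rng := by
  have h : 𝒢.rng = 𝒢.src ∘ 𝒢.inv := funext fun g => (𝒢.src_inv g).symm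
  rw [h]
  exact 𝒢.isLocalHomeomorph_src.comp 𝒢.isLocalHomeomorph_inv

/-- The space `G^(2)` of composable pairs. -/
abbrev Comp : Type _ := {p : G × G // 𝒢.src p.1 = 𝒢.rng p.2}

/-- The face map `d_0(g, h) = h`. -/
def d0 (p : 𝒢.Comp) : G := p.1.2

/-- The face map `d_1(g, h) = gh`. -/
def d1 (p : 𝒢.Comp) : G := 𝒢.mul p.1.1 p.1.2 p.2

/-- The face map `d_2(g, h) = g`. -/
def d2 (p : 𝒢.Comp) : G := p.1.1

theorem isLocalHomeomorph_d0 : IsLocalHomeomorph 𝒢.d0 := by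
  refine isLocalHomeomorph_of_isOpenMap (continuous_snd.comp continuous_subtype_val) ?_ ?_
  · rw [isOpenMap_iff_nhds_le]
    rintro ⟨⟨g, h⟩, p⟩ W hW
    obtain ⟨T, hT, hTW⟩ :=
      (mem_nhds_subtype {p : G × G | 𝒢.src p.1 = 𝒢.rng p.2} _ _).1 (Filter.mem_map.1 hW)
    obtain ⟨N, hN, M, hM, hNM⟩ := mem_nhds_prod_iff.1 hT
    have h1 : 𝒢.src '' N ∈ 𝓝 (𝒢.rng h) := by
      rw [← show 𝒢.src g = 𝒢.rng h from p]
      exact 𝒢.isLocalHomeomorph_src.isOpenMap.image_mem_nhds hN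
    filter_upwards [hM, 𝒢.isLocalHomeomorph_rng.continuous.continuousAt h1] with k hk hk'
    obtain ⟨g', hg', hg''⟩ := hk'
    exact hTW (a := ⟨(g', k), hg''⟩) (hNM ⟨hg', hk⟩)
  · rintro ⟨⟨g, h⟩, p⟩
    obtain ⟨U, hU, hUi⟩ := exists_injOn 𝒢.isLocalHomeomorph_src g
    refine ⟨{q | q.1.1 ∈ U}, (continuous_fst.comp continuous_subtype_val).continuousAt hU, ?_⟩
    rintro ⟨⟨g₁, h₁⟩, p₁⟩ q₁ ⟨⟨g₂, h₂⟩, p₂⟩ q₂ (rfl : h₁ = h₂)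
    have : g₁ = g₂ := hUi q₁ q₂ (p₁.trans p₂.symm)
    subst this
    rfl

theorem isLocalHomeomorph_d2 : IsLocalHomeomorph 𝒢.d2 := by
  refine isLocalHomeomorph_of_isOpenMap (continuous_fst.comp continuous_subtype_val) ?_ ?_
  · rw [isOpenMap_iff_nhds_le]
    rintro ⟨⟨g, h⟩, p⟩ W hW
    obtain ⟨T, hT, hTW⟩ :=
      (mem_nhds_subtype {p : G × G | 𝒢.src p.1 = 𝒢.rng p.2} _ _).1 (Filter.mem_map.1 hW)
    obtain ⟨N, hN, M, hM, hNM⟩ := mem_nhds_prod_iff.1 hT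
    have h1 : 𝒢.rng '' M ∈ 𝓝 (𝒢.src g) := by
      rw [show 𝒢.src g = 𝒢.rng h from p]
      exact 𝒢.isLocalHomeomorph_rng.isOpenMap.image_mem_nhds hM
    filter_upwards [hN, 𝒢.isLocalHomeomorph_src.continuous.continuousAt h1] with k hk hk'
    obtain ⟨h', hh', hh''⟩ := hk'
    exact hTW (a := ⟨(k, h'), hh''.symm⟩) (hNM ⟨hk, hh'⟩)
  · rintro ⟨⟨g, h⟩, p⟩
    obtain ⟨U, hU, hUi⟩ := exists_injOn 𝒢.isLocalHomeomorph_rng h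
    refine ⟨{q | q.1.2 ∈ U}, (continuous_snd.comp continuous_subtype_val).continuousAt hU, ?_⟩
    rintro ⟨⟨g₁, h₁⟩, p₁⟩ q₁ ⟨⟨g₂, h₂⟩, p₂⟩ q₂ (rfl : g₁ = g₂)
    have : h₁ = h₂ := hUi q₁ q₂ (p₁.symm.trans p₂)
    subst this
    rfl

theorem isLocalHomeomorph_d1 : IsLocalHomeomorph 𝒢.d1 := by
  refine IsLocalHomeomorph.of_comp (g := 𝒢.src) ?_ 𝒢.isLocalHomeomorph_src 𝒢.continuous_mul
  have h : 𝒢.src ∘ 𝒢.d1 = 𝒢.src ∘ 𝒢.d0 := funext fun p => 𝒢.src_mul _ _ _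
  rw [h]
  exact 𝒢.isLocalHomeomorph_src.comp 𝒢.isLocalHomeomorph_d0

instance t2_comp : T2Space 𝒢.Comp :=
  haveI := 𝒢.t2_arrows
  inferInstance

/-- `δ_1 = s_* - r_*`. -/
def δ₁ : C_c(G, ℤ) →+ C_c(X, ℤ) :=
  haveI := 𝒢.t2_arrows
  haveI := 𝒢.t2_units
  push 𝒢.src 𝒢.isLocalHomeomorph_src - push 𝒢.rng 𝒢.isLocalHomeomorph_rng

/-- `δ_2 = (d_0)_* - (d_1)_* + (d_2)_*`. -/
def δ₂ : C_c(𝒢.Comp, ℤ) →+ C_c(G, ℤ) :=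
  haveI := 𝒢.t2_arrows
  push 𝒢.d0 𝒢.isLocalHomeomorph_d0 - push 𝒢.d1 𝒢.isLocalHomeomorph_d1
    + push 𝒢.d2 𝒢.isLocalHomeomorph_d2

theorem δ₁_δ₂ (f : C_c(𝒢.Comp, ℤ)) : 𝒢.δ₁ (𝒢.δ₂ f) = 0 := by
  have := 𝒢.t2_arrows
  have := 𝒢.t2_units
  simp only [δ₁, δ₂, AddMonoidHom.sub_apply, AddMonoidHom.add_apply, map_add, map_sub, push_push]
  rw [push_congr _ (𝒢.isLocalHomeomorph_src.comp 𝒢.isLocalHomeomorph_d0)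
      (show 𝒢.src ∘ 𝒢.d1 = 𝒢.src ∘ 𝒢.d0 from funext fun p => 𝒢.src_mul _ _ _),
    push_congr _ (𝒢.isLocalHomeomorph_rng.comp 𝒢.isLocalHomeomorph_d2)
      (show 𝒢.rng ∘ 𝒢.d1 = 𝒢.rng ∘ 𝒢.d2 from funext fun p => 𝒢.rng_mul _ _ _),
    push_congr _ (𝒢.isLocalHomeomorph_rng.comp 𝒢.isLocalHomeomorph_d0)
      (show 𝒢.src ∘ 𝒢.d2 = 𝒢.rng ∘ 𝒢.d0 from funext fun p => p.2)]
  abel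

/-- `H_0(𝒢) = coker δ_1`. -/
abbrev H₀ : Type _ := C_c(X, ℤ) ⧸ 𝒢.δ₁.range

/-- `H_1(𝒢) = ker δ_1 / im δ_2`. -/
abbrev H₁ : Type _ := 𝒢.δ₁.ker ⧸ 𝒢.δ₂.range.addSubgroupOf 𝒢.δ₁.ker

/-- The class in `H_0(𝒢)` of a function on the unit space. -/
def cls₀ (f : C_c(X, ℤ)) : 𝒢.H₀ := QuotientAddGroup.mk f

/-- The class in `H_1(𝒢)` of a cycle. -/
def cls₁ (f : C_c(G, ℤ)) (hf : 𝒢.δ₁ f = 0) : 𝒢.H₁ :=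
  QuotientAddGroup.mk (⟨f, hf⟩ : 𝒢.δ₁.ker)

end EtaleGroupoid

/-- A groupoid homomorphism that is a local homeomorphism on arrows and on units. -/
structure EtaleHom {G X G' X' : Type*} [TopologicalSpace G] [TopologicalSpace X]
    [TopologicalSpace G'] [TopologicalSpace X'] (𝒢 : EtaleGroupoid G X)
    (𝒢' : EtaleGroupoid G' X') where
  arr : G → G'
  pt : X → X'
  src_arr : ∀ g, 𝒢'.src (arr g) = pt (𝒢.src g)
  rng_arr : ∀ g, 𝒢'.rng (arr g) = pt (𝒢.rng g)
  arr_mul : ∀ g h p, arr (𝒢.mul g h p)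
    = 𝒢'.mul (arr g) (arr h) (by rw [src_arr, rng_arr, p])
  isLocalHomeomorph_arr : IsLocalHomeomorph arr
  isLocalHomeomorph_pt : IsLocalHomeomorph pt

namespace EtaleHom

variable {G X G' X' : Type*} [TopologicalSpace G] [TopologicalSpace X]
  [TopologicalSpace G'] [TopologicalSpace X'] {𝒢 : EtaleGroupoid G X}
  {𝒢' : EtaleGroupoid G' X'} (F : EtaleHom 𝒢 𝒢')

/-- The map induced on composable pairs. -/
def comp (p : 𝒢.Comp) : 𝒢'.Comp :=
  ⟨(F.arr p.1.1, F.arr p.1.2), by rw [F.src_arr, F.rng_arr, p.2]⟩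

theorem isLocalHomeomorph_comp : IsLocalHomeomorph F.comp := by
  refine IsLocalHomeomorph.of_comp (g := 𝒢'.d0)
    (F.isLocalHomeomorph_arr.comp 𝒢.isLocalHomeomorph_d0) 𝒢'.isLocalHomeomorph_d0 ?_
  have h := F.isLocalHomeomorph_arr.continuous
  exact ((h.comp (continuous_fst.comp continuous_subtype_val)).prodMk
    (h.comp (continuous_snd.comp continuous_subtype_val))).subtype_mk _

/-- The map induced on chains in degree zero. -/
def chain₀ : C_c(X, ℤ) →+ C_c(X', ℤ) :=
  haveI := 𝒢.t2_units
  haveI := 𝒢'.t2_units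
  push F.pt F.isLocalHomeomorph_pt

/-- The map induced on chains in degree one. -/
def chain₁ : C_c(G, ℤ) →+ C_c(G', ℤ) :=
  haveI := 𝒢.t2_arrows
  haveI := 𝒢'.t2_arrows
  push F.arr F.isLocalHomeomorph_arr

/-- The map induced on chains in degree two. -/
def chain₂ : C_c(𝒢.Comp, ℤ) →+ C_c(𝒢'.Comp, ℤ) :=
  push F.comp F.isLocalHomeomorph_comp

theorem δ₁_chain₁ (f : C_c(G, ℤ)) : 𝒢'.δ₁ (F.chain₁ f) = F.chain₀ (𝒢.δ₁ f) := by
  have := 𝒢.t2_arrows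
  have := 𝒢'.t2_arrows
  have := 𝒢.t2_units
  have := 𝒢'.t2_units
  simp only [EtaleGroupoid.δ₁, chain₀, chain₁, AddMonoidHom.sub_apply, map_sub, push_push]
  rw [push_congr _ (F.isLocalHomeomorph_pt.comp 𝒢.isLocalHomeomorph_src)
      (show 𝒢'.src ∘ F.arr = F.pt ∘ 𝒢.src from funext F.src_arr),
    push_congr _ (F.isLocalHomeomorph_pt.comp 𝒢.isLocalHomeomorph_rng)
      (show 𝒢'.rng ∘ F.arr = F.pt ∘ 𝒢.rng from funext F.rng_arr)]

theorem δ₂_chain₂ (f : C_c(𝒢.Comp, ℤ)) : 𝒢'.δ₂ (F.chain₂ f) = F.chain₁ (𝒢.δ₂ f) := by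
  have := 𝒢.t2_arrows
  have := 𝒢'.t2_arrows
  simp only [EtaleGroupoid.δ₂, chain₁, chain₂, AddMonoidHom.sub_apply, AddMonoidHom.add_apply,
    map_add, map_sub, push_push]
  rw [push_congr _ (F.isLocalHomeomorph_arr.comp 𝒢.isLocalHomeomorph_d1)
      (show 𝒢'.d1 ∘ F.comp = F.arr ∘ 𝒢.d1 from funext fun p => (F.arr_mul _ _ _).symm)]
  rfl

/-- The map induced on `H_0`. -/
def mapH₀ : 𝒢.H₀ →+ 𝒢'.H₀ :=
  QuotientAddGroup.map _ _ F.chain₀ (by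
    rintro _ ⟨f, rfl⟩
    exact ⟨F.chain₁ f, F.δ₁_chain₁ f⟩)

/-- The map induced on `1`-cycles. -/
def cycle : 𝒢.δ₁.ker →+ 𝒢'.δ₁.ker where
  toFun f := ⟨F.chain₁ f.1, by
    rw [AddMonoidHom.mem_ker, F.δ₁_chain₁, (AddMonoidHom.mem_ker).1 f.2, map_zero]⟩
  map_zero' := Subtype.ext (map_zero F.chain₁)
  map_add' f g := Subtype.ext (map_add F.chain₁ f.1 g.1)

/-- The map induced on `H_1`. -/
def mapH₁ : 𝒢.H₁ →+ 𝒢'.H₁ :=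
  QuotientAddGroup.map _ _ F.cycle (by
    rintro ⟨f, hf⟩ ⟨k, hk⟩
    refine ⟨F.chain₂ k, ?_⟩
    rw [F.δ₂_chain₂, hk]
    rfl)

end EtaleHom

section Skew

variable {G X : Type*} [TopologicalSpace G] [TopologicalSpace X] (𝒢 : EtaleGroupoid G X)

/-- A continuous groupoid homomorphism `𝒢 → ℤ`. -/
structure Cocycle where
  toFun : G → ℤ
  map_mul : ∀ g h p, toFun (𝒢.mul g h p) = toFun g + toFun h
  continuous_toFun : Continuous toFun

variable {𝒢} (ρ : Cocycle 𝒢)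

theorem Cocycle.map_one (x : X) : ρ.toFun (𝒢.one x) = 0 := by
  have h := ρ.map_mul (𝒢.one x) (𝒢.one x) (by rw [𝒢.src_one, 𝒢.rng_one])
  have h' := 𝒢.one_mul (𝒢.one x)
  rw [𝒢.mul_congr (g' := 𝒢.one x) (by rw [𝒢.rng_one]) rfl _
    (by rw [𝒢.src_one, 𝒢.rng_one])] at h'
  rw [h'] at h
  omega

theorem Cocycle.map_inv (g : G) : ρ.toFun (𝒢.inv g) = - ρ.toFun g := by
  have h := ρ.map_mul (𝒢.inv g) g (𝒢.src_inv g)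
  rw [𝒢.inv_mul, ρ.map_one] at h
  omega

/-- The skew product `𝒢 ×_ρ ℤ`: `(g, k)` and `(h, l)` are composable iff `g` and `h` are and
`k + ρ(g) = l`, with `(g, k)(h, k + ρ(g)) = (gh, k)` and `(g, k)⁻¹ = (g⁻¹, k + ρ(g))`. -/
def skew : EtaleGroupoid (G × ℤ) (X × ℤ) where
  src a := (𝒢.src a.1, a.2 + ρ.toFun a.1)
  rng a := (𝒢.rng a.1, a.2)
  one y := (𝒢.one y.1, y.2)
  inv a := (𝒢.inv a.1, a.2 + ρ.toFun a.1)
  mul a b p := (𝒢.mul a.1 b.1 (congrArg Prod.fst p), a.2)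
  src_one y := by simp [𝒢.src_one, ρ.map_one]
  rng_one y := by simp [𝒢.rng_one]
  src_inv a := by simp [𝒢.src_inv, ρ.map_inv]
  rng_inv a := by simp [𝒢.rng_inv]
  src_mul a b p := by
    have h : a.2 + ρ.toFun a.1 = b.2 := congrArg Prod.snd p
    simp only [𝒢.src_mul, ρ.map_mul, ← h, add_assoc]
  rng_mul a b p := by simp [𝒢.rng_mul]
  mul_assoc a b c p q := Prod.ext (𝒢.mul_assoc a.1 b.1 c.1 (congrArg Prod.fst p)
    (congrArg Prod.fst q)) rfl
  one_mul a := by simp [𝒢.one_mul]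
  mul_one a := by simp [𝒢.mul_one]
  inv_mul a := by simp [𝒢.inv_mul]
  mul_inv a := by simp [𝒢.mul_inv]
  t2_arrows := haveI := 𝒢.t2_arrows; inferInstance
  t2_units := haveI := 𝒢.t2_units; inferInstance
  continuous_one := (𝒢.continuous_one.comp continuous_fst).prodMk continuous_snd
  continuous_inv := (𝒢.continuous_inv.comp continuous_fst).prodMk
    (continuous_snd.add (ρ.continuous_toFun.comp continuous_fst))
  continuous_mul := by
    refine Continuous.prodMk ?_ (continuous_snd.comp (continuous_fst.comp continuous_subtype_val))
    refine 𝒢.continuous_mul.comp (Continuous.subtype_mk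
      (f := fun p : {p : (G × ℤ) × (G × ℤ) // (𝒢.src p.1.1, p.1.2 + ρ.toFun p.1.1)
        = (𝒢.rng p.2.1, p.2.2)} => (p.1.1.1, p.1.2.1)) ?_ fun p => congrArg Prod.fst p.2)
    fun_prop
  isLocalHomeomorph_src := by
    have hc := ρ.continuous_toFun
    have hs := 𝒢.isLocalHomeomorph_src.continuous
    refine isLocalHomeomorph_of_isOpenMap (by fun_prop) ?_ ?_
    · rw [isOpenMap_iff_nhds_le]
      rintro ⟨g, k⟩ W hW
      rw [Filter.mem_map, nhds_prod_eq, nhds_discrete ℤ, Filter.prod_pure, Filter.mem_map] at hW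
      rw [nhds_prod_eq, nhds_discrete ℤ, Filter.prod_pure, Filter.mem_map]
      have h1 : {g' | ρ.toFun g' = ρ.toFun g} ∈ 𝓝 g :=
        hc.continuousAt ((isOpen_discrete {ρ.toFun g}).mem_nhds rfl)
      filter_upwards [𝒢.isLocalHomeomorph_src.isOpenMap.image_mem_nhds (Filter.inter_mem hW h1)]
        with x hx
      obtain ⟨g', ⟨h2, h3⟩, rfl⟩ := hx
      have h4 : ρ.toFun g' = ρ.toFun g := h3
      have h5 : (𝒢.src g', k + ρ.toFun g') ∈ W := h2
      rwa [h4] at h5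
    · rintro ⟨g, k⟩
      obtain ⟨U, hU, hUi⟩ := exists_injOn 𝒢.isLocalHomeomorph_src g
      refine ⟨U ×ˢ univ, prod_mem_nhds hU Filter.univ_mem, ?_⟩
      rintro ⟨g₁, k₁⟩ h₁ ⟨g₂, k₂⟩ h₂ h
      have h3 : g₁ = g₂ := hUi h₁.1 h₂.1 (congrArg Prod.fst h)
      subst h3
      have h4 : k₁ + ρ.toFun g₁ = k₂ + ρ.toFun g₁ := congrArg Prod.snd h
      rw [add_right_cancel h4]

/-- The dual action on the skew product: `ρ̂^m (g, k) = (g, m + k)`. -/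
def dual (m : ℤ) : EtaleHom (skew ρ) (skew ρ) where
  arr a := (a.1, m + a.2)
  pt y := (y.1, m + y.2)
  src_arr a := by simp [skew, add_assoc]
  rng_arr a := rfl
  arr_mul a b p := rfl
  isLocalHomeomorph_arr := ((Homeomorph.refl G).prodCongr (Homeomorph.addLeft m)).isLocalHomeomorph
  isLocalHomeomorph_pt := ((Homeomorph.refl X).prodCongr (Homeomorph.addLeft m)).isLocalHomeomorph

theorem Cocycle.isOpen_ker : IsOpen {g : G | ρ.toFun g = 0} :=
  (isOpen_discrete {(0 : ℤ)}).preimage ρ.continuous_toFun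

/-- The open subgroupoid `ker ρ`, with the same unit space. -/
def kernel : EtaleGroupoid {g : G // ρ.toFun g = 0} X where
  src g := 𝒢.src g.1
  rng g := 𝒢.rng g.1
  one x := ⟨𝒢.one x, ρ.map_one x⟩
  inv g := ⟨𝒢.inv g.1, by rw [ρ.map_inv, g.2, neg_zero]⟩
  mul g h p := ⟨𝒢.mul g.1 h.1 p, by rw [ρ.map_mul, g.2, h.2, add_zero]⟩
  src_one x := 𝒢.src_one x
  rng_one x := 𝒢.rng_one x
  src_inv g := 𝒢.src_inv g.1
  rng_inv g := 𝒢.rng_inv g.1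
  src_mul g h p := 𝒢.src_mul g.1 h.1 p
  rng_mul g h p := 𝒢.rng_mul g.1 h.1 p
  mul_assoc g h k p q := Subtype.ext (𝒢.mul_assoc g.1 h.1 k.1 p q)
  one_mul g := Subtype.ext (𝒢.one_mul g.1)
  mul_one g := Subtype.ext (𝒢.mul_one g.1)
  inv_mul g := Subtype.ext (𝒢.inv_mul g.1)
  mul_inv g := Subtype.ext (𝒢.mul_inv g.1)
  t2_arrows := haveI := 𝒢.t2_arrows; inferInstance
  t2_units := 𝒢.t2_units
  continuous_one := Topology.IsInducing.subtypeVal.continuous_iff.2 𝒢.continuous_one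
  continuous_inv := Topology.IsInducing.subtypeVal.continuous_iff.2
    (𝒢.continuous_inv.comp continuous_subtype_val)
  continuous_mul := by
    refine Topology.IsInducing.subtypeVal.continuous_iff.2 (𝒢.continuous_mul.comp
      (Continuous.subtype_mk (f := fun p : {p : {g : G // ρ.toFun g = 0} × {g : G // ρ.toFun g = 0} //
        𝒢.src p.1.1 = 𝒢.rng p.2.1} => (p.1.1.1, p.1.2.1)) ?_ fun p => p.2))
    fun_prop
  isLocalHomeomorph_src :=
    𝒢.isLocalHomeomorph_src.comp ρ.isOpen_ker.isOpenEmbedding_subtypeVal.isLocalHomeomorph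

/-- The embedding `ker ρ → 𝒢 ×_ρ ℤ`, `g ↦ (g, 0)`, which identifies `ker ρ` with the restriction
of `𝒢 ×_ρ ℤ` to the open set `𝒢^(0) × {0}`. -/
def incl : EtaleHom (kernel ρ) (skew ρ) where
  arr g := (g.1, 0)
  pt x := (x, 0)
  src_arr g := by simp [skew, kernel, g.2]
  rng_arr g := rfl
  arr_mul g h p := rfl
  isLocalHomeomorph_arr := IsLocalHomeomorph.comp (isOpenEmbedding_prodMk_zero G).isLocalHomeomorph
    ρ.isOpen_ker.isOpenEmbedding_subtypeVal.isLocalHomeomorph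
  isLocalHomeomorph_pt := (isOpenEmbedding_prodMk_zero X).isLocalHomeomorph

/-- If the embedding of `ker ρ` induces an isomorphism on `H_0`, this is the inverse isomorphism
`Ψ : H_0(𝒢 ×_ρ ℤ) → H_0(ker ρ)`, `[f] ↦ [f]`. -/
def Ψ₀ (h : Function.Bijective (incl ρ).mapH₀) : (skew ρ).H₀ ≃+ (kernel ρ).H₀ :=
  (AddEquiv.ofBijective (incl ρ).mapH₀ h).symm

/-- The same in degree one. -/
def Ψ₁ (h : Function.Bijective (incl ρ).mapH₁) : (skew ρ).H₁ ≃+ (kernel ρ).H₁ :=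
  (AddEquiv.ofBijective (incl ρ).mapH₁ h).symm

/-- The action `ρ̃^m = Ψ ∘ ρ̂^m ∘ Ψ⁻¹` of `m : ℤ` on `H_0(ker ρ)`. -/
def tilde₀ (h : Function.Bijective (incl ρ).mapH₀) (m : ℤ) : (kernel ρ).H₀ →+ (kernel ρ).H₀ :=
  ((Ψ₀ ρ h).toAddMonoidHom.comp (dual ρ m).mapH₀).comp (Ψ₀ ρ h).symm.toAddMonoidHom

/-- The action `ρ̃^m = Ψ ∘ ρ̂^m ∘ Ψ⁻¹` of `m : ℤ` on `H_1(ker ρ)`. -/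
def tilde₁ (h : Function.Bijective (incl ρ).mapH₁) (m : ℤ) : (kernel ρ).H₁ →+ (kernel ρ).H₁ :=
  ((Ψ₁ ρ h).toAddMonoidHom.comp (dual ρ m).mapH₁).comp (Ψ₁ ρ h).symm.toAddMonoidHom

end Skew

end Groupoids

section Paths

universe u

variable {V : Type u} (A B : Matrix V V ℤ)

/-- Every row has only finitely many nonzero entries. -/
def RowFinite (M : Matrix V V ℤ) : Prop := ∀ i, {j | M i j ≠ 0}.Finite

/-- The edges `e_{i,j,n}`, `0 ≤ n < A i j`, with source `i` and range `j`. -/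
@[ext] structure Edge where
  s : V
  r : V
  idx : ℤ
  nonneg : 0 ≤ idx
  lt : idx < A s r

instance : TopologicalSpace (Edge A) := ⊥
instance : DiscreteTopology (Edge A) := ⟨rfl⟩

variable {A}

theorem Edge.pos (e : Edge A) : 0 < A e.s e.r := lt_of_le_of_lt e.nonneg e.lt

/-- `κ_m(e_{i,j,n}) = e_{i,j,l}` where `m B_{i,j} + n = k A_{i,j} + l`, `0 ≤ l < A_{i,j}`. -/
def Edge.act (m : ℤ) (e : Edge A) : Edge A where
  s := e.s
  r := e.r
  idx := (m * B e.s e.r + e.idx) % A e.s e.r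
  nonneg := Int.emod_nonneg _ e.pos.ne'
  lt := Int.emod_lt_of_pos _ e.pos

/-- `φ(m, e_{i,j,n}) = k` where `m B_{i,j} + n = k A_{i,j} + l`, `0 ≤ l < A_{i,j}`. -/
def Edge.coc (m : ℤ) (e : Edge A) : ℤ := (m * B e.s e.r + e.idx) / A e.s e.r

theorem Edge.act_zero (e : Edge A) : e.act B 0 = e := by
  ext
  · rfl
  · rfl
  · simp [Edge.act, Int.emod_eq_of_lt e.nonneg e.lt]

theorem Edge.coc_zero (e : Edge A) : e.coc B 0 = 0 := by
  simp [Edge.coc, Int.ediv_eq_zero_of_lt e.nonneg e.lt]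

theorem Edge.eq_aux (m₁ m₂ : ℤ) (e : Edge A) : (m₁ + m₂) * B e.s e.r + e.idx
    = (m₁ * B e.s e.r + (e.act B m₂).idx) + A e.s e.r * e.coc B m₂ := by
  have h := Int.mul_ediv_add_emod (m₂ * B e.s e.r + e.idx) (A e.s e.r)
  simp only [Edge.act, Edge.coc]
  linarith

theorem Edge.act_add (m₁ m₂ : ℤ) (e : Edge A) :
    e.act B (m₁ + m₂) = (e.act B m₂).act B m₁ := by
  ext
  · rfl
  · rfl
  · change ((m₁ + m₂) * B e.s e.r + e.idx) % A e.s e.r = _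
    rw [Edge.eq_aux, Int.add_mul_emod_self_left]
    rfl

theorem Edge.coc_add (m₁ m₂ : ℤ) (e : Edge A) :
    e.coc B (m₁ + m₂) = (e.act B m₂).coc B m₁ + e.coc B m₂ := by
  change ((m₁ + m₂) * B e.s e.r + e.idx) / A e.s e.r = _
  rw [Edge.eq_aux, Int.add_mul_ediv_left _ _ e.pos.ne']
  rfl

variable (A) in
/-- The action `κ` is pseudo free. -/
def PseudoFree : Prop := ∀ (m : ℤ) (e : Edge A), e.act B m = e → e.coc B m = 0 → m = 0

variable {B} in
theorem PseudoFree.eq (hp : PseudoFree A B) {m m' : ℤ} {e : Edge A}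
    (h : e.act B m = e.act B m') (h' : e.coc B m = e.coc B m') : m = m' := by
  have h1 := Edge.act_add B (m - m') m' e
  have h2 := Edge.coc_add B (m - m') m' e
  rw [sub_add_cancel] at h1 h2
  have := hp (m - m') (e.act B m') (by rw [← h1, h]) (by omega)
  omega

variable (A) in
/-- The infinite path space, a subspace of the product of copies of the discrete edge set. -/
abbrev InfPath : Type u := {x : ℕ → Edge A // ∀ n, (x n).r = (x (n + 1)).s}

variable (A) in
/-- Finite paths: a source vertex and a list of consecutive edges starting there. The paths of
length zero are the vertices. -/
@[ext] structure FinPath where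
  s : V
  edges : List (Edge A)
  head : ∀ h : 0 < edges.length, edges[0].s = s
  link : ∀ (i : ℕ) (h : i + 1 < edges.length), (edges[i]).r = (edges[i + 1]).s

namespace FinPath

/-- The length `|α|`. -/
def len (α : FinPath A) : ℕ := α.edges.length

/-- The range `r(α)`. -/
def r (α : FinPath A) : V :=
  if h : 0 < α.edges.length then (α.edges[α.edges.length - 1]).r else α.s

theorem r_of_pos {α : FinPath A} (h : 0 < α.edges.length) :
    α.r = (α.edges[α.edges.length - 1]).r := dif_pos h

theorem r_of_not {α : FinPath A} (h : ¬ 0 < α.edges.length) : α.r = α.s := dif_neg h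

/-- The path `αe`. -/
def snoc (α : FinPath A) (e : Edge A) (h : α.r = e.s) : FinPath A where
  s := α.s
  edges := α.edges ++ [e]
  head _ := by
    by_cases hα : 0 < α.edges.length
    · rw [List.getElem_append_left hα]
      exact α.head hα
    · rw [List.getElem_append_right (by omega), ← r_of_not hα, h]
      simp
  link i hi := by
    simp only [List.length_append, List.length_singleton] at hi
    by_cases h' : i + 1 < α.edges.length
    · rw [List.getElem_append_left h', List.getElem_append_left (by omega)]
      exact α.link i h'
    · have h1 : i = α.edges.length - 1 := by omega
      rw [List.getElem_append_left (by omega), List.getElem_append_right (by omega)]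
      rw [r_of_pos (by omega)] at h
      simp only [h1, h, List.getElem_singleton]

/-- The infinite path `αy`. -/
def append (α : FinPath A) (y : InfPath A) (h : α.r = (y.1 0).s) : InfPath A :=
  ⟨fun n => if hn : n < α.edges.length then α.edges[n] else y.1 (n - α.edges.length), by
    intro n
    beta_reduce
    by_cases h1 : n + 1 < α.edges.length
    · rw [dif_pos h1, dif_pos (by omega)]
      exact α.link n h1
    · rw [dif_neg h1]
      by_cases h2 : n < α.edges.length
      · have h3 : n = α.edges.length - 1 := by omega
        have h4 : n + 1 - α.edges.length = 0 := by omega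
        rw [dif_pos h2, h4, ← h, r_of_pos (by omega)]
        simp only [h3]
      · rw [dif_neg h2, show n + 1 - α.edges.length = (n - α.edges.length) + 1 by omega]
        exact y.2 _⟩

end FinPath

namespace InfPath

/-- The initial segment `x_{|n}`. -/
def take (x : InfPath A) (n : ℕ) : FinPath A where
  s := (x.1 0).s
  edges := List.ofFn fun i : Fin n => x.1 i
  head h := by simp
  link i h := by simpa using x.2 i

/-- The remaining path after deleting `n` edges. -/
def drop (x : InfPath A) (n : ℕ) : InfPath A := ⟨fun i => x.1 (n + i), fun i => x.2 (n + i)⟩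

theorem length_take (x : InfPath A) (n : ℕ) : (x.take n).edges.length = n := by simp [take]

theorem len_take (x : InfPath A) (n : ℕ) : (x.take n).len = n := x.length_take n

theorem r_take (x : InfPath A) (n : ℕ) : (x.take n).r = (x.1 n).s := by
  cases n with
  | zero => exact FinPath.r_of_not (by simp [take])
  | succ n =>
    have h : ∀ k (hk : k < (x.take (n + 1)).edges.length), (x.take (n + 1)).edges[k] = x.1 k :=
      fun k hk => List.getElem_ofFn hk
    rw [FinPath.r_of_pos (by simp [take]), h, length_take]
    exact x.2 n

theorem take_succ (x : InfPath A) (n : ℕ) :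
    x.take (n + 1) = (x.take n).snoc (x.1 n) (x.r_take n) := by
  ext1
  · rfl
  · exact List.ofFn_succ_last

theorem take_eq_take_iff {x y : InfPath A} {n : ℕ} :
    x.take n = y.take n ↔ (x.1 0).s = (y.1 0).s ∧ ∀ i < n, x.1 i = y.1 i := by
  constructor
  · intro h
    refine ⟨congrArg FinPath.s h, fun i hi => ?_⟩
    have h1 : (List.ofFn fun i : Fin n => x.1 i) = List.ofFn fun i : Fin n => y.1 i :=
      congrArg FinPath.edges h
    exact congrFun (List.ofFn_injective h1) ⟨i, hi⟩
  · rintro ⟨h1, h2⟩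
    ext1
    · exact h1
    · exact congrArg List.ofFn (funext fun i => h2 i i.2)

theorem take_append (α : FinPath A) (y : InfPath A) (h : α.r = (y.1 0).s) :
    (α.append y h).take α.len = α := by
  ext1
  · change (dite _ _ _ : Edge A).s = _
    split_ifs with h0
    · exact α.head h0
    · rw [← FinPath.r_of_not h0, h, Nat.zero_sub]
  · refine List.ext_getElem (length_take _ _) fun i h1 h2 => ?_
    simp [take, FinPath.append, h2]

theorem drop_append (α : FinPath A) (y : InfPath A) (h : α.r = (y.1 0).s) :
    (α.append y h).drop α.len = y := by
  refine Subtype.ext (funext fun i => ?_)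
  simp [drop, FinPath.append, FinPath.len]

theorem append_take_drop (x : InfPath A) (n : ℕ) (h) : (x.take n).append (x.drop n) h = x := by
  refine Subtype.ext (funext fun i => ?_)
  change dite _ _ _ = _
  split_ifs with hi
  · simp [take]
  · rw [length_take] at hi ⊢
    change x.1 (n + (i - n)) = _
    rw [Nat.add_sub_cancel' (not_lt.1 hi)]

theorem drop_drop (x : InfPath A) (n k : ℕ) : (x.drop n).drop k = x.drop (n + k) :=
  Subtype.ext (funext fun i => congrArg x.1 (add_assoc n k i).symm)

/-- `φ(m, x_{|n})`, where `φ(m, αe) = φ(φ(m, α), e)`. -/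
def coc (m : ℤ) (x : InfPath A) : ℕ → ℤ
  | 0 => m
  | n + 1 => (x.1 n).coc B (coc m x n)

/-- The action `κ_m` on infinite paths, the `n`-th edge of `κ_m(x)` being
`κ_{φ(m, x_{|n})}(x_n)`. -/
def act (m : ℤ) (x : InfPath A) : InfPath A :=
  ⟨fun n => (x.1 n).act B (coc B m x n), fun n => x.2 n⟩

theorem coc_zero (x : InfPath A) (n : ℕ) : coc B 0 x n = 0 := by
  induction n with
  | zero => rfl
  | succ n ih => rw [coc, ih, Edge.coc_zero]

theorem act_zero (x : InfPath A) : x.act B 0 = x :=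
  Subtype.ext (funext fun n => by
    change (x.1 n).act B (coc B 0 x n) = _
    rw [coc_zero, Edge.act_zero])

theorem coc_add (m₁ m₂ : ℤ) (x : InfPath A) (n : ℕ) :
    coc B (m₁ + m₂) x n = coc B m₁ (x.act B m₂) n + coc B m₂ x n := by
  induction n with
  | zero => rfl
  | succ n ih =>
    rw [coc, ih, Edge.coc_add]
    rfl

theorem act_add (m₁ m₂ : ℤ) (x : InfPath A) : x.act B (m₁ + m₂) = (x.act B m₂).act B m₁ :=
  Subtype.ext (funext fun n => by
    change (x.1 n).act B (coc B (m₁ + m₂) x n) = _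
    rw [coc_add, Edge.act_add]
    rfl)

theorem coc_coc (m : ℤ) (x : InfPath A) (n k : ℕ) :
    coc B (coc B m x n) (x.drop n) k = coc B m x (n + k) := by
  induction k with
  | zero => rfl
  | succ k ih =>
    rw [coc, ih]
    rfl

theorem drop_act (m : ℤ) (x : InfPath A) (n : ℕ) :
    (x.act B m).drop n = (x.drop n).act B (coc B m x n) :=
  Subtype.ext (funext fun k => by
    change (x.1 (n + k)).act B _ = (x.1 (n + k)).act B _
    rw [coc_coc])

end InfPath

/-- The cylinder set `Z(α)` of the infinite paths with initial segment `α`. -/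
def cyl (α : FinPath A) : Set (InfPath A) := {x | x.take α.len = α}

end Paths

section KatsuraExelPardo

universe u

variable {V : Type u} {A : Matrix V V ℤ} (B : Matrix V V ℤ)

theorem FinPath.r_snoc (α : FinPath A) (e : Edge A) (h : α.r = e.s) : (α.snoc e h).r = e.r := by
  rw [FinPath.r_of_pos (by simp [FinPath.snoc])]
  simp [FinPath.snoc]

theorem FinPath.len_snoc (α : FinPath A) (e : Edge A) (h : α.r = e.s) :
    (α.snoc e h).len = α.len + 1 := by simp [FinPath.snoc, FinPath.len]

theorem FinPath.snoc_congr {α α' : FinPath A} {e e' : Edge A} (h : α.r = e.s) (h' : α'.r = e'.s)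
    (hα : α = α') (he : e = e') : α.snoc e h = α'.snoc e' h' := by
  subst hα
  subst he
  rfl

theorem FinPath.snoc_inj {α α' : FinPath A} {e e' : Edge A} {h : α.r = e.s} {h' : α'.r = e'.s}
    (hh : α.snoc e h = α'.snoc e' h') : α = α' ∧ e = e' := by
  have h1 : α.edges ++ [e] = α'.edges ++ [e'] := congrArg FinPath.edges hh
  have h2 := List.append_inj' h1 rfl
  refine ⟨FinPath.ext (congrArg FinPath.s hh :) h2.1, ?_⟩
  simpa using h2.2

variable (A) in
/-- The quadruples `(α, m, β; x)` with `r(α) = r(β)` and `x ∈ Z(β)`. -/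
@[ext] structure Quad where
  α : FinPath A
  m : ℤ
  β : FinPath A
  x : InfPath A
  hr : α.r = β.r
  hx : x ∈ cyl β

namespace Quad

variable {B}

/-- The infinite path `y` with `x = βy`. -/
def tail (q : Quad A) : InfPath A := q.x.drop q.β.len

theorem r_β (q : Quad A) : q.β.r = (q.x.1 q.β.len).s := by
  have h := q.x.r_take q.β.len
  rwa [show q.x.take q.β.len = q.β from q.hx] at h

variable (B)

/-- The infinite path `α κ_m(y)`, where `x = βy`. -/
def rng (q : Quad A) : InfPath A := q.α.append (q.tail.act B q.m) (q.hr.trans q.r_β)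

/-- The quadruple `(α κ_m(γ), φ(m, γ), βγ; x)`, where `x = βγy` with an edge `γ`. -/
def next (q : Quad A) : Quad A where
  α := q.α.snoc ((q.x.1 q.β.len).act B q.m) (q.hr.trans q.r_β)
  m := (q.x.1 q.β.len).coc B q.m
  β := q.β.snoc (q.x.1 q.β.len) q.r_β
  x := q.x
  hr := by
    rw [FinPath.r_snoc, FinPath.r_snoc]
    rfl
  hx := by
    change q.x.take _ = _
    rw [FinPath.len_snoc, InfPath.take_succ]
    exact FinPath.snoc_congr _ _ q.hx rfl

theorem r_α (q : Quad A) : q.α.r = ((q.x.1 q.β.len).act B q.m).s := q.hr.trans q.r_β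

/-- The quadruple with range `u`, source `x`, and initial segments of lengths `a` and `b`. -/
def ofPaths (u x : InfPath A) (a b : ℕ) (m : ℤ) (h : u.drop a = (x.drop b).act B m) : Quad A where
  α := u.take a
  m := m
  β := x.take b
  x := x
  hr := by
    rw [InfPath.r_take, InfPath.r_take]
    exact congrArg (fun z : InfPath A => (z.1 0).s) h
  hx := by
    change x.take _ = _
    rw [InfPath.len_take]

theorem rng_ofPaths (u x : InfPath A) (a b : ℕ) (m : ℤ) (h) : (ofPaths B u x a b m h).rng B = u := by
  have h1 : (ofPaths B u x a b m h).tail = x.drop b := by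
    change x.drop (x.take b).len = _
    rw [InfPath.len_take]
  have h2 : ∀ (y : InfPath A) (hy : y = u.drop a) (h3), (u.take a).append y h3 = u := by
    rintro y rfl h3
    exact InfPath.append_take_drop u a h3
  refine h2 _ ?_ _
  rw [h1, h]
  rfl

theorem exists_ofPaths (q : Quad A) : ∃ h, q = ofPaths B (q.rng B) q.x q.α.len q.β.len q.m h := by
  refine ⟨InfPath.drop_append _ _ _, ?_⟩
  ext1
  · exact (InfPath.take_append _ _ _).symm
  · rfl
  · exact q.hx.symm
  · rfl

theorem ofPaths_step {u x : InfPath A} {a b : ℕ} {m : ℤ} (h : u.drop a = (x.drop b).act B m) :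
    u.drop (a + 1) = (x.drop (b + 1)).act B ((x.1 b).coc B m) := by
  rw [← InfPath.drop_drop, h, InfPath.drop_act, InfPath.drop_drop]
  rfl

theorem next_ofPaths (u x : InfPath A) (a b : ℕ) (m : ℤ) (h) :
    (ofPaths B u x a b m h).next B
      = ofPaths B u x (a + 1) (b + 1) ((x.1 b).coc B m) (ofPaths_step B h) := by
  have hb : x.1 (x.take b).len = x.1 b := by rw [InfPath.len_take]
  have hu : u.1 a = (x.1 b).act B m := congrArg (fun z : InfPath A => z.1 0) h
  ext1
  · refine Eq.trans (FinPath.snoc_congr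
      ((ofPaths B u x a b m h).r_α B) (u.r_take a) rfl ?_) (u.take_succ a).symm
    rw [hu]
    exact congrArg (Edge.act B m) hb
  · exact congrArg (Edge.coc B m) hb
  · exact Eq.trans (FinPath.snoc_congr (ofPaths B u x a b m h).r_β (x.r_take b) rfl hb) (x.take_succ b).symm
  · rfl

theorem rng_next (q : Quad A) : (q.next B).rng B = q.rng B := by
  obtain ⟨h, hq⟩ := q.exists_ofPaths B
  generalize q.rng B = u at *
  rw [hq, next_ofPaths, rng_ofPaths]

/-- The quadruple `(β, -m, α; α κ_m(y))`, where `x = βy`. -/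
def inv (q : Quad A) : Quad A where
  α := q.β
  m := -q.m
  β := q.α
  x := q.rng B
  hr := q.hr.symm
  hx := InfPath.take_append _ _ _

theorem ofPaths_inv {u x : InfPath A} {a b : ℕ} {m : ℤ} (h : u.drop a = (x.drop b).act B m) :
    x.drop b = (u.drop a).act B (-m) := by
  rw [h, ← InfPath.act_add, neg_add_cancel, InfPath.act_zero]

theorem inv_ofPaths (u x : InfPath A) (a b : ℕ) (m : ℤ) (h) :
    (ofPaths B u x a b m h).inv B = ofPaths B x u b a (-m) (ofPaths_inv B h) := by
  ext1
  · rfl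
  · rfl
  · rfl
  · exact rng_ofPaths B u x a b m h

theorem ofPaths_congr {u u' x x' : InfPath A} {a a' b b' : ℕ} {m m' : ℤ} (h h') (hu : u = u')
    (hx : x = x') (ha : a = a') (hb : b = b') (hm : m = m') :
    ofPaths B u x a b m h = ofPaths B u' x' a' b' m' h' := by
  subst hu hx ha hb hm
  rfl

theorem next_inv (q : Quad A) : (q.next B).inv B = (q.inv B).next B := by
  obtain ⟨h, hq⟩ := q.exists_ofPaths B
  generalize q.rng B = u at *
  generalize q.x = x, q.α.len = a, q.β.len = b, q.m = m at *
  subst hq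
  rw [next_ofPaths, inv_ofPaths, inv_ofPaths, next_ofPaths]
  refine ofPaths_congr B _ _ rfl rfl rfl rfl ?_
  have hu : u.1 a = (x.1 b).act B m := congrArg (fun z : InfPath A => z.1 0) h
  have h1 := Edge.coc_add B (-m) m (x.1 b)
  rw [neg_add_cancel, Edge.coc_zero] at h1
  rw [hu]
  omega

theorem inv_inv (q : Quad A) : (q.inv B).inv B = q := by
  obtain ⟨h, hq⟩ := q.exists_ofPaths B
  generalize q.rng B = u at *
  generalize q.x = x, q.α.len = a, q.β.len = b, q.m = m at *
  subst hq
  rw [inv_ofPaths, inv_ofPaths]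
  exact ofPaths_congr B _ _ rfl rfl rfl rfl (neg_neg m)

/-- The product `(α, m', β; β κ_m(x)) (β, m, γ; γx) = (α, m' + m, γ; γx)`. -/
def mul (q q' : Quad A) (h : q.β = q'.α) : Quad A where
  α := q.α
  m := q.m + q'.m
  β := q'.β
  x := q'.x
  hr := q.hr.trans ((congrArg FinPath.r h).trans q'.hr)
  hx := q'.hx

theorem ofPaths_mul {u w x : InfPath A} {a b c : ℕ} {m' m : ℤ}
    (h : u.drop a = (w.drop b).act B m') (h' : w.drop b = (x.drop c).act B m) :
    u.drop a = (x.drop c).act B (m' + m) := by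
  rw [h, h', InfPath.act_add]

theorem mul_ofPaths (u w x : InfPath A) (a b c : ℕ) (m' m : ℤ) (h h') :
    (ofPaths B u w a b m' h).mul (ofPaths B w x b c m h') rfl
      = ofPaths B u x a c (m' + m) (ofPaths_mul B h h') := rfl

theorem mul_next (q q' : Quad A) (h : q.β = q'.α) (hx : q.x = q'.rng B) :
    ∃ h', (q.next B).mul (q'.next B) h' = (q.mul q' h).next B := by
  have hu : q.x.1 q.β.len = (q'.x.1 q'.β.len).act B q'.m := by
    have h1 := congrArg (fun z : InfPath A => z.1 0)
      (InfPath.drop_append q'.α (q'.tail.act B q'.m) (q'.hr.trans q'.r_β))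
    rw [h, hx]
    exact h1
  refine ⟨FinPath.snoc_congr q.r_β (q'.r_α B) h hu, ?_⟩
  have h1 := Edge.coc_add B q.m q'.m (q'.x.1 q'.β.len)
  ext1
  · refine FinPath.snoc_congr (q.r_α B) ((q.mul q' h).r_α B) rfl ?_
    rw [hu]
    exact (Edge.act_add B q.m q'.m _).symm
  · change (q.x.1 q.β.len).coc B q.m + _ = _
    rw [hu]
    exact h1.symm
  · rfl
  · rfl

theorem lenα_next (q : Quad A) : (q.next B).α.len = q.α.len + 1 :=
  FinPath.len_snoc _ _ (q.r_α B)

theorem lenβ_next (q : Quad A) : (q.next B).β.len = q.β.len + 1 := FinPath.len_snoc _ _ q.r_β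

theorem x_iterate (q : Quad A) (n : ℕ) : ((Quad.next B)^[n] q).x = q.x := by
  induction n with
  | zero => rfl
  | succ n ih =>
    rw [Function.iterate_succ_apply']
    exact ih

theorem rng_iterate (q : Quad A) (n : ℕ) : ((Quad.next B)^[n] q).rng B = q.rng B := by
  induction n with
  | zero => rfl
  | succ n ih => rw [Function.iterate_succ_apply', rng_next, ih]

theorem lenα_iterate (q : Quad A) (n : ℕ) : ((Quad.next B)^[n] q).α.len = q.α.len + n := by
  induction n with
  | zero => rfl
  | succ n ih => rw [Function.iterate_succ_apply', lenα_next, ih, add_assoc]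

theorem lenβ_iterate (q : Quad A) (n : ℕ) : ((Quad.next B)^[n] q).β.len = q.β.len + n := by
  induction n with
  | zero => rfl
  | succ n ih => rw [Function.iterate_succ_apply', lenβ_next, ih, add_assoc]

theorem mul_iterate (q q' : Quad A) (h : q.β = q'.α) (hx : q.x = q'.rng B) (n : ℕ) :
    ∃ h', ((Quad.next B)^[n] q).mul ((Quad.next B)^[n] q') h' = (Quad.next B)^[n] (q.mul q' h) := by
  induction n with
  | zero => exact ⟨h, rfl⟩
  | succ n ih =>
    obtain ⟨h1, h2⟩ := ih
    obtain ⟨h3, h4⟩ := mul_next B _ _ h1 (by rw [x_iterate, rng_iterate, hx])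
    rw [h2] at h4
    simp only [Function.iterate_succ_apply']
    exact ⟨h3, h4⟩

end Quad

variable (A) in
/-- The arrows of the Katsura-Exel-Pardo groupoid: the quotient of the quadruples by the equivalence
relation generated by `(α, m, β; x) ∼ (α κ_m(γ), φ(m, γ), βγ; x)`, `x = βγy`. -/
def KArrow : Type u := Quot fun q q' : Quad A => q' = q.next B

namespace KArrow

variable {B}

variable (B) in
/-- The class `[α, m, β; x]`. -/
def mk (q : Quad A) : KArrow A B := Quot.mk _ q

theorem mk_next (q : Quad A) : mk B (q.next B) = mk B q :=
  (Quot.sound (r := fun q q' : Quad A => q' = q.next B) rfl).symm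

theorem mk_iterate (q : Quad A) (n : ℕ) : mk B ((Quad.next B)^[n] q) = mk B q := by
  induction n with
  | zero => rfl
  | succ n ih => rw [Function.iterate_succ_apply', mk_next, ih]

theorem exists_mk (g : KArrow A B) : ∃ q, mk B q = g := Quot.exists_rep g

theorem mk_eq_mk {q q' : Quad A} (h : mk B q = mk B q') :
    ∃ i j, (Quad.next B)^[i] q = (Quad.next B)^[j] q' := by
  have h1 := Quot.eqvGen_exact h
  induction h1 with
  | rel x y hxy => exact ⟨1, 0, hxy.symm⟩
  | refl x => exact ⟨0, 0, rfl⟩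
  | symm x y _ ih =>
    obtain ⟨i, j, hij⟩ := ih (Quot.eqvGen_sound (by assumption))
    exact ⟨j, i, hij.symm⟩
  | trans x y z h1 h2 ih1 ih2 =>
    obtain ⟨i, j, hij⟩ := ih1 (Quot.eqvGen_sound h1)
    obtain ⟨k, l, hkl⟩ := ih2 (Quot.eqvGen_sound h2)
    refine ⟨k + i, j + l, ?_⟩
    rw [Function.iterate_add_apply, hij, Function.iterate_add_apply, ← hkl,
      ← Function.iterate_add_apply, ← Function.iterate_add_apply, add_comm]

theorem mk_eq_mk_of {q q' : Quad A} (i j : ℕ) (h : (Quad.next B)^[i] q = (Quad.next B)^[j] q') :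
    mk B q = mk B q' := by
  rw [← mk_iterate q i, h, mk_iterate]

/-- `s([α, m, β; x]) = x`. -/
def src : KArrow A B → InfPath A := Quot.lift Quad.x (by rintro q _ rfl; rfl)

/-- `r([α, m, β; βy]) = α κ_m(y)`. -/
def rng : KArrow A B → InfPath A :=
  Quot.lift (Quad.rng B) (by rintro q _ rfl; exact (q.rng_next B).symm)

/-- `[α, m, β; βy]⁻¹ = [β, -m, α; α κ_m(y)]`. -/
def inv : KArrow A B → KArrow A B :=
  Quot.lift (fun q => mk B (q.inv B)) (by
    rintro q _ rfl
    rw [Quad.next_inv, mk_next])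

/-- `ρ([α, m, β; x]) = |α| - |β|`. -/
def lag : KArrow A B → ℤ :=
  Quot.lift (fun q => (q.α.len : ℤ) - q.β.len) (by
    rintro q _ rfl
    rw [Quad.lenα_next, Quad.lenβ_next]
    push_cast
    ring)

variable (B) in
/-- The unit `[v, 0, v; x]`, where `v` is the source of `x`. -/
def one (x : InfPath A) : KArrow A B := mk B
  { α := x.take 0
    m := 0
    β := x.take 0
    x := x
    hr := rfl
    hx := rfl }

theorem one_eq (x : InfPath A) (n : ℕ) (h) : one B x = mk B (Quad.ofPaths B x x n n 0 h) := by
  induction n with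
  | zero => rfl
  | succ n ih =>
    have h0 : x.drop n = (x.drop n).act B 0 := (InfPath.act_zero B _).symm
    rw [ih h0, ← mk_next, Quad.next_ofPaths]
    exact congrArg _ (Quad.ofPaths_congr B _ _ rfl rfl rfl rfl (Edge.coc_zero B _))

theorem exists_reps (g h : KArrow A B) (p : g.src = h.rng) :
    ∃ q q' : Quad A, mk B q = g ∧ mk B q' = h ∧ q.β = q'.α := by
  obtain ⟨q, rfl⟩ := exists_mk g
  obtain ⟨q', rfl⟩ := exists_mk h
  have p : q.x = q'.rng B := p
  refine ⟨(Quad.next B)^[q'.α.len] q, (Quad.next B)^[q.β.len] q', mk_iterate _ _, mk_iterate _ _, ?_⟩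
  have h1 := ((Quad.next B)^[q'.α.len] q).hx
  have h2 := (((Quad.next B)^[q.β.len] q').inv B).hx
  change InfPath.take _ _ = _ at h1
  change InfPath.take (((Quad.next B)^[q.β.len] q').rng B) ((Quad.next B)^[q.β.len] q').α.len
    = ((Quad.next B)^[q.β.len] q').α at h2
  rw [← h1, ← h2, Quad.x_iterate, Quad.rng_iterate, Quad.lenα_iterate, Quad.lenβ_iterate, p,
    add_comm]

/-- The product, given by `[α, m', β; β κ_m(x)] [β, m, γ; γx] = [α, m' + m, γ; γx]`; it does not
depend on the representatives, see `mul_mk`. -/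
def mul (g h : KArrow A B) (p : g.src = h.rng) : KArrow A B :=
  mk B ((exists_reps g h p).choose.mul (exists_reps g h p).choose_spec.choose
    (exists_reps g h p).choose_spec.choose_spec.2.2)

theorem mul_mk (q q' : Quad A) (p : (mk B q).src = (mk B q').rng) (h : q.β = q'.α) :
    mul (mk B q) (mk B q') p = mk B (q.mul q' h) := by
  obtain ⟨h1, h2, h3⟩ := (exists_reps (mk B q) (mk B q') p).choose_spec.choose_spec
  change mk B (Quad.mul _ _ h3) = _
  generalize (exists_reps (mk B q) (mk B q') p).choose_spec.choose = q₁' at *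
  generalize (exists_reps (mk B q) (mk B q') p).choose = q₁ at *
  obtain ⟨i, j, hij⟩ := mk_eq_mk h1
  obtain ⟨k, l, hkl⟩ := mk_eq_mk h2
  have p1 : q₁.x = q₁'.rng B := by
    have e1 : q₁.x = q.x := congrArg src h1
    have e2 : q₁'.rng B = q'.rng B := congrArg rng h2
    rw [e1, e2]
    exact p
  obtain ⟨h4, h5⟩ := Quad.mul_iterate B q₁ q₁' h3 p1 (k + i)
  obtain ⟨h6, h7⟩ := Quad.mul_iterate B q q' h p (k + j)
  have l1 := congrArg (fun q : Quad A => q.β.len) hij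
  have l2 := congrArg (fun q : Quad A => q.α.len) hkl
  simp only [Quad.lenα_iterate, Quad.lenβ_iterate] at l1 l2
  rw [h3, h] at l1
  have e1 : (Quad.next B)^[k + i] q₁ = (Quad.next B)^[k + j] q := by
    rw [Function.iterate_add_apply, hij, ← Function.iterate_add_apply]
  have e2 : (Quad.next B)^[k + i] q₁' = (Quad.next B)^[k + j] q' := by
    rw [add_comm k i, Function.iterate_add_apply, hkl, ← Function.iterate_add_apply,
      show i + l = k + j by omega]
  refine mk_eq_mk_of (k + i) (k + j) ?_
  rw [← h5, ← h7]
  congr 1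

theorem exists_ofPaths (g : KArrow A B) : ∃ a b m, ∃ h : g.rng.drop a = (g.src.drop b).act B m,
    mk B (Quad.ofPaths B g.rng g.src a b m h) = g := by
  obtain ⟨q, rfl⟩ := exists_mk g
  obtain ⟨h, hq⟩ := q.exists_ofPaths B
  exact ⟨q.α.len, q.β.len, q.m, h, congrArg (mk B) hq.symm⟩

end KArrow

section Topology

theorem InfPath.eventually_eq (x : InfPath A) (n : ℕ) :
    ∀ᶠ y : InfPath A in 𝓝 x, ∀ i < n, y.1 i = x.1 i := by
  refine (Filter.eventually_all_finite (Set.finite_lt_nat n)).2 fun i _ => ?_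
  exact ((continuous_apply i).comp continuous_subtype_val).continuousAt
    ((isOpen_discrete {x.1 i}).mem_nhds rfl)

theorem InfPath.eventually_take (x : InfPath A) (n : ℕ) :
    ∀ᶠ y : InfPath A in 𝓝 x, y.take n = x.take n := by
  filter_upwards [x.eventually_eq (n + 1)] with y hy
  exact InfPath.take_eq_take_iff.2 ⟨congrArg Edge.s (hy 0 (by omega)),
    fun i hi => hy i (by omega)⟩

theorem isOpen_cyl (α : FinPath A) : IsOpen (cyl α) := by
  rw [isOpen_iff_mem_nhds]
  intro x hx
  filter_upwards [x.eventually_take α.len] with y hy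
  exact hy.trans hx

theorem isClosed_cyl (α : FinPath A) : IsClosed (cyl α) := by
  rw [← isOpen_compl_iff, isOpen_iff_mem_nhds]
  intro x hx
  filter_upwards [x.eventually_take α.len] with y hy hy'
  exact hx (hy.symm.trans hy')

theorem InfPath.exists_cyl_subset {x : InfPath A} {U : Set (InfPath A)} (hU : U ∈ 𝓝 x) :
    ∃ n, ∀ k, n ≤ k → cyl (x.take k) ⊆ U := by
  obtain ⟨W, hW, hWU⟩ :=
    (mem_nhds_subtype {x : ℕ → Edge A | ∀ n, (x n).r = (x (n + 1)).s} x U).1 hU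
  obtain ⟨O, hOW, hO, hxO⟩ := mem_nhds_iff.1 hW
  obtain ⟨C, ⟨z, n, rfl⟩, hxC, hCO⟩ :=
    (PiNat.isTopologicalBasis_cylinders (fun _ : ℕ => Edge A)).exists_subset_of_mem_open hxO hO
  refine ⟨n, fun k hk y hy => hWU (hOW (hCO ?_))⟩
  have hy : y.take (x.take k).len = x.take k := hy
  rw [InfPath.len_take] at hy
  have h1 := (InfPath.take_eq_take_iff.1 hy).2
  rw [PiNat.mem_cylinder_iff] at hxC ⊢
  intro i hi
  rw [← hxC i hi]
  exact h1 i (by omega)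

theorem Edge.finite_source (hA : RowFinite A) (v : V) : {e : Edge A | e.s = v}.Finite := by
  have h1 : (⋃ j ∈ {j | A v j ≠ 0}, ({j} : Set V) ×ˢ Set.Ico (0 : ℤ) (A v j)).Finite :=
    (hA v).biUnion fun j _ => (Set.finite_singleton j).prod (Set.finite_Ico _ _)
  refine Set.Finite.of_injOn (f := fun e : Edge A => (e.r, e.idx)) ?_ ?_ h1
  · rintro e rfl
    refine mem_biUnion (show e.r ∈ {j | A e.s j ≠ 0} from e.pos.ne') ⟨rfl, e.nonneg, e.lt⟩
  · rintro e rfl e' h h'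
    exact Edge.ext h.symm (congrArg Prod.fst h') (congrArg Prod.snd h')

theorem InfPath.isCompact_source (hA : RowFinite A) (v : V) :
    IsCompact {x : InfPath A | (x.1 0).s = v} := by
  let F : ℕ → Set (Edge A) := fun n =>
    n.rec {e | e.s = v} (fun _ S => ⋃ e ∈ S, {f | f.s = e.r})
  have hF : ∀ n, (F n).Finite := by
    intro n
    induction n with
    | zero => exact Edge.finite_source hA v
    | succ n ih => exact ih.biUnion fun e _ => Edge.finite_source hA e.r
  have hc : IsCompact (univ.pi F) := isCompact_univ_pi fun n => (hF n).isCompact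
  rw [Topology.IsEmbedding.subtypeVal.isCompact_iff]
  refine hc.of_isClosed_subset ?_ ?_
  · have h1 : (Subtype.val '' {x : InfPath A | (x.1 0).s = v})
        = {x : ℕ → Edge A | (x 0).s = v} ∩ ⋂ n, {x | (x n).r = (x (n + 1)).s} := by
      ext x
      simp only [mem_image, mem_inter_iff, mem_iInter, mem_ofPred_eq]
      constructor
      · rintro ⟨y, hy, rfl⟩
        exact ⟨hy, y.2⟩
      · rintro ⟨hx, hx'⟩
        exact ⟨⟨x, hx'⟩, hx, rfl⟩
    rw [h1]
    have hc0 : ∀ n, Continuous fun x : ℕ → Edge A => x n := fun n => continuous_apply n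
    refine IsClosed.inter ?_ (isClosed_iInter fun n => ?_)
    · exact (isClosed_discrete {e : Edge A | e.s = v}).preimage (hc0 0)
    · exact (isClosed_discrete {e : Edge A × Edge A | e.1.r = e.2.s}).preimage
        ((hc0 n).prodMk (hc0 (n + 1)))
  · rintro _ ⟨x, hx, rfl⟩ n _
    induction n with
    | zero => exact hx
    | succ n ih => exact mem_biUnion (ih trivial) (x.2 n).symm

theorem isCompact_cyl (hA : RowFinite A) (α : FinPath A) : IsCompact (cyl α) := by
  refine (InfPath.isCompact_source hA α.s).of_isClosed_subset (isClosed_cyl α) fun x hx => ?_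
  exact congrArg FinPath.s (show x.take α.len = α from hx)

namespace KArrow

/-- The set `Z(α, m, β; Z(β))` of all `[α, m, β; x]` with `x ∈ Z(β)`. -/
def Z (α : FinPath A) (m : ℤ) (β : FinPath A) : Set (KArrow A B) :=
  {g | ∃ q : Quad A, q.α = α ∧ q.m = m ∧ q.β = β ∧ mk B q = g}

/-- The topology generated by the sets `Z(α, m, β; Z(β))`. -/
instance : TopologicalSpace (KArrow A B) :=
  TopologicalSpace.generateFrom
    {S | ∃ (α : FinPath A) (m : ℤ) (β : FinPath A), α.r = β.r ∧ S = Z B α m β}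

variable {B}

theorem isOpen_Z {α β : FinPath A} (h : α.r = β.r) (m : ℤ) : IsOpen (Z B α m β) :=
  TopologicalSpace.isOpen_generateFrom_of_mem ⟨α, m, β, h, rfl⟩

theorem mk_mem_Z (q : Quad A) : mk B q ∈ Z B q.α q.m q.β := ⟨q, rfl, rfl, rfl, rfl⟩

theorem Z_next (q : Quad A) : Z B (q.next B).α (q.next B).m (q.next B).β ⊆ Z B q.α q.m q.β := by
  rintro _ ⟨p, hα, hm, hβ, rfl⟩
  have h1 : p.x.take p.β.len = p.β := p.hx
  rw [hβ, Quad.lenβ_next, InfPath.take_succ] at h1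
  obtain ⟨h2, h3⟩ := FinPath.snoc_inj (h' := q.r_β) h1
  refine ⟨⟨q.α, q.m, q.β, p.x, q.hr, h2⟩, rfl, rfl, rfl, ?_⟩
  rw [← mk_next]
  refine congrArg (mk B) (Quad.ext ?_ ?_ ?_ rfl)
  · rw [hα]
    exact FinPath.snoc_congr (Quad.r_α B ⟨q.α, q.m, q.β, p.x, q.hr, h2⟩) (q.r_α B) rfl
      (congrArg (Edge.act B q.m) h3)
  · rw [hm]
    exact congrArg (Edge.coc B q.m) h3
  · rw [hβ]
    exact FinPath.snoc_congr (Quad.r_β ⟨q.α, q.m, q.β, p.x, q.hr, h2⟩) q.r_β rfl h3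

theorem Z_iterate (q : Quad A) (n : ℕ) :
    Z B ((Quad.next B)^[n] q).α ((Quad.next B)^[n] q).m ((Quad.next B)^[n] q).β
      ⊆ Z B q.α q.m q.β := by
  induction n with
  | zero => exact subset_rfl
  | succ n ih =>
    rw [Function.iterate_succ_apply']
    exact (Z_next _).trans ih

theorem isBasis : TopologicalSpace.IsTopologicalBasis
    {S | ∃ (α : FinPath A) (m : ℤ) (β : FinPath A), α.r = β.r ∧ S = Z B α m β} where
  exists_subset_inter := by
    rintro _ ⟨α, m, β, h, rfl⟩ _ ⟨α', m', β', h', rfl⟩ _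
      ⟨⟨q, rfl, rfl, rfl, rfl⟩, q', rfl, rfl, rfl, hq⟩
    obtain ⟨i, j, hij⟩ := mk_eq_mk hq
    refine ⟨_, ⟨_, _, _, ((Quad.next B)^[i] q').hr, rfl⟩, ?_,
      subset_inter ?_ (Z_iterate q' i)⟩
    · rw [← hq, ← mk_iterate q' i]
      exact mk_mem_Z _
    · rw [hij]
      exact Z_iterate q j
  sUnion_eq := by
    refine eq_univ_of_forall fun g => ?_
    obtain ⟨q, rfl⟩ := exists_mk g
    exact ⟨_, ⟨_, _, _, q.hr, rfl⟩, mk_mem_Z q⟩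
  eq_generateFrom := rfl

/-- Every neighbourhood of `[q]` contains the basic sets of all sufficiently long representatives. -/
theorem exists_Z_subset {q : Quad A} {N : Set (KArrow A B)} (hN : N ∈ 𝓝 (mk B q)) :
    ∃ n, Z B ((Quad.next B)^[n] q).α ((Quad.next B)^[n] q).m ((Quad.next B)^[n] q).β ⊆ N := by
  obtain ⟨_, ⟨α, m, β, h, rfl⟩, ⟨q', rfl, rfl, rfl, hq⟩, hS⟩ := isBasis.mem_nhds_iff.1 hN
  obtain ⟨i, j, hij⟩ := mk_eq_mk hq
  refine ⟨j, Subset.trans ?_ hS⟩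
  rw [← hij]
  exact Z_iterate q' i

theorem Z_mem_nhds (q : Quad A) : Z B q.α q.m q.β ∈ 𝓝 (mk B q) :=
  (isOpen_Z q.hr q.m).mem_nhds (mk_mem_Z q)

theorem Z_iterate_mem_nhds (q : Quad A) (n : ℕ) :
    Z B ((Quad.next B)^[n] q).α ((Quad.next B)^[n] q).m ((Quad.next B)^[n] q).β ∈ 𝓝 (mk B q) := by
  rw [← mk_iterate q n]
  exact Z_mem_nhds _

theorem src_injOn_Z (α : FinPath A) (m : ℤ) (β : FinPath A) : (Z B α m β).InjOn src := by
  rintro _ ⟨q, rfl, rfl, rfl, rfl⟩ _ ⟨q', hα, hm, hβ, rfl⟩ hx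
  exact congrArg (mk B) (Quad.ext hα.symm hm.symm hβ.symm hx)

theorem src_image_Z {α β : FinPath A} (h : α.r = β.r) (m : ℤ) : src '' Z B α m β = cyl β := by
  ext x
  constructor
  · rintro ⟨_, ⟨q, rfl, rfl, rfl, rfl⟩, rfl⟩
    exact q.hx
  · intro hx
    exact ⟨_, ⟨⟨α, m, β, x, h, hx⟩, rfl, rfl, rfl, rfl⟩, rfl⟩

theorem continuous_src : Continuous (src : KArrow A B → InfPath A) := by
  rw [continuous_iff_continuousAt]
  intro g U hU
  obtain ⟨q, rfl⟩ := exists_mk g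
  have hU : U ∈ 𝓝 q.x := hU
  obtain ⟨n, hn⟩ := InfPath.exists_cyl_subset hU
  refine Filter.mem_map.2 (Filter.mem_of_superset (Z_iterate_mem_nhds q n) ?_)
  rintro _ ⟨p, hα, hm, hβ, rfl⟩
  refine hn (q.β.len + n) (by omega) ?_
  have h1 := p.hx
  have h2 := ((Quad.next B)^[n] q).hx
  change InfPath.take _ _ = _ at h1 h2
  change InfPath.take p.x (q.x.take _).len = _
  rw [InfPath.len_take]
  rw [Quad.x_iterate, Quad.lenβ_iterate] at h2
  rw [hβ, Quad.lenβ_iterate, ← h2] at h1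
  exact h1

theorem isLocalHomeomorph_src : IsLocalHomeomorph (src : KArrow A B → InfPath A) := by
  refine isLocalHomeomorph_of_isOpenMap continuous_src ?_ ?_
  · refine isBasis.isOpenMap_iff.2 ?_
    rintro _ ⟨α, m, β, h, rfl⟩
    rw [src_image_Z h]
    exact isOpen_cyl β
  · intro g
    obtain ⟨q, rfl⟩ := exists_mk g
    exact ⟨_, Z_mem_nhds q, src_injOn_Z _ _ _⟩

theorem isCompact_Z (hA : RowFinite A) {α β : FinPath A} (h : α.r = β.r) (m : ℤ) :
    IsCompact (Z B α m β) := by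
  have h1 : IsOpenEmbedding fun g : Z B α m β => src g.1 :=
    .of_continuous_injective_isOpenMap (continuous_src.comp continuous_subtype_val)
      (fun g g' hg => Subtype.ext (src_injOn_Z α m β g.2 g'.2 hg))
      (isLocalHomeomorph_src.isOpenMap.comp (isOpen_Z h m).isOpenMap_subtype_val)
  rw [isCompact_iff_isCompact_univ, h1.isInducing.isCompact_iff]
  convert isCompact_cyl hA β
  rw [← src_image_Z (B := B) h m]
  ext x
  simp

theorem inv_inv (g : KArrow A B) : g.inv.inv = g := by
  obtain ⟨q, rfl⟩ := exists_mk g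
  exact congrArg (mk B) (q.inv_inv B)

theorem inv_mem_Z {g : KArrow A B} {α β : FinPath A} {m : ℤ} (hg : g ∈ Z B α m β) :
    g.inv ∈ Z B β (-m) α := by
  obtain ⟨q, rfl, rfl, rfl, rfl⟩ := hg
  exact ⟨q.inv B, rfl, rfl, rfl, rfl⟩

theorem continuous_inv : Continuous (inv : KArrow A B → KArrow A B) := by
  refine continuous_generateFrom_iff.2 ?_
  rintro _ ⟨α, m, β, h, rfl⟩
  convert isOpen_Z (B := B) h.symm (-m)
  ext g
  refine ⟨fun hg => ?_, fun hg => ?_⟩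
  · have := inv_mem_Z (show g.inv ∈ _ from hg)
    rwa [inv_inv] at this
  · have := inv_mem_Z hg
    rwa [neg_neg] at this

theorem continuous_one : Continuous (one B : InfPath A → KArrow A B) := by
  rw [continuous_iff_continuousAt]
  intro x N hN
  have h0 : ∀ (y : InfPath A) (n : ℕ), y.drop n = (y.drop n).act B 0 :=
    fun y n => (InfPath.act_zero B _).symm
  rw [one_eq x 0 (h0 x 0)] at hN
  obtain ⟨n, hn⟩ := exists_Z_subset hN
  have h1 : (Quad.next B)^[n] (Quad.ofPaths B x x 0 0 0 (h0 x 0))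
      = Quad.ofPaths B x x n n 0 (h0 x n) := by
    clear hn
    induction n with
    | zero => rfl
    | succ n ih =>
      rw [Function.iterate_succ_apply', ih, Quad.next_ofPaths]
      exact Quad.ofPaths_congr B _ _ rfl rfl rfl rfl (Edge.coc_zero B _)
  rw [h1] at hn
  change ∀ᶠ y in 𝓝 x, one B y ∈ N
  filter_upwards [x.eventually_take n] with y hy
  refine hn ?_
  rw [one_eq y n (h0 y n)]
  exact ⟨Quad.ofPaths B y y n n 0 (h0 y n), hy, rfl, hy, rfl⟩

theorem rng_inv (g : KArrow A B) : g.inv.rng = g.src := by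
  rw [← inv_inv g]
  obtain ⟨q, hq⟩ := exists_mk g.inv
  rw [← hq]
  have h := congrArg Quad.x (q.inv_inv B)
  change rng (mk B ((q.inv B).inv B)) = q.rng B
  rw [q.inv_inv B]
  rfl

theorem src_inv (g : KArrow A B) : g.inv.src = g.rng := by
  obtain ⟨q, rfl⟩ := exists_mk g
  rfl

theorem src_mul (g h : KArrow A B) (p) : (mul g h p).src = h.src := by
  obtain ⟨q, q', rfl, rfl, hh⟩ := exists_reps g h p
  rw [mul_mk q q' p hh]
  rfl

theorem mul_ofPaths (u w x : InfPath A) (a b c : ℕ) (m' m : ℤ) (h h' p) :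
    mul (mk B (Quad.ofPaths B u w a b m' h)) (mk B (Quad.ofPaths B w x b c m h')) p
      = mk B (Quad.ofPaths B u x a c (m' + m) (Quad.ofPaths_mul B h h')) :=
  mul_mk _ _ _ rfl

theorem exists_ofPaths₂ (g h : KArrow A B) (p : g.src = h.rng) : ∃ u w x a b c m' m, ∃ h₁ h₂,
    mk B (Quad.ofPaths B u w a b m' h₁) = g ∧ mk B (Quad.ofPaths B w x b c m h₂) = h := by
  obtain ⟨q, q', rfl, rfl, hh⟩ := exists_reps g h p
  have p : q.x = q'.rng B := p
  obtain ⟨h₁, e₁⟩ := q.exists_ofPaths B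
  obtain ⟨h₂, e₂⟩ := q'.exists_ofPaths B
  have hl : q'.α.len = q.β.len := by rw [hh]
  refine ⟨q.rng B, q.x, q'.x, q.α.len, q.β.len, q'.β.len, q.m, q'.m, h₁, ?_, ?_, ?_⟩
  · rw [p, ← hl]
    exact h₂
  · exact congrArg (mk B) e₁.symm
  · refine congrArg (mk B) (Eq.trans ?_ e₂.symm)
    exact Quad.ofPaths_congr B _ _ p rfl hl.symm rfl rfl

theorem iterate_ofPaths (u x : InfPath A) (a b : ℕ) (m : ℤ) (h) (n : ℕ) : ∃ h',
    (Quad.next B)^[n] (Quad.ofPaths B u x a b m h)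
      = Quad.ofPaths B u x (a + n) (b + n) (InfPath.coc B m (x.drop b) n) h' := by
  induction n with
  | zero => exact ⟨h, rfl⟩
  | succ n ih =>
    obtain ⟨h', ih⟩ := ih
    rw [Function.iterate_succ_apply', ih, Quad.next_ofPaths]
    exact ⟨_, rfl⟩

theorem rng_mul (g h : KArrow A B) (p) : (mul g h p).rng = g.rng := by
  obtain ⟨u, w, x, a, b, c, m', m, h₁, h₂, rfl, rfl⟩ := exists_ofPaths₂ g h p
  rw [mul_ofPaths]
  exact (Quad.rng_ofPaths B _ _ _ _ _ _).trans (Quad.rng_ofPaths B _ _ _ _ _ _).symm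

theorem lag_mul (g h : KArrow A B) (p) : (mul g h p).lag = g.lag + h.lag := by
  obtain ⟨q, q', rfl, rfl, hh⟩ := exists_reps g h p
  rw [mul_mk q q' p hh]
  change (q.α.len : ℤ) - q'.β.len = ((q.α.len : ℤ) - q.β.len) + (q'.α.len - q'.β.len)
  rw [hh]
  ring

theorem exists_ofPaths₃ (g h k : KArrow A B) (p : g.src = h.rng) (p' : h.src = k.rng) :
    ∃ u w x y a b c d m₁ m₂ m₃, ∃ h₁ h₂ h₃,
      mk B (Quad.ofPaths B u w a b m₁ h₁) = g ∧ mk B (Quad.ofPaths B w x b c m₂ h₂) = h ∧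
      mk B (Quad.ofPaths B x y c d m₃ h₃) = k := by
  obtain ⟨u, w, x, a, b, c, m', m, h₁, h₂, rfl, rfl⟩ := exists_ofPaths₂ g h p
  obtain ⟨c', d, m₃, h₃, hk⟩ := exists_ofPaths k
  have p' : x = k.rng := p'
  generalize k.src = y at *
  generalize k.rng = z at *
  subst hk p'
  obtain ⟨i₁, e₁⟩ := iterate_ofPaths u w a b m' h₁ c'
  obtain ⟨i₂, e₂⟩ := iterate_ofPaths w x b c m h₂ c'
  obtain ⟨i₃, e₃⟩ := iterate_ofPaths x y c' d m₃ h₃ c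
  rw [add_comm c' c] at i₃
  refine ⟨u, w, x, y, a + c', b + c', c + c', d + c, _, _, _, i₁, i₂, i₃, ?_, ?_, ?_⟩
  · rw [← e₁, mk_iterate]
  · rw [← e₂, mk_iterate]
  · rw [← mk_iterate (Quad.ofPaths B x y c' d m₃ h₃) c, e₃]
    exact congrArg (mk B) (Quad.ofPaths_congr B _ _ rfl rfl (add_comm c c') rfl rfl)

theorem mul_assoc (g h k : KArrow A B) (p : g.src = h.rng) (p' : h.src = k.rng) :
    mul (mul g h p) k ((src_mul g h p).trans p') = mul g (mul h k p') (p.trans (rng_mul h k p').symm)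
    := by
  obtain ⟨u, w, x, y, a, b, c, d, m₁, m₂, m₃, h₁, h₂, h₃, rfl, rfl, rfl⟩ :=
    exists_ofPaths₃ g h k p p'
  simp only [mul_ofPaths]
  exact congrArg (mk B) (Quad.ofPaths_congr B _ _ rfl rfl rfl rfl (add_assoc _ _ _))

theorem src_one (x : InfPath A) : (one B x).src = x := rfl

theorem rng_one (x : InfPath A) : (one B x).rng = x := by
  rw [one_eq x 0 (InfPath.act_zero B _).symm]
  exact Quad.rng_ofPaths B _ _ _ _ _ _

theorem mul_congr {g g' h h' : KArrow A B} (hg : g = g') (hh : h = h') (p : g.src = h.rng)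
    (p' : g'.src = h'.rng) : mul g h p = mul g' h' p' := by
  subst hg hh
  rfl

theorem mul_eq {g h k : KArrow A B} (p) {u w x : InfPath A} {a b c : ℕ} {m' m n : ℤ} {h₁ h₂ h₃}
    (hg : mk B (Quad.ofPaths B u w a b m' h₁) = g) (hh : mk B (Quad.ofPaths B w x b c m h₂) = h)
    (hk : mk B (Quad.ofPaths B u x a c n h₃) = k) (hn : m' + m = n) : mul g h p = k := by
  subst hg hh hk hn
  exact mul_ofPaths u w x a b c m' m h₁ h₂ p

theorem one_eq' (x : InfPath A) (n : ℕ) :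
    mk B (Quad.ofPaths B x x n n 0 (InfPath.act_zero B _).symm) = one B x := (one_eq x n _).symm

theorem exists_ofPaths_inv (g : KArrow A B) : ∃ a b m,
    ∃ h : g.rng.drop a = (g.src.drop b).act B m, ∃ h' : g.src.drop b = (g.rng.drop a).act B (-m),
      mk B (Quad.ofPaths B g.rng g.src a b m h) = g ∧
      mk B (Quad.ofPaths B g.src g.rng b a (-m) h') = g.inv := by
  obtain ⟨a, b, m, h, hg⟩ := exists_ofPaths g
  refine ⟨a, b, m, h, Quad.ofPaths_inv B h, hg, ?_⟩
  rw [← Quad.inv_ofPaths]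
  exact congrArg inv hg

theorem one_mul (g : KArrow A B) (p) : mul (one B g.rng) g p = g := by
  obtain ⟨a, b, m, h, hg⟩ := exists_ofPaths g
  exact mul_eq p (one_eq' g.rng a) hg hg (zero_add m)

theorem mul_one (g : KArrow A B) (p) : mul g (one B g.src) p = g := by
  obtain ⟨a, b, m, h, hg⟩ := exists_ofPaths g
  exact mul_eq p hg (one_eq' g.src b) hg (add_zero m)

theorem inv_mul (g : KArrow A B) (p) : mul g.inv g p = one B g.src := by
  obtain ⟨a, b, m, h, h', hg, hi⟩ := exists_ofPaths_inv g
  exact mul_eq p hi hg (one_eq' g.src b) (neg_add_cancel m)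

theorem mul_inv (g : KArrow A B) (p) : mul g g.inv p = one B g.rng := by
  obtain ⟨a, b, m, h, h', hg, hi⟩ := exists_ofPaths_inv g
  exact mul_eq p hg hi (one_eq' g.rng a) (add_neg_cancel m)

theorem continuous_mul :
    Continuous fun p : {p : KArrow A B × KArrow A B // p.1.src = p.2.rng} =>
      mul p.1.1 p.1.2 p.2 := by
  rw [continuous_iff_continuousAt]
  rintro ⟨⟨g, h⟩, p⟩ N hN
  obtain ⟨q, q', rfl, rfl, hh⟩ := exists_reps g h p
  have hN : N ∈ 𝓝 (mul (mk B q) (mk B q') p) := hN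
  rw [mul_mk q q' p hh] at hN
  obtain ⟨n, hn⟩ := exists_Z_subset hN
  obtain ⟨h₁, h₂⟩ := Quad.mul_iterate B q q' hh p n
  rw [← h₂] at hn
  have h3 := prod_mem_nhds (Z_iterate_mem_nhds (B := B) q n) (Z_iterate_mem_nhds (B := B) q' n)
  refine Filter.mem_map.2 (Filter.mem_of_superset (continuous_subtype_val.continuousAt h3) ?_)
  rintro ⟨⟨g, h⟩, p⟩ ⟨⟨r, hα, hm, hβ, hg⟩, r', hα', hm', hβ', hg'⟩
  have hg : mk B r = g := hg
  have hg' : mk B r' = h := hg'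
  subst hg hg'
  refine hn ?_
  change mul (mk B r) (mk B r') p ∈ _
  rw [mul_mk r r' p (by rw [hβ, h₁, hα'])]
  refine ⟨r.mul r' (by rw [hβ, h₁, hα']), hα, ?_, hβ', rfl⟩
  exact congrArg₂ (· + ·) hm hm'

theorem continuous_lag : Continuous (lag : KArrow A B → ℤ) := by
  rw [← IsLocallyConstant.iff_continuous, IsLocallyConstant.iff_eventually_eq]
  intro g
  obtain ⟨q, rfl⟩ := exists_mk g
  filter_upwards [Z_mem_nhds (B := B) q]
  rintro _ ⟨p, hα, hm, hβ, rfl⟩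
  change (p.α.len : ℤ) - p.β.len = (q.α.len : ℤ) - q.β.len
  rw [hα, hβ]

theorem next_injective (hp : PseudoFree A B) : Function.Injective (Quad.next B (A := A)) := by
  intro q q' h
  obtain ⟨h1, h2⟩ := FinPath.snoc_inj (h := q.r_α B) (h' := q'.r_α B) (congrArg Quad.α h)
  obtain ⟨h3, h4⟩ := FinPath.snoc_inj (h := q.r_β) (h' := q'.r_β) (congrArg Quad.β h)
  have h5 : (q.x.1 q.β.len).coc B q.m = (q'.x.1 q'.β.len).coc B q'.m := congrArg Quad.m h
  rw [← h4] at h2 h5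
  exact Quad.ext h1 (hp.eq h2 h5) h3 (congrArg Quad.x h :)

theorem t2Space (hp : PseudoFree A B) : T2Space (KArrow A B) := by
  refine ⟨fun g h hgh => ?_⟩
  by_cases hs : g.src = h.src
  · obtain ⟨q₀, rfl⟩ := exists_mk g
    obtain ⟨q₀', rfl⟩ := exists_mk h
    have hs : q₀.x = q₀'.x := hs
    obtain ⟨q, q', e, e', hx, hβ⟩ : ∃ q q' : Quad A, mk B q = mk B q₀ ∧ mk B q' = mk B q₀' ∧
        q.x = q'.x ∧ q.β = q'.β := by
      refine ⟨(Quad.next B)^[q₀'.β.len] q₀, (Quad.next B)^[q₀.β.len] q₀', mk_iterate _ _,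
        mk_iterate _ _, by rw [Quad.x_iterate, Quad.x_iterate, hs], ?_⟩
      have h1 := ((Quad.next B)^[q₀'.β.len] q₀).hx
      have h2 := ((Quad.next B)^[q₀.β.len] q₀').hx
      change InfPath.take _ _ = _ at h1 h2
      rw [← h1, ← h2, Quad.x_iterate, Quad.x_iterate, Quad.lenβ_iterate, Quad.lenβ_iterate, hs,
        add_comm]
    rw [← e, ← e'] at hgh ⊢
    refine ⟨_, _, isOpen_Z q.hr q.m, isOpen_Z q'.hr q'.m, mk_mem_Z q, mk_mem_Z q',
      Set.disjoint_left.2 ?_⟩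
    rintro _ ⟨r, hα, hm, hrβ, rfl⟩ ⟨r', hα', hm', hrβ', hr⟩
    obtain ⟨i, j, hij⟩ := mk_eq_mk hr
    have hl := congrArg (fun q : Quad A => q.β.len) hij
    simp only [Quad.lenβ_iterate] at hl
    rw [hrβ, hrβ', hβ] at hl
    have hl : i = j := by omega
    subst hl
    have hrr := (next_injective hp).iterate i hij
    subst hrr
    exact hgh (congrArg (mk B) (Quad.ext (hα.symm.trans hα') (hm.symm.trans hm') hβ hx))
  · obtain ⟨U, W, hU, hW, hgU, hhW, hUW⟩ := t2_separation hs
    exact ⟨_, _, hU.preimage continuous_src, hW.preimage continuous_src, hgU, hhW,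
      hUW.preimage src⟩

end KArrow

open KArrow

variable {B}

/-- The Katsura-Exel-Pardo groupoid `𝒢_{A,B}` of a pseudo free pair, with unit space the space of
infinite paths. -/
def katsura (hp : PseudoFree A B) : EtaleGroupoid (KArrow A B) (InfPath A) where
  src := src
  rng := rng
  one := one B
  inv := inv
  mul := mul
  src_one := src_one
  rng_one := rng_one
  src_inv := src_inv
  rng_inv := rng_inv
  src_mul := src_mul
  rng_mul := rng_mul
  mul_assoc := mul_assoc
  one_mul g := one_mul g _
  mul_one g := mul_one g _
  inv_mul g := inv_mul g _
  mul_inv g := mul_inv g _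
  t2_arrows := t2Space hp
  t2_units := inferInstance
  continuous_one := continuous_one
  continuous_inv := continuous_inv
  continuous_mul := continuous_mul
  isLocalHomeomorph_src := isLocalHomeomorph_src

/-- The homomorphism `ρ : 𝒢_{A,B} → ℤ`, `ρ([α, m, β; x]) = |α| - |β|`. -/
def rho (hp : PseudoFree A B) : Cocycle (katsura hp) where
  toFun := lag
  map_mul := lag_mul
  continuous_toFun := continuous_lag

/-- The groupoid `ℋ_{A,B} = ker ρ`. -/
abbrev ℋ (hp : PseudoFree A B) :
    EtaleGroupoid {g : KArrow A B // (rho hp).toFun g = 0} (InfPath A) := kernel (rho hp)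

/-- The class `[1_{Z(α)}]` in `H_0(ℋ_{A,B})`. -/
def pathClass (hA : RowFinite A) (hp : PseudoFree A B) (α : FinPath A) : (ℋ hp).H₀ :=
  (ℋ hp).cls₀ (ind (cyl α) (isCompact_cyl hA α) (isOpen_cyl α))

/-- The set `Z(α, m, α; Z(α))` as a subset of `ℋ_{A,B}`. -/
def loopSet (hp : PseudoFree A B) (α : FinPath A) (m : ℤ) :
    Set {g : KArrow A B // (rho hp).toFun g = 0} := Subtype.val ⁻¹' Z B α m α

theorem isOpen_loopSet (hp : PseudoFree A B) (α : FinPath A) (m : ℤ) :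
    IsOpen (loopSet hp α m) := (isOpen_Z rfl m).preimage continuous_subtype_val

theorem val_image_loopSet (hp : PseudoFree A B) (α : FinPath A) (m : ℤ) :
    Subtype.val '' loopSet hp α m = Z B α m α := by
  refine (Subtype.image_preimage_coe _ _).trans (inter_eq_right.2 ?_)
  rintro _ ⟨q, rfl, rfl, h, rfl⟩
  change (q.α.len : ℤ) - q.β.len = 0
  rw [h, sub_self]

theorem isCompact_loopSet (hA : RowFinite A) (hp : PseudoFree A B) (α : FinPath A) (m : ℤ) :
    IsCompact (loopSet hp α m) := by
  rw [Topology.IsEmbedding.subtypeVal.isCompact_iff, val_image_loopSet]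
  exact isCompact_Z hA rfl m

/-- The function `1_{Z(α, m, α; Z(α))}` on `ℋ_{A,B}`. -/
def loopInd (hA : RowFinite A) (hp : PseudoFree A B) (α : FinPath A) (m : ℤ) :
    C_c({g : KArrow A B // (rho hp).toFun g = 0}, ℤ) :=
  haveI := (ℋ hp).t2_arrows
  ind (loopSet hp α m) (isCompact_loopSet hA hp α m) (isOpen_loopSet hp α m)

theorem δ₁_loopInd (hA : RowFinite A) (hp : PseudoFree A B) (α : FinPath A) (m : ℤ) :
    (ℋ hp).δ₁ (loopInd hA hp α m) = 0 := by
  have := (ℋ hp).t2_arrows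
  have h1 : (ℋ hp).src = src ∘ Subtype.val := rfl
  have h2 : (ℋ hp).rng = src ∘ inv ∘ Subtype.val := funext fun g => (src_inv g.1).symm
  have h3 : inv '' Z B α m α = Z B α (-m) α := by
    ext g
    constructor
    · rintro ⟨k, hk, rfl⟩
      exact inv_mem_Z hk
    · intro hg
      refine ⟨g.inv, ?_, inv_inv g⟩
      have := inv_mem_Z hg
      rwa [neg_neg] at this
  have i1 : (ℋ hp).src '' loopSet hp α m = cyl α := by
    rw [h1, image_comp, val_image_loopSet, src_image_Z rfl]
  have i2 : (ℋ hp).rng '' loopSet hp α m = cyl α := by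
    rw [h2, image_comp, image_comp, val_image_loopSet, h3, src_image_Z rfl]
  have j1 : (loopSet hp α m).InjOn (ℋ hp).src := fun g hg k hk h =>
    Subtype.ext (src_injOn_Z α m α hg hk h)
  have j2 : (loopSet hp α m).InjOn (ℋ hp).rng := fun g hg k hk h => by
    refine Subtype.ext ?_
    rw [← inv_inv g.1, ← inv_inv k.1]
    refine congrArg inv (src_injOn_Z α (-m) α (inv_mem_Z hg) (inv_mem_Z hk) ?_)
    rw [src_inv, src_inv]
    exact h
  change push _ (ℋ hp).isLocalHomeomorph_src (ind _ _ _)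
    - push _ (ℋ hp).isLocalHomeomorph_rng (ind _ _ _) = 0
  rw [push_ind _ _ _ j1 i1 (isCompact_cyl hA α) (isOpen_cyl α),
    push_ind _ _ _ j2 i2 (isCompact_cyl hA α) (isOpen_cyl α), sub_self]

/-- The class `[1_{Z(α, 1, α; Z(α))}]` in `H_1(ℋ_{A,B})`. -/
def loopClass (hA : RowFinite A) (hp : PseudoFree A B) (α : FinPath A) : (ℋ hp).H₁ :=
  (ℋ hp).cls₁ (loopInd hA hp α 1) (δ₁_loopInd hA hp α 1)

end Topology

section IndLimit

variable {M : Matrix V V ℤ}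

/-- The endomorphism `1_v ↦ ∑_w M v w 1_w` of the free abelian group on the vertices. -/
def rowMap (hM : RowFinite M) : Module.End ℤ (V →₀ ℤ) :=
  Finsupp.linearCombination ℤ fun v => Finsupp.ofSupportFinite (M v) (hM v)

/-- The inductive limit `ℤ_M` of the sequence `ℤ^(V) → ℤ^(V) → ⋯` with all maps `rowMap`. -/
abbrev IndLim (hM : RowFinite M) : Type u :=
  Module.DirectLimit (fun _ : ℕ => V →₀ ℤ) fun i j (_ : i ≤ j) => rowMap hM ^ (j - i)

/-- The canonical map `φ_{i,∞}`. -/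
def toLim (hM : RowFinite M) (i : ℕ) : (V →₀ ℤ) →ₗ[ℤ] IndLim hM :=
  Module.DirectLimit.of ℤ ℕ (fun _ : ℕ => V →₀ ℤ) (fun i j (_ : i ≤ j) => rowMap hM ^ (j - i)) i

end IndLimit

variable {B}

/-- `Φ : H_0(ℋ_{A,B}) → ℤ_A` is given by `[1_{Z(α)}] ↦ φ_{n,∞}(1_v)`, where `n = |α|` and
`v = r(α)`. -/
def IsPhiA (hA : RowFinite A) (hp : PseudoFree A B) (Φ : (ℋ hp).H₀ ≃+ IndLim hA) : Prop :=
  ∀ α : FinPath A, Φ (pathClass hA hp α) = toLim hA α.len (Finsupp.single α.r 1)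

/-- `Φ : H_1(ℋ_{A,B}) → ℤ_B` is given by `[1_{Z(α, 1, α; Z(α))}] ↦ φ_{n,∞}(1_v)`, where `n = |α|`
and `v = r(α)`. -/
def IsPhiB (hA : RowFinite A) (hB : RowFinite B) (hp : PseudoFree A B)
    (Φ : (ℋ hp).H₁ ≃+ IndLim hB) : Prop :=
  ∀ α : FinPath A, Φ (loopClass hA hp α) = toLim hB α.len (Finsupp.single α.r 1)

end KatsuraExelPardo

end KEP

end

/-! Claim (0). The embedding `incl` identifies `ℋ` with the restriction of the skew product to an
open set of units. A `Transversal` chooses continuously, for each unit `(x, k)`, an arrow to a unit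
`(y, 0)`. Conjugation by these arrows is a homomorphism back to `ℋ`, inverse to `incl` up to natural
transformations, and naturally isomorphic homomorphisms agree on homology (`NatTrans.mapH₀_eq`,
`NatTrans.mapH₁_eq`). The arrow at `(x, k)` replaces an initial segment of `x` by a path with the
same end that is longer by `k`. Such a path exists because the vertices at the end of long paths are
at the end of paths of every length (`exists_reach_subset`).

The maps to the limits. The path space is cut by the cylinders `Z(α)`, `|α| = n`, and `ℋ` by the
bisections `Z(α, m, β)`, `|α| = |β| = n`, and these partitions get finer with `n` (`Subdivision`).
Every function in `C_c` is a combination of cells of one level, uniquely at that level, so finitely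
additive functions on cells extend to homomorphisms on `C_c`. The function `Z(α) ↦
φ_{n,∞}(1_{r(α)})` is additive because `A v w` counts the edges from `v` to `w`. The function `Z(α,
m, β) ↦ m φ_{n,∞}(1_{r(β)})` is additive because of Hermite's identity `∑_{0 ≤ n < a} ⌊(c + n) / a⌋
= c`: for `a = A v w` and `c = m B v w` it says that the values `φ(m, e)` over the edges `e` from
`v` to `w` add up to `m B v w`. This is how `B` enters `H_1`.

Boundaries are killed since `Z(α, m, β) Z(β, m', γ) = Z(α, m + m', γ)`. For injectivity, a function
with value zero in the limit is represented at a late level by a sum of total weight zero. Modulo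
boundaries, the class of `Z(α)` depends only on `r(α)`, and that of `Z(α, m, β)` is a term depending
on `α`, minus the same term for `β`, plus `m` times a class depending on `r(β)` (`arrowCls_eq`). For
a cycle of total weight zero everything cancels. Surjectivity again uses `exists_reach_subset`.

The shift. If `r(α') = r(α)` and `|α'| = |α| + 1`, then `Z(α', 0, α) × {0}` is a bisection of the
skew product from `Z(α) × {1}` to `Z(α') × {0}`. Hence `ρ̃^1` carries the class of `α` to that of
`α'`, in both degrees. -/

noncomputable section

namespace KEP

/-! ### Boundaries of indicator functions of compact open bisections. -/

namespace EtaleGroupoid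

variable {G X : Type*} [TopologicalSpace G] [TopologicalSpace X] (𝒢 : EtaleGroupoid G X)

theorem mul_inv_mul_cancel (g h : G) (p : 𝒢.src g = 𝒢.src h) :
    𝒢.mul (𝒢.mul g (𝒢.inv h) (p.trans (𝒢.rng_inv h).symm)) h
      ((𝒢.src_mul _ _ _).trans (𝒢.src_inv h)) = g := by
  rw [𝒢.mul_assoc g (𝒢.inv h) h _ (𝒢.src_inv h),
    𝒢.mul_congr rfl (𝒢.inv_mul h) _ (p.trans (𝒢.rng_one _).symm),
    𝒢.mul_congr rfl (congrArg 𝒢.one p.symm) _ (𝒢.rng_one _).symm, 𝒢.mul_one]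

theorem mul_mul_inv_cancel (g h : G) (p : 𝒢.src g = 𝒢.rng h) :
    𝒢.mul (𝒢.mul g h p) (𝒢.inv h) ((𝒢.src_mul _ _ _).trans (𝒢.rng_inv h).symm) = g := by
  rw [𝒢.mul_assoc g h (𝒢.inv h) _ (𝒢.rng_inv h).symm,
    𝒢.mul_congr rfl (𝒢.mul_inv h) _ (p.trans (𝒢.rng_one _).symm),
    𝒢.mul_congr rfl (congrArg 𝒢.one p.symm) _ (𝒢.rng_one _).symm, 𝒢.mul_one]

theorem mul_right_cancel {g g' h : G} (p : 𝒢.src g = 𝒢.rng h) (p' : 𝒢.src g' = 𝒢.rng h)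
    (e : 𝒢.mul g h p = 𝒢.mul g' h p') : g = g' := by
  rw [← 𝒢.mul_mul_inv_cancel g h p, ← 𝒢.mul_mul_inv_cancel g' h p']
  exact 𝒢.mul_congr e rfl _ _

/-- The composable pairs `(g, h)` with `g ∈ U` and `h ∈ W`. -/
def pairs (U W : Set G) : Set 𝒢.Comp := {p | p.1.1 ∈ U ∧ p.1.2 ∈ W}

theorem isOpen_pairs {U W : Set G} (hU : IsOpen U) (hW : IsOpen W) : IsOpen (𝒢.pairs U W) :=
  (hU.prod hW).preimage continuous_subtype_val

/-- The unit space is Hausdorff, so the composable pairs form a closed subset of `G × G`. -/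
theorem isCompact_pairs {U W : Set G} (hU : IsCompact U) (hW : IsCompact W) :
    IsCompact (𝒢.pairs U W) := by
  have := 𝒢.t2_units
  have hc : IsClosed {p : G × G | 𝒢.src p.1 = 𝒢.rng p.2} :=
    isClosed_eq (𝒢.isLocalHomeomorph_src.continuous.comp continuous_fst)
      (𝒢.isLocalHomeomorph_rng.continuous.comp continuous_snd)
  exact hc.isClosedEmbedding_subtypeVal.isCompact_preimage (hU.prod hW)

/-- The hypotheses say that `s(U) = r(W)` and `P = UW`. All three faces are injective on the pairs:
`h` determines `g` through `s` on `U`, `g` determines `h` through `r` on `W`, and `gh` determines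
`h` by its source and then `g` by cancellation. So each push-forward of the indicator function is
again an indicator function. -/
theorem δ₂_pairs [T2Space G] {U W P : Set G} (hU : IsCompact U) (hU' : IsOpen U)
    (hW : IsCompact W) (hW' : IsOpen W) (hP : IsCompact P) (hP' : IsOpen P)
    (iU : U.InjOn 𝒢.src) (iW : W.InjOn 𝒢.src) (iW' : W.InjOn 𝒢.rng)
    (h₂ : ∀ g ∈ U, ∃ h ∈ W, 𝒢.src g = 𝒢.rng h) (h₀ : ∀ h ∈ W, ∃ g ∈ U, 𝒢.src g = 𝒢.rng h)
    (hP₁ : ∀ g ∈ U, ∀ h ∈ W, ∀ p, 𝒢.mul g h p ∈ P)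
    (hP₂ : ∀ k ∈ P, ∃ g ∈ U, ∃ h ∈ W, ∃ p, 𝒢.mul g h p = k) :
    𝒢.δ₂ (ind (𝒢.pairs U W) (𝒢.isCompact_pairs hU hW) (𝒢.isOpen_pairs hU' hW'))
      = ind W hW hW' - ind P hP hP' + ind U hU hU' := by
  have j0 : (𝒢.pairs U W).InjOn 𝒢.d0 := by
    rintro ⟨⟨g, h⟩, p⟩ ⟨hg, _⟩ ⟨⟨g', h'⟩, p'⟩ ⟨hg', _⟩ (rfl : h = h')
    obtain rfl : g = g' := iU hg hg' (p.trans p'.symm)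
    rfl
  have j2 : (𝒢.pairs U W).InjOn 𝒢.d2 := by
    rintro ⟨⟨g, h⟩, p⟩ ⟨_, hh⟩ ⟨⟨g', h'⟩, p'⟩ ⟨_, hh'⟩ (rfl : g = g')
    obtain rfl : h = h' := iW' hh hh' (p.symm.trans p')
    rfl
  have j1 : (𝒢.pairs U W).InjOn 𝒢.d1 := by
    rintro ⟨⟨g, h⟩, p⟩ ⟨hg, hh⟩ ⟨⟨g', h'⟩, p'⟩ ⟨hg', hh'⟩ e
    have e' : 𝒢.mul g h p = 𝒢.mul g' h' p' := e
    have e1 := congrArg 𝒢.src e'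
    rw [𝒢.src_mul, 𝒢.src_mul] at e1
    obtain rfl : h = h' := iW hh hh' e1
    obtain rfl : g = g' := 𝒢.mul_right_cancel p p' e'
    rfl
  have i0 : 𝒢.d0 '' 𝒢.pairs U W = W := by
    ext h
    constructor
    · rintro ⟨p, hp, rfl⟩
      exact hp.2
    · intro hh
      obtain ⟨g, hg, p⟩ := h₀ h hh
      exact ⟨⟨(g, h), p⟩, ⟨hg, hh⟩, rfl⟩
  have i2 : 𝒢.d2 '' 𝒢.pairs U W = U := by
    ext g
    constructor
    · rintro ⟨p, hp, rfl⟩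
      exact hp.1
    · intro hg
      obtain ⟨h, hh, p⟩ := h₂ g hg
      exact ⟨⟨(g, h), p⟩, ⟨hg, hh⟩, rfl⟩
  have i1 : 𝒢.d1 '' 𝒢.pairs U W = P := by
    ext k
    constructor
    · rintro ⟨p, hp, rfl⟩
      exact hP₁ _ hp.1 _ hp.2 _
    · intro hk
      obtain ⟨g, hg, h, hh, p, rfl⟩ := hP₂ k hk
      exact ⟨⟨(g, h), p⟩, ⟨hg, hh⟩, rfl⟩
  change push _ 𝒢.isLocalHomeomorph_d0 _ - push _ 𝒢.isLocalHomeomorph_d1 _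
    + push _ 𝒢.isLocalHomeomorph_d2 _ = _
  rw [push_ind _ _ _ j0 i0 hW hW', push_ind _ _ _ j1 i1 hP hP', push_ind _ _ _ j2 i2 hU hU']

theorem δ₁_ind [T2Space G] [T2Space X] {U : Set G} (hU : IsCompact U) (hU' : IsOpen U)
    (iU : U.InjOn 𝒢.src) (iU' : U.InjOn 𝒢.rng) {S R : Set X} (hS : 𝒢.src '' U = S)
    (hR : 𝒢.rng '' U = R) (cS : IsCompact S) (oS : IsOpen S) (cR : IsCompact R) (oR : IsOpen R) :
    𝒢.δ₁ (ind U hU hU') = ind S cS oS - ind R cR oR := by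
  change push _ 𝒢.isLocalHomeomorph_src _ - push _ 𝒢.isLocalHomeomorph_rng _ = _
  rw [push_ind _ _ _ iU hS cS oS, push_ind _ _ _ iU' hR cR oR]

end EtaleGroupoid

/-! ### Invariance of homology under natural transformations. -/

namespace EtaleHom

variable {G X G' X' G'' X'' : Type*} [TopologicalSpace G] [TopologicalSpace X]
  [TopologicalSpace G'] [TopologicalSpace X'] [TopologicalSpace G''] [TopologicalSpace X'']
  {𝒢 : EtaleGroupoid G X} {𝒢' : EtaleGroupoid G' X'} {𝒢'' : EtaleGroupoid G'' X''}

variable (𝒢) in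
/-- The identity homomorphism. -/
def id : EtaleHom 𝒢 𝒢 where
  arr g := g
  pt x := x
  src_arr _ := rfl
  rng_arr _ := rfl
  arr_mul _ _ _ := rfl
  isLocalHomeomorph_arr := (Homeomorph.refl G).isLocalHomeomorph
  isLocalHomeomorph_pt := (Homeomorph.refl X).isLocalHomeomorph

/-- The composite of two homomorphisms. -/
def trans (F : EtaleHom 𝒢 𝒢') (F' : EtaleHom 𝒢' 𝒢'') : EtaleHom 𝒢 𝒢'' where
  arr g := F'.arr (F.arr g)
  pt x := F'.pt (F.pt x)
  src_arr g := by rw [F'.src_arr, F.src_arr]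
  rng_arr g := by rw [F'.rng_arr, F.rng_arr]
  arr_mul g h p := by
    rw [← F'.arr_mul _ _ (by rw [F.src_arr, F.rng_arr, p])]
    exact congrArg F'.arr (F.arr_mul g h p)
  isLocalHomeomorph_arr := F'.isLocalHomeomorph_arr.comp F.isLocalHomeomorph_arr
  isLocalHomeomorph_pt := F'.isLocalHomeomorph_pt.comp F.isLocalHomeomorph_pt

theorem push_id {Y : Type*} [TopologicalSpace Y] [T2Space Y] (h : IsLocalHomeomorph fun y : Y => y)
    (f : C_c(Y, ℤ)) : push (fun y : Y => y) h f = f := by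
  ext y
  rw [push_apply]
  exact finsum_mem_singleton

theorem mapH₀_id (ξ : 𝒢.H₀) : (id 𝒢).mapH₀ ξ = ξ := by
  have := 𝒢.t2_units
  induction ξ using QuotientAddGroup.induction_on with
  | H f => exact congrArg (QuotientAddGroup.mk (s := 𝒢.δ₁.range)) (push_id _ f)

theorem mapH₁_id (ξ : 𝒢.H₁) : (id 𝒢).mapH₁ ξ = ξ := by
  have := 𝒢.t2_arrows
  induction ξ using QuotientAddGroup.induction_on with
  | H f =>
    exact congrArg (QuotientAddGroup.mk (s := 𝒢.δ₂.range.addSubgroupOf 𝒢.δ₁.ker))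
      (Subtype.ext (push_id _ f.1))

theorem mapH₀_trans (F : EtaleHom 𝒢 𝒢') (F' : EtaleHom 𝒢' 𝒢'') (ξ : 𝒢.H₀) :
    (F.trans F').mapH₀ ξ = F'.mapH₀ (F.mapH₀ ξ) := by
  have := 𝒢.t2_units
  have := 𝒢'.t2_units
  have := 𝒢''.t2_units
  induction ξ using QuotientAddGroup.induction_on with
  | H f =>
    exact congrArg (QuotientAddGroup.mk (s := 𝒢''.δ₁.range))
      (push_push F.isLocalHomeomorph_pt F'.isLocalHomeomorph_pt f).symm

theorem mapH₁_trans (F : EtaleHom 𝒢 𝒢') (F' : EtaleHom 𝒢' 𝒢'') (ξ : 𝒢.H₁) :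
    (F.trans F').mapH₁ ξ = F'.mapH₁ (F.mapH₁ ξ) := by
  have := 𝒢.t2_arrows
  have := 𝒢'.t2_arrows
  have := 𝒢''.t2_arrows
  induction ξ using QuotientAddGroup.induction_on with
  | H f =>
    exact congrArg (QuotientAddGroup.mk (s := 𝒢''.δ₂.range.addSubgroupOf 𝒢''.δ₁.ker))
      (Subtype.ext (push_push F.isLocalHomeomorph_arr F'.isLocalHomeomorph_arr f.1).symm)

/-- A continuous natural transformation between homomorphisms. -/
structure NatTrans (F F' : EtaleHom 𝒢 𝒢') where
  app : X → G'
  continuous_app : Continuous app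
  src_app : ∀ x, 𝒢'.src (app x) = F.pt x
  rng_app : ∀ x, 𝒢'.rng (app x) = F'.pt x
  naturality : ∀ g, 𝒢'.mul (app (𝒢.rng g)) (F.arr g) ((src_app _).trans (F.rng_arr g).symm)
    = 𝒢'.mul (F'.arr g) (app (𝒢.src g)) ((F'.src_arr g).trans (rng_app _).symm)

namespace NatTrans

variable {F F' : EtaleHom 𝒢 𝒢'} (θ : NatTrans F F')

theorem isLocalHomeomorph_app : IsLocalHomeomorph θ.app := by
  refine IsLocalHomeomorph.of_comp (g := 𝒢'.src) ?_ 𝒢'.isLocalHomeomorph_src θ.continuous_app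
  rw [show 𝒢'.src ∘ θ.app = F.pt from funext θ.src_app]
  exact F.isLocalHomeomorph_pt

/-- The composable pair `(θ(r(g)), F(g))`. -/
def left (g : G) : 𝒢'.Comp :=
  ⟨(θ.app (𝒢.rng g), F.arr g), (θ.src_app _).trans (F.rng_arr g).symm⟩

/-- The composable pair `(F'(g), θ(s(g)))`. -/
def right (g : G) : 𝒢'.Comp :=
  ⟨(F'.arr g, θ.app (𝒢.src g)), (F'.src_arr g).trans (θ.rng_app _).symm⟩

theorem isLocalHomeomorph_left : IsLocalHomeomorph θ.left :=
  IsLocalHomeomorph.of_comp (g := 𝒢'.d0) F.isLocalHomeomorph_arr 𝒢'.isLocalHomeomorph_d0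
    (((θ.continuous_app.comp 𝒢.isLocalHomeomorph_rng.continuous).prodMk
      F.isLocalHomeomorph_arr.continuous).subtype_mk _)

theorem isLocalHomeomorph_right : IsLocalHomeomorph θ.right :=
  IsLocalHomeomorph.of_comp (g := 𝒢'.d2) F'.isLocalHomeomorph_arr 𝒢'.isLocalHomeomorph_d2
    ((F'.isLocalHomeomorph_arr.continuous.prodMk
      (θ.continuous_app.comp 𝒢.isLocalHomeomorph_src.continuous)).subtype_mk _)

/-- The arrows `θ(x)` lead from `F(x)` to `F'(x)`, so the push-forward of `f` along `θ` has boundary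
`F_* f - F'_* f`. -/
theorem mapH₀_eq (θ : NatTrans F F') : F.mapH₀ = F'.mapH₀ := by
  have := 𝒢.t2_units
  have := 𝒢'.t2_units
  have := 𝒢'.t2_arrows
  ext f
  refine ((QuotientAddGroup.eq (s := 𝒢'.δ₁.range)).2
    ⟨push θ.app θ.isLocalHomeomorph_app f, ?_⟩).symm
  change push _ 𝒢'.isLocalHomeomorph_src _ - push _ 𝒢'.isLocalHomeomorph_rng _
    = - push F'.pt F'.isLocalHomeomorph_pt f + push F.pt F.isLocalHomeomorph_pt f
  rw [push_push, push_push, push_congr _ F.isLocalHomeomorph_pt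
    (show 𝒢'.src ∘ θ.app = F.pt from funext θ.src_app), push_congr _ F'.isLocalHomeomorph_pt
    (show 𝒢'.rng ∘ θ.app = F'.pt from funext θ.rng_app)]
  abel

/-- The diagonal of the naturality square of `g` cuts it into the composable pairs `left` and
`right`, which have the same product. In the boundary of the difference of their push-forwards the
products cancel. Besides `F_* f - F'_* f` there remains the push-forward along `θ` of `r_* f - s_*
f`, which is zero for a cycle. -/
theorem mapH₁_eq (θ : NatTrans F F') : F.mapH₁ = F'.mapH₁ := by
  have := 𝒢.t2_units
  have := 𝒢.t2_arrows
  have := 𝒢'.t2_units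
  have := 𝒢'.t2_arrows
  ext ⟨f, hf⟩
  refine ((QuotientAddGroup.eq (s := 𝒢'.δ₂.range.addSubgroupOf 𝒢'.δ₁.ker)).2
    ⟨push θ.left θ.isLocalHomeomorph_left f - push θ.right θ.isLocalHomeomorph_right f, ?_⟩).symm
  have hf : push 𝒢.src 𝒢.isLocalHomeomorph_src f - push 𝒢.rng 𝒢.isLocalHomeomorph_rng f = 0 := hf
  change push _ 𝒢'.isLocalHomeomorph_d0 _ - push _ 𝒢'.isLocalHomeomorph_d1 _
    + push _ 𝒢'.isLocalHomeomorph_d2 _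
    = - push F'.arr F'.isLocalHomeomorph_arr f + push F.arr F.isLocalHomeomorph_arr f
  have e := congrArg (push θ.app θ.isLocalHomeomorph_app) hf
  rw [map_sub, map_zero, push_push, push_push] at e
  simp only [map_sub, push_push]
  rw [push_congr _ (𝒢'.isLocalHomeomorph_d1.comp θ.isLocalHomeomorph_right)
    (show 𝒢'.d1 ∘ θ.left = 𝒢'.d1 ∘ θ.right from funext θ.naturality)]
  have e1 : push (𝒢'.d0 ∘ θ.left) (𝒢'.isLocalHomeomorph_d0.comp θ.isLocalHomeomorph_left) f
    = push F.arr F.isLocalHomeomorph_arr f := rfl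
  have e2 : push (𝒢'.d2 ∘ θ.right) (𝒢'.isLocalHomeomorph_d2.comp θ.isLocalHomeomorph_right) f
    = push F'.arr F'.isLocalHomeomorph_arr f := rfl
  have e3 : push (𝒢'.d2 ∘ θ.left) (𝒢'.isLocalHomeomorph_d2.comp θ.isLocalHomeomorph_left) f
    = push (θ.app ∘ 𝒢.rng) (θ.isLocalHomeomorph_app.comp 𝒢.isLocalHomeomorph_rng) f := rfl
  have e4 : push (𝒢'.d0 ∘ θ.right) (𝒢'.isLocalHomeomorph_d0.comp θ.isLocalHomeomorph_right) f
    = push (θ.app ∘ 𝒢.src) (θ.isLocalHomeomorph_app.comp 𝒢.isLocalHomeomorph_src) f := rfl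
  rw [e1, e2, e3, e4, sub_eq_zero.1 e]
  abel

end NatTrans

end EtaleHom

/-! ### Retraction of the skew product onto the kernel of the cocycle. -/

section Transversal

variable {G X : Type*} [TopologicalSpace G] [TopologicalSpace X] {𝒢 : EtaleGroupoid G X}
  (ρ : Cocycle 𝒢)

/-- A continuous choice, for each unit `(x, k)` of the skew product, of an arrow from it to the
open set `𝒢^(0) × {0}`. -/
structure Transversal where
  arr : X × ℤ → G
  continuous_arr : Continuous arr
  src_arr : ∀ y, 𝒢.src (arr y) = y.1
  lag_arr : ∀ y, ρ.toFun (arr y) = y.2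

variable {ρ} (θ : Transversal ρ)

namespace Transversal

/-- The product `θ(r(a)) a`. -/
def lmul (a : G × ℤ) : G := 𝒢.mul (θ.arr ((skew ρ).rng a)) a.1 (θ.src_arr _)

theorem src_lmul (a : G × ℤ) : 𝒢.src (θ.lmul a) = 𝒢.src (θ.arr ((skew ρ).src a)) :=
  (𝒢.src_mul _ _ _).trans (θ.src_arr ((skew ρ).src a)).symm

/-- The arrow `θ(r(a)) a θ(s(a))⁻¹`. -/
def conj (a : G × ℤ) : G :=
  𝒢.mul (θ.lmul a) (𝒢.inv (θ.arr ((skew ρ).src a))) ((θ.src_lmul a).trans (𝒢.rng_inv _).symm)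

theorem src_conj (a : G × ℤ) : 𝒢.src (θ.conj a) = 𝒢.rng (θ.arr ((skew ρ).src a)) :=
  (𝒢.src_mul _ _ _).trans (𝒢.src_inv _)

theorem rng_conj (a : G × ℤ) : 𝒢.rng (θ.conj a) = 𝒢.rng (θ.arr ((skew ρ).rng a)) :=
  (𝒢.rng_mul _ _ _).trans (𝒢.rng_mul _ _ _)

theorem conj_mul (a : G × ℤ) : 𝒢.mul (θ.conj a) (θ.arr ((skew ρ).src a)) (θ.src_conj a)
    = θ.lmul a := 𝒢.mul_inv_mul_cancel _ _ (θ.src_lmul a)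

/-- For `a = (g, k)` the three factors contribute `k`, `ρ(g)` and `-(k + ρ(g))`. -/
theorem lag_conj (a : G × ℤ) : ρ.toFun (θ.conj a) = 0 := by
  have h1 : ρ.toFun (θ.conj a) = ρ.toFun (θ.lmul a) + ρ.toFun (𝒢.inv _) := ρ.map_mul _ _ _
  have h2 : ρ.toFun (θ.lmul a) = ρ.toFun (θ.arr ((skew ρ).rng a)) + ρ.toFun a.1 := ρ.map_mul _ _ _
  have h3 : ((skew ρ).src a).2 = ((skew ρ).rng a).2 + ρ.toFun a.1 := rfl
  rw [h1, h2, ρ.map_inv, θ.lag_arr, θ.lag_arr, h3]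
  omega

theorem continuous_conj : Continuous θ.conj := by
  have h1 : Continuous θ.lmul := 𝒢.continuous_mul.comp (Continuous.subtype_mk
    (f := fun a => (θ.arr ((skew ρ).rng a), a.1))
    ((θ.continuous_arr.comp (skew ρ).isLocalHomeomorph_rng.continuous).prodMk continuous_fst)
    fun a => θ.src_arr _)
  exact 𝒢.continuous_mul.comp (Continuous.subtype_mk
    (f := fun a => (θ.lmul a, 𝒢.inv (θ.arr ((skew ρ).src a))))
    (h1.prodMk (𝒢.continuous_inv.comp
      (θ.continuous_arr.comp (skew ρ).isLocalHomeomorph_src.continuous)))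
    fun a => (θ.src_lmul a).trans (𝒢.rng_inv _).symm)

/-- Multiplied on the right by `θ(s(b))`, both sides become `θ(r(a)) a b`, and right multiplication
can be cancelled. The `mul_congr` steps only transport proofs of composability. -/
theorem conj_conj (a b : G × ℤ) (p : (skew ρ).src a = (skew ρ).rng b) :
    θ.conj ((skew ρ).mul a b p) = 𝒢.mul (θ.conj a) (θ.conj b)
      ((θ.src_conj a).trans ((congrArg (fun y => 𝒢.rng (θ.arr y)) p).trans (θ.rng_conj b).symm)) := by
  have q : 𝒢.src (θ.conj b) = 𝒢.rng (θ.arr ((skew ρ).src b)) := θ.src_conj b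
  have e : (skew ρ).src ((skew ρ).mul a b p) = (skew ρ).src b := (skew ρ).src_mul a b p
  have q' : 𝒢.src (θ.conj ((skew ρ).mul a b p)) = 𝒢.rng (θ.arr ((skew ρ).src b)) := by
    rw [θ.src_conj, e]
  refine 𝒢.mul_right_cancel (h := θ.arr ((skew ρ).src b)) q' ((𝒢.src_mul _ _ _).trans q) ?_
  have h1 := θ.conj_mul ((skew ρ).mul a b p)
  rw [𝒢.mul_congr rfl (congrArg θ.arr e) _ q'] at h1
  rw [h1, 𝒢.mul_assoc _ _ _ _ q, 𝒢.mul_congr rfl (θ.conj_mul b) _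
    ((θ.src_conj a).trans ((congrArg (fun y => 𝒢.rng (θ.arr y)) p).trans
      (𝒢.rng_mul _ _ _).symm))]
  have r1 : 𝒢.src (θ.conj a) = 𝒢.rng (θ.arr ((skew ρ).rng b)) :=
    (θ.src_conj a).trans (congrArg (fun y => 𝒢.rng (θ.arr y)) p)
  have h2 := 𝒢.mul_assoc (θ.conj a) (θ.arr ((skew ρ).rng b)) b.1 r1 (θ.src_arr _)
  refine Eq.trans ?_ h2
  have h3 := θ.conj_mul a
  rw [𝒢.mul_congr rfl (congrArg θ.arr p) _ r1] at h3
  rw [𝒢.mul_congr h3 rfl _ ((𝒢.src_mul _ _ _).trans (congrArg Prod.fst p))]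
  have h4 : (skew ρ).rng ((skew ρ).mul a b p) = (skew ρ).rng a := (skew ρ).rng_mul a b p
  refine Eq.trans ?_
    (𝒢.mul_assoc (θ.arr ((skew ρ).rng a)) a.1 b.1 (θ.src_arr _) (congrArg Prod.fst p)).symm
  exact 𝒢.mul_congr (congrArg θ.arr h4) rfl _ _

/-- A transversal is a continuous section of `g ↦ (s(g), ρ(g))`, which is a local homeomorphism,
being the source map of the skew product on `G × {0}`. -/
theorem isLocalHomeomorph_arr : IsLocalHomeomorph θ.arr := by
  refine IsLocalHomeomorph.of_comp (g := fun g : G => (𝒢.src g, ρ.toFun g)) ?_ ?_ θ.continuous_arr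
  · rw [show (fun g : G => (𝒢.src g, ρ.toFun g)) ∘ θ.arr = fun y => y from
      funext fun y => Prod.ext (θ.src_arr y) (θ.lag_arr y)]
    exact (Homeomorph.refl _).isLocalHomeomorph
  · have h := (skew ρ).isLocalHomeomorph_src.comp (isOpenEmbedding_prodMk_zero G).isLocalHomeomorph
    rwa [show (skew ρ).src ∘ (fun g : G => (g, (0 : ℤ))) = fun g : G => (𝒢.src g, ρ.toFun g) from
      funext fun g => by simp [skew]] at h

/-- The retraction of the skew product onto `ker ρ`. -/
def retract : EtaleHom (skew ρ) (kernel ρ) where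
  arr a := ⟨θ.conj a, θ.lag_conj a⟩
  pt y := 𝒢.rng (θ.arr y)
  src_arr a := θ.src_conj a
  rng_arr a := θ.rng_conj a
  arr_mul a b p := Subtype.ext (θ.conj_conj a b p)
  isLocalHomeomorph_arr := by
    refine IsLocalHomeomorph.of_comp (g := (kernel ρ).src) ?_ (kernel ρ).isLocalHomeomorph_src
      (θ.continuous_conj.subtype_mk _)
    rw [show (kernel ρ).src ∘ (fun a => (⟨θ.conj a, θ.lag_conj a⟩ : {g // ρ.toFun g = 0}))
      = 𝒢.rng ∘ θ.arr ∘ (skew ρ).src from funext θ.src_conj]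
    exact 𝒢.isLocalHomeomorph_rng.comp (θ.isLocalHomeomorph_arr.comp (skew ρ).isLocalHomeomorph_src)
  isLocalHomeomorph_pt := 𝒢.isLocalHomeomorph_rng.comp θ.isLocalHomeomorph_arr

/-- The transversal as a natural transformation from the identity to `incl ∘ retract`. -/
def skewTrans : EtaleHom.NatTrans (EtaleHom.id (skew ρ)) (θ.retract.trans (incl ρ)) where
  app y := (θ.arr y, 0)
  continuous_app := θ.continuous_arr.prodMk continuous_const
  src_app y := Prod.ext (θ.src_arr y) ((zero_add _).trans (θ.lag_arr y))
  rng_app _ := rfl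
  naturality a := Prod.ext (θ.conj_mul a).symm rfl

/-- The transversal as a natural transformation from the identity to `retract ∘ incl`. -/
def kernelTrans : EtaleHom.NatTrans (EtaleHom.id (kernel ρ)) ((incl ρ).trans θ.retract) where
  app x := ⟨θ.arr (x, 0), θ.lag_arr _⟩
  continuous_app := (θ.continuous_arr.comp (continuous_id.prodMk continuous_const)).subtype_mk _
  src_app x := θ.src_arr (x, 0)
  rng_app x := rfl
  naturality a := by
    refine Subtype.ext ?_
    have e : (skew ρ).src (a.1, 0) = ((kernel ρ).src a, 0) := (incl ρ).src_arr a
    refine (θ.conj_mul (a.1, 0)).symm.trans ?_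
    exact 𝒢.mul_congr rfl (congrArg θ.arr e) _ _

theorem bijective_mapH₀ (θ : Transversal ρ) : Function.Bijective (incl ρ).mapH₀ := by
  refine Function.bijective_iff_has_inverse.2 ⟨θ.retract.mapH₀, fun ξ => ?_, fun ξ => ?_⟩
  · rw [← EtaleHom.mapH₀_trans, ← θ.kernelTrans.mapH₀_eq, EtaleHom.mapH₀_id]
  · rw [← EtaleHom.mapH₀_trans, ← θ.skewTrans.mapH₀_eq, EtaleHom.mapH₀_id]

theorem bijective_mapH₁ (θ : Transversal ρ) : Function.Bijective (incl ρ).mapH₁ := by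
  refine Function.bijective_iff_has_inverse.2 ⟨θ.retract.mapH₁, fun ξ => ?_, fun ξ => ?_⟩
  · rw [← EtaleHom.mapH₁_trans, ← θ.kernelTrans.mapH₁_eq, EtaleHom.mapH₁_id]
  · rw [← EtaleHom.mapH₁_trans, ← θ.skewTrans.mapH₁_eq, EtaleHom.mapH₁_id]

end Transversal

end Transversal

/-! ### Homomorphisms out of free abelian groups. -/

section FreeLift

variable {T L : Type*} [AddCommGroup L]

/-- The homomorphism from the free abelian group on `T` that extends `f`. -/
def freeLift (f : T → L) : (T →₀ ℤ) →+ L := Finsupp.liftAddHom fun t => zmultiplesHom L (f t)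

theorem freeLift_apply (f : T → L) (F : T →₀ ℤ) : freeLift f F = F.sum fun t k => k • f t := rfl

theorem freeLift_single (f : T → L) (t : T) (k : ℤ) : freeLift f (Finsupp.single t k) = k • f t := by
  rw [freeLift_apply]
  exact Finsupp.sum_single_index (zero_smul ℤ (f t))

theorem freeHom_ext {a b : (T →₀ ℤ) →+ L}
    (h : ∀ t, a (Finsupp.single t 1) = b (Finsupp.single t 1)) : a = b := by
  refine Finsupp.addHom_ext fun t k => ?_
  rw [← mul_one k, ← smul_eq_mul, ← Finsupp.smul_single, map_zsmul, map_zsmul, h]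

end FreeLift

/-! ### Generation of `C_c(X, ℤ)` by indicator functions of nested or disjoint sets. -/

section Generation

variable {X : Type*} [TopologicalSpace X] [T2Space X]

theorem ind_apply {S : Set X} (hc : IsCompact S) (ho : IsOpen S) (x : X) :
    ind S hc ho x = S.indicator 1 x := rfl

theorem ind_apply_of_mem {S : Set X} (hc : IsCompact S) (ho : IsOpen S) {x : X} (h : x ∈ S) :
    ind S hc ho x = 1 := Set.indicator_of_mem h _

theorem ind_apply_of_notMem {S : Set X} (hc : IsCompact S) (ho : IsOpen S) {x : X} (h : x ∉ S) :
    ind S hc ho x = 0 := Set.indicator_of_notMem h _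

theorem ind_congr {S S' : Set X} (hc : IsCompact S) (ho : IsOpen S) (h : S = S')
    (hc' : IsCompact S') (ho' : IsOpen S') : ind S hc ho = ind S' hc' ho' := by
  subst h
  rfl

theorem ind_mul_ind_of_subset {S S' : Set X} (hc : IsCompact S) (ho : IsOpen S)
    (hc' : IsCompact S') (ho' : IsOpen S') (h : S ⊆ S') :
    ind S hc ho * ind S' hc' ho' = ind S hc ho := by
  ext x
  rw [CompactlySupportedContinuousMap.mul_apply]
  by_cases hx : x ∈ S
  · rw [ind_apply_of_mem _ _ hx, ind_apply_of_mem _ _ (h hx), _root_.mul_one]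
  · rw [ind_apply_of_notMem _ _ hx, zero_mul]

theorem ind_mul_ind_of_disjoint {S S' : Set X} (hc : IsCompact S) (ho : IsOpen S)
    (hc' : IsCompact S') (ho' : IsOpen S') (h : Disjoint S S') :
    ind S hc ho * ind S' hc' ho' = 0 := by
  ext x
  rw [CompactlySupportedContinuousMap.mul_apply]
  by_cases hx : x ∈ S
  · rw [ind_apply_of_notMem hc' ho' (Set.disjoint_left.1 h hx), mul_zero]
    rfl
  · rw [ind_apply_of_notMem _ _ hx, zero_mul]
    rfl

theorem ind_union {S S' : Set X} (hc : IsCompact S) (ho : IsOpen S) (hc' : IsCompact S')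
    (ho' : IsOpen S') : ind (S ∪ S') (hc.union hc') (ho.union ho')
      = ind S hc ho + ind S' hc' ho' - ind S hc ho * ind S' hc' ho' := by
  ext x
  rw [CompactlySupportedContinuousMap.sub_apply, CompactlySupportedContinuousMap.add_apply,
    CompactlySupportedContinuousMap.mul_apply]
  simp only [ind_apply]
  by_cases h : x ∈ S <;> by_cases h' : x ∈ S' <;> simp [h, h']

variable {ι : Type*} {S : ι → Set X} (hc : ∀ i, IsCompact (S i)) (ho : ∀ i, IsOpen (S i))

/-- The product of two of the indicator functions is one of them if the sets are nested, and zero if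
they are disjoint. -/
theorem mul_mem_closure_ind (hn : ∀ i j, S i ⊆ S j ∨ S j ⊆ S i ∨ Disjoint (S i) (S j))
    {f g : C_c(X, ℤ)} (hf : f ∈ AddSubgroup.closure (range fun i => ind (S i) (hc i) (ho i)))
    (hg : g ∈ AddSubgroup.closure (range fun i => ind (S i) (hc i) (ho i))) :
    f * g ∈ AddSubgroup.closure (range fun i => ind (S i) (hc i) (ho i)) := by
  induction hf, hg using AddSubgroup.closure_induction₂ with
  | mem x y hx hy =>
    obtain ⟨i, rfl⟩ := hx
    obtain ⟨j, rfl⟩ := hy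
    change ind (S i) (hc i) (ho i) * ind (S j) (hc j) (ho j) ∈ _
    rcases hn i j with h | h | h
    · rw [ind_mul_ind_of_subset _ _ _ _ h]
      exact AddSubgroup.subset_closure ⟨i, rfl⟩
    · rw [mul_comm, ind_mul_ind_of_subset _ _ _ _ h]
      exact AddSubgroup.subset_closure ⟨j, rfl⟩
    · rw [ind_mul_ind_of_disjoint _ _ _ _ h]
      exact zero_mem _
  | zero_left x _ =>
    rw [zero_mul]
    exact zero_mem _
  | zero_right x _ =>
    rw [mul_zero]
    exact zero_mem _
  | add_left x y z _ _ _ h1 h2 =>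
    rw [add_mul]
    exact add_mem h1 h2
  | add_right x y z _ _ _ h1 h2 =>
    rw [mul_add]
    exact add_mem h1 h2
  | neg_left x y _ _ h =>
    rw [show -x * y = -(x * y) by ext z; exact neg_mul (x z) (y z)]
    exact neg_mem h
  | neg_right x y _ _ h =>
    rw [show x * -y = -(x * y) by ext z; exact mul_neg (x z) (y z)]
    exact neg_mem h

/-- A compact open set is a finite union of sets `S i`. The indicator function of a union is
computed by inclusion and exclusion, and the product terms stay in the subgroup by
`mul_mem_closure_ind`. -/
theorem ind_mem_closure_ind (hn : ∀ i j, S i ⊆ S j ∨ S j ⊆ S i ∨ Disjoint (S i) (S j))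
    (hb : ∀ x, ∀ U ∈ 𝓝 x, ∃ i, x ∈ S i ∧ S i ⊆ U) {K : Set X} (cK : IsCompact K)
    (oK : IsOpen K) :
    ind K cK oK ∈ AddSubgroup.closure (range fun i => ind (S i) (hc i) (ho i)) := by
  have h1 : ∀ s : Finset ι, ∃ (c : IsCompact (⋃ i ∈ s, S i)) (o : IsOpen (⋃ i ∈ s, S i)),
      ind _ c o ∈ AddSubgroup.closure (range fun i => ind (S i) (hc i) (ho i)) := by
    classical
    intro s
    induction s using Finset.induction_on with
    | empty =>
      simp only [Finset.notMem_empty, iUnion_of_empty, iUnion_empty]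
      refine ⟨isCompact_empty, isOpen_empty, ?_⟩
      rw [show ind ∅ isCompact_empty isOpen_empty = (0 : C_c(X, ℤ)) by
        ext x
        exact ind_apply_of_notMem _ _ (Set.notMem_empty x)]
      exact zero_mem _
    | insert i s _ ih =>
      obtain ⟨c, o, h⟩ := ih
      rw [Finset.set_biUnion_insert]
      refine ⟨(hc i).union c, (ho i).union o, ?_⟩
      have hi := AddSubgroup.subset_closure (k := range fun i => ind (S i) (hc i) (ho i)) ⟨i, rfl⟩
      rw [ind_union (hc i) (ho i) c o]
      exact sub_mem (add_mem hi h) (mul_mem_closure_ind hc ho hn hi h)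
  have h2 : ∀ x ∈ K, ∃ i, x ∈ S i ∧ S i ⊆ K := fun x hx => hb x K (oK.mem_nhds hx)
  obtain ⟨t, ht⟩ := cK.elim_finite_subcover (fun i : {i // S i ⊆ K} => S i) (fun i => ho i) (by
    intro x hx
    obtain ⟨i, hxi, hi⟩ := h2 x hx
    exact mem_iUnion.2 ⟨⟨i, hi⟩, hxi⟩)
  classical
  obtain ⟨c, o, h⟩ := h1 (t.image Subtype.val)
  rw [ind_congr cK oK ?_ c o]
  · exact h
  · refine Subset.antisymm (fun x hx => ?_) (fun x hx => ?_)
    · obtain ⟨i, hi, hxi⟩ := mem_iUnion₂.1 (ht hx)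
      exact mem_iUnion₂.2 ⟨i.1, Finset.mem_image_of_mem _ hi, hxi⟩
    · obtain ⟨i, hi, hxi⟩ := mem_iUnion₂.1 hx
      obtain ⟨j, _, rfl⟩ := Finset.mem_image.1 hi
      exact j.2 hxi

/-- If the compact open sets `S i` form a basis and any two are nested or disjoint, then their
indicator functions generate `C_c(X, ℤ)`. -/
theorem closure_ind_eq_top (hn : ∀ i j, S i ⊆ S j ∨ S j ⊆ S i ∨ Disjoint (S i) (S j))
    (hb : ∀ x, ∀ U ∈ 𝓝 x, ∃ i, x ∈ S i ∧ S i ⊆ U) :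
    AddSubgroup.closure (range fun i => ind (S i) (hc i) (ho i)) = ⊤ := by
  refine eq_top_iff.2 fun f _ => ?_
  have hfin : (range f).Finite := by
    have h1 : (f '' tsupport f).Finite :=
      (f.hasCompactSupport.isCompact.image f.continuous).finite_of_discrete
    refine (h1.insert 0).subset ?_
    rintro _ ⟨x, rfl⟩
    by_cases hx : x ∈ tsupport f
    · exact Or.inr ⟨x, hx, rfl⟩
    · exact Or.inl (image_eq_zero_of_notMem_tsupport hx)
  have hk : ∀ k : ℤ, k ≠ 0 → IsCompact (f ⁻¹' {k}) := fun k hk =>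
    f.hasCompactSupport.isCompact.of_isClosed_subset ((isClosed_discrete _).preimage f.continuous)
      fun x hx => subset_tsupport _ (by
        have : f x = k := hx
        rwa [Function.mem_support, this])
  have hk' : ∀ k : ℤ, IsOpen (f ⁻¹' {k}) := fun k => (isOpen_discrete _).preimage f.continuous
  -- The part of `f` with value `k`. The level set of `0` need not be compact; its part is zero
  -- anyway.
  let g : ℤ → C_c(X, ℤ) := fun k =>
    if h : k ≠ 0 then k • ind (f ⁻¹' {k}) (hk k h) (hk' k) else 0
  have hg : ∀ k x, g k x = if f x = k then k else 0 := by
    intro k x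
    by_cases h : k ≠ 0
    · simp only [g, dif_pos h]
      rw [CompactlySupportedContinuousMap.smul_apply]
      split_ifs with hx
      · rw [ind_apply_of_mem _ _ (show x ∈ f ⁻¹' {k} from hx), smul_eq_mul, _root_.mul_one]
      · rw [ind_apply_of_notMem _ _ (show x ∉ f ⁻¹' {k} from hx), smul_zero]
    · have h : k = 0 := not_not.1 h
      subst h
      simp [g]
  have hf : f = ∑ k ∈ hfin.toFinset, g k := by
    ext x
    rw [CompactlySupportedContinuousMap.coe_sum, Finset.sum_apply]
    simp only [hg]
    rw [Finset.sum_ite_eq, if_pos (hfin.mem_toFinset.2 ⟨x, rfl⟩)]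
  rw [hf]
  refine sum_mem fun k _ => ?_
  simp only [g]
  split_ifs with h
  · exact zsmul_mem (ind_mem_closure_ind hc ho hn hb _ _) k
  · exact zero_mem _

end Generation

/-! ### Finitely additive functions on successive partitions into cells. -/

/-- A sequence of finer and finer partitions of open subsets of `X` into compact open cells: the
cells of level `n` are disjoint, each is the disjoint union of finitely many cells of level `n + 1`,
and all cells together form a basis. -/
structure Subdivision (X T E : Type*) [TopologicalSpace X] where
  lev : T → ℕ
  cell : T → Set X
  edges : T → Finset E
  child : T → E → T
  isCompact_cell : ∀ t, IsCompact (cell t)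
  isOpen_cell : ∀ t, IsOpen (cell t)
  nonempty_cell : ∀ t, (cell t).Nonempty
  eq_of_mem : ∀ t t' x, lev t = lev t' → x ∈ cell t → x ∈ cell t' → t = t'
  lev_child : ∀ t, ∀ e ∈ edges t, lev (child t e) = lev t + 1
  child_subset : ∀ t, ∀ e ∈ edges t, cell (child t e) ⊆ cell t
  exists_child : ∀ t, ∀ x ∈ cell t, ∃ e ∈ edges t, x ∈ cell (child t e)
  child_unique : ∀ t, ∀ e ∈ edges t, ∀ e' ∈ edges t, ∀ x ∈ cell (child t e),
    x ∈ cell (child t e') → e = e'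
  exists_cell : ∀ x, ∀ U ∈ 𝓝 x, ∃ t, x ∈ cell t ∧ cell t ⊆ U

namespace Subdivision

variable {X T E : Type*} [TopologicalSpace X] (𝒮 : Subdivision X T E)

/-- Induction on the difference of the levels. Cells of the same level are equal or disjoint.
Otherwise the finer cell lies in some child of the coarser one, or by induction is disjoint from
every child and hence from their union. -/
theorem subset_or_disjoint_of_le {t t' : T} (h : 𝒮.lev t ≤ 𝒮.lev t') :
    𝒮.cell t' ⊆ 𝒮.cell t ∨ Disjoint (𝒮.cell t') (𝒮.cell t) := by
  obtain ⟨d, hd⟩ := Nat.exists_eq_add_of_le h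
  clear h
  induction d generalizing t with
  | zero =>
    by_cases ht : t = t'
    · exact Or.inl (by rw [ht])
    · exact Or.inr (Set.disjoint_left.2 fun x hx hx' => ht (𝒮.eq_of_mem t t' x (by omega) hx' hx))
  | succ d ih =>
    by_cases hn : ∃ e ∈ 𝒮.edges t, 𝒮.cell t' ⊆ 𝒮.cell (𝒮.child t e)
    · obtain ⟨e, he, h⟩ := hn
      exact Or.inl (h.trans (𝒮.child_subset t e he))
    · refine Or.inr (Set.disjoint_left.2 fun x hx hx' => ?_)
      obtain ⟨e, he, hxe⟩ := 𝒮.exists_child t x hx'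
      have hl := 𝒮.lev_child t e he
      rcases ih (t := 𝒮.child t e) (by omega) with h | h
      · exact hn ⟨e, he, h⟩
      · exact Set.disjoint_left.1 h hx hxe

theorem nested_or_disjoint (t t' : T) : 𝒮.cell t ⊆ 𝒮.cell t' ∨ 𝒮.cell t' ⊆ 𝒮.cell t ∨
    Disjoint (𝒮.cell t) (𝒮.cell t') := by
  rcases le_total (𝒮.lev t) (𝒮.lev t') with h | h
  · rcases 𝒮.subset_or_disjoint_of_le h with h' | h'
    · exact Or.inr (Or.inl h')
    · exact Or.inr (Or.inr h'.symm)
  · rcases 𝒮.subset_or_disjoint_of_le h with h' | h'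
    · exact Or.inl h'
    · exact Or.inr (Or.inr h')

/-- The subdivision of each cell into its children, on formal sums of cells. -/
def refine : (T →₀ ℤ) →+ (T →₀ ℤ) :=
  freeLift fun t => ∑ e ∈ 𝒮.edges t, Finsupp.single (𝒮.child t e) 1

/-- A formal sum all of whose terms have level `n`. -/
def Homog (n : ℕ) (F : T →₀ ℤ) : Prop := ∀ t ∈ F.support, 𝒮.lev t = n

variable {𝒮}

theorem Homog.add {n : ℕ} {F F' : T →₀ ℤ} (h : 𝒮.Homog n F) (h' : 𝒮.Homog n F') :
    𝒮.Homog n (F + F') := by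
  classical
  intro t ht
  rcases Finset.mem_union.1 (Finsupp.support_add ht) with ht | ht
  · exact h t ht
  · exact h' t ht

theorem Homog.sub {n : ℕ} {F F' : T →₀ ℤ} (h : 𝒮.Homog n F) (h' : 𝒮.Homog n F') :
    𝒮.Homog n (F - F') := by
  classical
  intro t ht
  rcases Finset.mem_union.1 (Finsupp.support_sub ht) with ht | ht
  · exact h t ht
  · exact h' t ht

theorem homog_zero (n : ℕ) : 𝒮.Homog n 0 := fun t ht => absurd ht (by simp)

theorem homog_single (t : T) (k : ℤ) : 𝒮.Homog (𝒮.lev t) (Finsupp.single t k) := fun t' ht => by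
  rw [Finset.mem_singleton.1 (Finsupp.support_single_subset ht)]

theorem homog_sum {ι : Type*} {n : ℕ} (s : Finset ι) {F : ι → T →₀ ℤ}
    (h : ∀ i ∈ s, 𝒮.Homog n (F i)) : 𝒮.Homog n (∑ i ∈ s, F i) :=
  Finset.sum_induction F (𝒮.Homog n) (fun _ _ => Homog.add) (homog_zero n) h

theorem Homog.zsmul {n : ℕ} {F : T →₀ ℤ} (h : 𝒮.Homog n F) (k : ℤ) : 𝒮.Homog n (k • F) :=
  fun t ht => h t (Finsupp.support_smul ht)

theorem Homog.refine {n : ℕ} {F : T →₀ ℤ} (h : 𝒮.Homog n F) : 𝒮.Homog (n + 1) (𝒮.refine F) :=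
  homog_sum _ fun t ht => Homog.zsmul (homog_sum _ fun e he => by
    rw [← h t ht, ← 𝒮.lev_child t e he]
    exact homog_single _ _) _

theorem Homog.iterate {n : ℕ} {F : T →₀ ℤ} (h : 𝒮.Homog n F) (j : ℕ) :
    𝒮.Homog (n + j) (𝒮.refine^[j] F) := by
  induction j with
  | zero => exact h
  | succ j ih =>
    rw [Function.iterate_succ_apply']
    exact ih.refine

theorem comp_refine_iterate {L : Type*} [AddCommGroup L] {a : (T →₀ ℤ) →+ L}
    (ha : a.comp 𝒮.refine = a) (j : ℕ) (F : T →₀ ℤ) : a (𝒮.refine^[j] F) = a F := by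
  induction j with
  | zero => rfl
  | succ j ih =>
    rw [Function.iterate_succ_apply', ← ih]
    exact DFunLike.congr_fun ha _

variable (𝒮)

/-- The terms of `F` can be refined to a common level. The change is recorded as `refine D - D`
because every homomorphism invariant under `refine` kills such elements; this serves `realize` as
well as arbitrary additive functions. -/
theorem exists_homog (F : T →₀ ℤ) : ∃ n F', 𝒮.Homog n F' ∧
    ∃ D, F' - F = 𝒮.refine D - D := by
  -- A telescoping sum, with `D` the sum of the first `j` iterates `F, refine F, …`.
  have hit : ∀ (j : ℕ) (F : T →₀ ℤ), ∃ D, 𝒮.refine^[j] F - F = 𝒮.refine D - D := by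
    intro j F
    induction j with
    | zero => exact ⟨0, by simp⟩
    | succ j ih =>
      obtain ⟨D, hD⟩ := ih
      refine ⟨D + 𝒮.refine^[j] F, ?_⟩
      rw [Function.iterate_succ_apply', map_add]
      rw [sub_eq_iff_eq_add.1 hD, map_add, map_sub]
      abel
  induction F using Finsupp.induction_linear with
  | zero => exact ⟨0, 0, homog_zero 0, 0, by simp⟩
  | add F₁ F₂ h₁ h₂ =>
    obtain ⟨n₁, F₁', h₁, D₁, e₁⟩ := h₁
    obtain ⟨n₂, F₂', h₂, D₂, e₂⟩ := h₂
    obtain ⟨D₃, e₃⟩ := hit n₂ F₁'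
    obtain ⟨D₄, e₄⟩ := hit n₁ F₂'
    refine ⟨n₁ + n₂, 𝒮.refine^[n₂] F₁' + 𝒮.refine^[n₁] F₂', (h₁.iterate n₂).add ?_,
      D₁ + D₂ + D₃ + D₄, ?_⟩
    · rw [add_comm]
      exact h₂.iterate n₁
    · rw [sub_eq_iff_eq_add.1 e₃, sub_eq_iff_eq_add.1 e₄, sub_eq_iff_eq_add.1 e₁,
        sub_eq_iff_eq_add.1 e₂]
      simp only [map_add]
      abel
  | single t k => exact ⟨_, _, homog_single t k, 0, by simp⟩

variable [T2Space X]

/-- The indicator function of a cell. -/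
def cellInd (t : T) : C_c(X, ℤ) := ind (𝒮.cell t) (𝒮.isCompact_cell t) (𝒮.isOpen_cell t)

/-- The function represented by a formal sum of cells. -/
def realize : (T →₀ ℤ) →+ C_c(X, ℤ) := freeLift 𝒮.cellInd

theorem realize_single (t : T) : 𝒮.realize (Finsupp.single t 1) = 𝒮.cellInd t := by
  rw [realize, freeLift_single, one_smul]

theorem realize_apply (F : T →₀ ℤ) (x : X) :
    𝒮.realize F x = ∑ t ∈ F.support, F t * 𝒮.cellInd t x := by
  rw [realize, freeLift_apply, Finsupp.sum, CompactlySupportedContinuousMap.coe_sum,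
    Finset.sum_apply]
  refine Finset.sum_congr rfl fun t _ => ?_
  rw [CompactlySupportedContinuousMap.smul_apply, smul_eq_mul]

theorem realize_comp_refine : 𝒮.realize.comp 𝒮.refine = 𝒮.realize := by
  refine freeHom_ext fun t => ?_
  rw [AddMonoidHom.comp_apply, refine, freeLift_single, one_smul, map_sum]
  simp only [realize_single]
  ext x
  rw [CompactlySupportedContinuousMap.coe_sum, Finset.sum_apply]
  by_cases hx : x ∈ 𝒮.cell t
  · obtain ⟨e, he, hxe⟩ := 𝒮.exists_child t x hx
    rw [Finset.sum_eq_single_of_mem e he, cellInd, cellInd, ind_apply_of_mem _ _ hx,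
      ind_apply_of_mem _ _ hxe]
    intro e' he' hne
    exact ind_apply_of_notMem _ _ fun hx' => hne (𝒮.child_unique t e' he' e he x hx' hxe)
  · rw [cellInd, ind_apply_of_notMem _ _ hx]
    exact Finset.sum_eq_zero fun e he =>
      ind_apply_of_notMem _ _ fun hx' => hx (𝒮.child_subset t e he hx')

/-- Cells of one level are disjoint and nonempty, so the value at a point of the cell `t` is the
coefficient of `t`. -/
theorem eq_zero_of_realize {n : ℕ} {F : T →₀ ℤ} (h : 𝒮.Homog n F) (h0 : 𝒮.realize F = 0) :
    F = 0 := by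
  ext t
  by_contra hne
  have ht : t ∈ F.support := Finsupp.mem_support_iff.2 hne
  obtain ⟨x, hx⟩ := 𝒮.nonempty_cell t
  have h1 := 𝒮.realize_apply F x
  rw [h0, Finset.sum_eq_single_of_mem t ht, cellInd, ind_apply_of_mem _ _ hx, _root_.mul_one] at h1
  · exact hne h1.symm
  · intro t' ht' hne'
    rw [cellInd, ind_apply_of_notMem, mul_zero]
    exact fun hx' => hne' (𝒮.eq_of_mem t' t x ((h t' ht').trans (h t ht).symm) hx' hx)

theorem realize_surjective : Function.Surjective 𝒮.realize := by
  rw [← AddMonoidHom.range_eq_top, eq_top_iff,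
    ← closure_ind_eq_top 𝒮.isCompact_cell 𝒮.isOpen_cell 𝒮.nested_or_disjoint 𝒮.exists_cell,
    AddSubgroup.closure_le]
  rintro _ ⟨t, rfl⟩
  exact ⟨Finsupp.single t 1, 𝒮.realize_single t⟩

theorem exists_homog_realize (f : C_c(X, ℤ)) : ∃ n F, 𝒮.Homog n F ∧ 𝒮.realize F = f := by
  obtain ⟨F, rfl⟩ := 𝒮.realize_surjective f
  obtain ⟨n, F', h, D, e⟩ := 𝒮.exists_homog F
  refine ⟨n, F', h, ?_⟩
  rw [← sub_eq_zero, ← map_sub, e, map_sub, ← AddMonoidHom.comp_apply, realize_comp_refine, sub_self]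

variable {L : Type*} [AddCommGroup L] {a : (T →₀ ℤ) →+ L}

/-- The homomorphism on `C_c(X, ℤ)` induced by a finitely additive function on cells. -/
def integral (ha : a.comp 𝒮.refine = a) : C_c(X, ℤ) →+ L :=
  𝒮.realize.liftOfSurjective 𝒮.realize_surjective ⟨a, fun F hF => by
    -- Both `a` and `realize` take the same value on the homogeneous `F'` as on `F`. Thus `F'` is
    -- realized by zero, hence is zero, and `a` vanishes on `F`.
    obtain ⟨n, F', h, D, e⟩ := 𝒮.exists_homog F
    have h1 : a F' = a F := by
      rw [← sub_eq_zero, ← map_sub, e, map_sub, ← AddMonoidHom.comp_apply, ha, sub_self]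
    have h2 : F' = 0 := 𝒮.eq_zero_of_realize h (by
      have e' := congrArg 𝒮.realize e
      rw [map_sub, map_sub, ← AddMonoidHom.comp_apply, realize_comp_refine, sub_self,
        (AddMonoidHom.mem_ker).1 hF, sub_zero] at e'
      exact e')
    rw [AddMonoidHom.mem_ker, ← h1, h2, map_zero]⟩

theorem integral_realize (ha : a.comp 𝒮.refine = a) (F : T →₀ ℤ) :
    𝒮.integral ha (𝒮.realize F) = a F :=
  AddMonoidHom.liftOfRightInverse_comp_apply _ _ _ _ F

theorem integral_cellInd (ha : a.comp 𝒮.refine = a) (t : T) :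
    𝒮.integral ha (𝒮.cellInd t) = a (Finsupp.single t 1) := by
  rw [← realize_single, integral_realize]

end Subdivision

universe u

variable {V : Type u} {A B M : Matrix V V ℤ}

/-! ### The inductive limits. -/

section IndLimit

instance directedSystem_rowMap (hM : RowFinite M) :
    DirectedSystem (fun _ : ℕ => V →₀ ℤ) fun i j (_ : i ≤ j) => ⇑(rowMap hM ^ (j - i)) where
  map_self i x := by simp
  map_map k j i hij hjk x := by
    rw [← Module.End.mul_apply, ← pow_add]
    congr 2
    omega

theorem toLim_pow (hM : RowFinite M) (i j : ℕ) (x : V →₀ ℤ) :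
    toLim hM (i + j) ((rowMap hM ^ j) x) = toLim hM i x := by
  have h := Module.DirectLimit.of_f (R := ℤ) (G := fun _ : ℕ => V →₀ ℤ)
    (f := fun i j (_ : i ≤ j) => rowMap hM ^ (j - i)) (hij := Nat.le_add_right i j) (x := x)
  rw [Nat.add_sub_cancel_left] at h
  exact h

theorem toLim_rowMap (hM : RowFinite M) (i : ℕ) (x : V →₀ ℤ) :
    toLim hM (i + 1) (rowMap hM x) = toLim hM i x := by
  simpa using toLim_pow hM i 1 x

theorem exists_pow_eq_zero (hM : RowFinite M) {i : ℕ} {x : V →₀ ℤ} (h : toLim hM i x = 0) :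
    ∃ j, (rowMap hM ^ j) x = 0 := by
  obtain ⟨j, _, hj⟩ := Module.DirectLimit.of.zero_exact (R := ℤ) (G := fun _ : ℕ => V →₀ ℤ)
    (f := fun i j (_ : i ≤ j) => rowMap hM ^ (j - i)) h
  exact ⟨_, hj⟩

theorem exists_toLim (hM : RowFinite M) (y : IndLim hM) : ∃ i x, toLim hM i x = y := by
  obtain ⟨i, x, h⟩ := Module.DirectLimit.exists_of y
  exact ⟨i, x, h⟩

theorem rowMap_single (hM : RowFinite M) (v : V) :
    rowMap hM (Finsupp.single v 1) = Finsupp.ofSupportFinite (M v) (hM v) := by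
  rw [rowMap, Finsupp.linearCombination_single, one_smul]

end IndLimit

/-! ### Sums over the edges that start at a vertex. -/

section Edges

/-- The edges with source `v`. -/
def edgesFrom (hA : RowFinite A) (v : V) : Finset (Edge A) := (Edge.finite_source hA v).toFinset

theorem mem_edgesFrom (hA : RowFinite A) {v : V} {e : Edge A} : e ∈ edgesFrom hA v ↔ v = e.s := by
  rw [edgesFrom, Set.Finite.mem_toFinset]
  exact eq_comm

/-- Hermite's identity. Replacing `c` by `c + 1` shifts the window of numerators: the term `c / a`
leaves and `(c + a) / a = c / a + 1` enters, so the sum grows by one. For `c = 0` all terms vanish,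
and induction proceeds from there in both directions. -/
theorem sum_add_ediv (a : ℕ) (ha : 0 < a) (c : ℤ) : ∑ n ∈ Finset.range a, (c + n) / (a : ℤ) = c := by
  have ha' : (a : ℤ) ≠ 0 := by exact_mod_cast ha.ne'
  have hs : ∀ c : ℤ, ∑ n ∈ Finset.range a, (c + 1 + n) / (a : ℤ)
      = ∑ n ∈ Finset.range a, (c + n) / (a : ℤ) + 1 := by
    intro c
    have h1 := Finset.sum_range_succ (fun n : ℕ => (c + n) / (a : ℤ)) a
    rw [Finset.sum_range_succ', show (c + (a : ℕ)) / (a : ℤ) = c / a + 1 by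
      simpa using Int.add_mul_ediv_right c 1 ha'] at h1
    have h2 : ∀ n : ℕ, (c + 1 + n) / (a : ℤ) = (c + (n + 1 : ℕ)) / (a : ℤ) := by
      intro n
      push_cast
      ring_nf
    simp only [h2]
    simp only [Nat.cast_zero, add_zero] at h1
    linarith
  induction c using Int.induction_on with
  | zero =>
    refine Finset.sum_eq_zero fun n hn => ?_
    rw [zero_add]
    exact Int.ediv_eq_zero_of_lt (by positivity) (by exact_mod_cast Finset.mem_range.1 hn)
  | succ i ih => rw [hs, ih]
  | pred i ih =>
    have h := hs (-(i : ℤ) - 1)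
    rw [sub_add_cancel, ih] at h
    linarith

/-- The coefficient at `w` sees only the edges from `v` to `w`, which are numbered by `0 ≤ n < A v
w`. -/
theorem sum_edges_apply (hA : RowFinite A) (v w : V) (f : Edge A → ℤ) (g : ℤ → ℤ)
    (hf : ∀ e : Edge A, e.s = v → e.r = w → f e = g e.idx) :
    (∑ e ∈ edgesFrom hA v, f e • Finsupp.single e.r (1 : ℤ)) w
      = ∑ n ∈ Finset.range (A v w).toNat, g n := by
  classical
  rw [Finsupp.finsetSum_apply]
  simp only [Finsupp.smul_apply, Finsupp.single_apply, smul_eq_mul, mul_ite, _root_.mul_one, mul_zero]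
  rw [← Finset.sum_filter]
  refine Finset.sum_bij' (fun e _ => e.idx.toNat)
    (fun n hn => ⟨v, w, n, by positivity, by have := Finset.mem_range.1 hn; omega⟩)
    ?_ ?_ ?_ ?_ ?_
  · intro e he
    obtain ⟨h1, rfl⟩ := Finset.mem_filter.1 he
    obtain rfl := (mem_edgesFrom hA).1 h1
    have := e.nonneg
    have := e.lt
    exact Finset.mem_range.2 (by omega)
  · intro n hn
    exact Finset.mem_filter.2 ⟨(mem_edgesFrom hA).2 rfl, rfl⟩
  · intro e he
    obtain ⟨h1, rfl⟩ := Finset.mem_filter.1 he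
    obtain rfl := (mem_edgesFrom hA).1 h1
    have := e.nonneg
    ext
    · rfl
    · rfl
    · change (e.idx.toNat : ℤ) = e.idx
      omega
  · intro n hn
    exact Int.toNat_natCast n
  · intro e he
    obtain ⟨h1, h2⟩ := Finset.mem_filter.1 he
    have := e.nonneg
    rw [hf e ((mem_edgesFrom hA).1 h1).symm h2]
    congr 1
    omega

theorem sum_single_r (hA : RowFinite A) (hnn : ∀ i j, 0 ≤ A i j) (v : V) :
    ∑ e ∈ edgesFrom hA v, Finsupp.single e.r (1 : ℤ) = rowMap hA (Finsupp.single v 1) := by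
  ext w
  have h := sum_edges_apply hA v w (fun _ => 1) (fun _ => 1) fun _ _ _ => rfl
  simp only [one_smul] at h
  rw [h, rowMap_single]
  have := hnn v w
  simp only [Finset.sum_const, Finset.card_range, nsmul_eq_mul, _root_.mul_one]
  exact Int.toNat_of_nonneg this

/-- The coefficient at `w` is Hermite's sum with `a = A v w` and `c = m B v w`. If `A v w = 0`,
there is no edge from `v` to `w`, and the right side vanishes too because then `B v w = 0`. -/
theorem sum_coc_single_r (hA : RowFinite A) (hB : RowFinite B) (hnn : ∀ i j, 0 ≤ A i j)
    (hAB : ∀ i j, A i j = 0 → B i j = 0) (m : ℤ) (v : V) :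
    ∑ e ∈ edgesFrom hA v, e.coc B m • Finsupp.single e.r (1 : ℤ)
      = m • rowMap hB (Finsupp.single v 1) := by
  ext w
  have h := sum_edges_apply hA v w (fun e => e.coc B m) (fun n => (m * B v w + n) / A v w) (by
    rintro e rfl rfl
    rfl)
  rw [h, rowMap_single]
  change _ = m * B v w
  rcases (hnn v w).eq_or_lt with h0 | h0
  · rw [hAB v w h0.symm, ← h0]
    simp
  · have h1 := sum_add_ediv (A v w).toNat (by omega) (m * B v w)
    rwa [Int.toNat_of_nonneg h0.le] at h1

end Edges

/-! ### Cylinder sets and the sets `Z(α, m, β)` as cells. -/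

section Cells

theorem FinPath.r_of_mem_cyl {α : FinPath A} {x : InfPath A} (h : x ∈ cyl α) :
    α.r = (x.1 α.len).s := by
  have h' : x.take α.len = α := h
  rw [← x.r_take, h']

theorem mem_cyl_snoc {α : FinPath A} {e : Edge A} (h : α.r = e.s) {x : InfPath A} :
    x ∈ cyl (α.snoc e h) ↔ x ∈ cyl α ∧ x.1 α.len = e := by
  change x.take (α.snoc e h).len = _ ↔ _
  rw [FinPath.len_snoc, InfPath.take_succ]
  constructor
  · intro h'
    exact FinPath.snoc_inj h'
  · rintro ⟨h1, h2⟩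
    exact FinPath.snoc_congr _ _ h1 h2

open Classical in
/-- The path `αe` if `r(α) = s(e)`, and `α` otherwise. -/
def FinPath.extend (α : FinPath A) (e : Edge A) : FinPath A :=
  if h : α.r = e.s then α.snoc e h else α

theorem FinPath.extend_of_eq {α : FinPath A} {e : Edge A} (h : α.r = e.s) :
    α.extend e = α.snoc e h := dif_pos h

theorem exists_infPath (hrow : ∀ i, ∃ j, A i j ≠ 0) (hnn : ∀ i j, 0 ≤ A i j) (v : V) :
    ∃ y : InfPath A, (y.1 0).s = v := by
  choose f hf using hrow
  let e : V → Edge A := fun w => ⟨w, f w, 0, le_rfl, lt_of_le_of_ne (hnn _ _) (hf w).symm⟩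
  exact ⟨⟨fun n => e (f^[n] v), fun n => (Function.iterate_succ_apply' f n v).symm⟩, rfl⟩

theorem nonempty_cyl (hrow : ∀ i, ∃ j, A i j ≠ 0) (hnn : ∀ i j, 0 ≤ A i j) (α : FinPath A) :
    (cyl α).Nonempty := by
  obtain ⟨y, hy⟩ := exists_infPath hrow hnn α.r
  exact ⟨α.append y hy.symm, InfPath.take_append α y hy.symm⟩

/-- The partitions of the infinite path space into cylinder sets. -/
def pathCells (hA : RowFinite A) (hrow : ∀ i, ∃ j, A i j ≠ 0) (hnn : ∀ i j, 0 ≤ A i j) :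
    Subdivision (InfPath A) (FinPath A) (Edge A) where
  lev := FinPath.len
  cell := cyl
  edges α := edgesFrom hA α.r
  child := FinPath.extend
  isCompact_cell := isCompact_cyl hA
  isOpen_cell := isOpen_cyl
  nonempty_cell := nonempty_cyl hrow hnn
  eq_of_mem α α' x h hx hx' := by
    have h1 : x.take α.len = α := hx
    have h2 : x.take α'.len = α' := hx'
    rw [← h1, h, h2]
  lev_child α e he := by
    rw [FinPath.extend_of_eq ((mem_edgesFrom hA).1 he), FinPath.len_snoc]
  child_subset α e he := by
    rw [FinPath.extend_of_eq ((mem_edgesFrom hA).1 he)]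
    exact fun x hx => ((mem_cyl_snoc _).1 hx).1
  exists_child α x hx := by
    have h := FinPath.r_of_mem_cyl hx
    refine ⟨_, (mem_edgesFrom hA).2 h, ?_⟩
    rw [FinPath.extend_of_eq h]
    exact (mem_cyl_snoc _).2 ⟨hx, rfl⟩
  child_unique α e he e' he' x hx hx' := by
    rw [FinPath.extend_of_eq ((mem_edgesFrom hA).1 he)] at hx
    rw [FinPath.extend_of_eq ((mem_edgesFrom hA).1 he')] at hx'
    rw [← ((mem_cyl_snoc _).1 hx).2, ← ((mem_cyl_snoc _).1 hx').2]
  exists_cell x U hU := by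
    obtain ⟨n, hn⟩ := InfPath.exists_cyl_subset hU
    refine ⟨x.take n, ?_, hn n le_rfl⟩
    change x.take (x.take n).len = _
    rw [InfPath.len_take]

variable (A) in
/-- The triples `(α, m, β)` with `r(α) = r(β)` and `|α| = |β|`. -/
@[ext] structure Triple where
  α : FinPath A
  m : ℤ
  β : FinPath A
  hr : α.r = β.r
  hl : α.len = β.len

theorem Triple.r_α (B : Matrix V V ℤ) (t : Triple A) {e : Edge A} (h : t.β.r = e.s) :
    t.α.r = (e.act B t.m).s := t.hr.trans h

/-- The triple `(α κ_m(e), φ(m, e), βe)`. -/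
def Triple.snoc (B : Matrix V V ℤ) (t : Triple A) (e : Edge A) (h : t.β.r = e.s) : Triple A where
  α := t.α.snoc (e.act B t.m) (t.r_α B h)
  m := e.coc B t.m
  β := t.β.snoc e h
  hr := by
    rw [FinPath.r_snoc, FinPath.r_snoc]
    rfl
  hl := by rw [FinPath.len_snoc, FinPath.len_snoc, t.hl]

open Classical in
/-- The triple `(α κ_m(e), φ(m, e), βe)` if `r(β) = s(e)`, and `(α, m, β)` otherwise. -/
def Triple.extend (B : Matrix V V ℤ) (t : Triple A) (e : Edge A) : Triple A :=
  if h : t.β.r = e.s then t.snoc B e h else t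

theorem Triple.extend_of_eq (B : Matrix V V ℤ) {t : Triple A} {e : Edge A} (h : t.β.r = e.s) :
    t.extend B e = t.snoc B e h := dif_pos h

namespace KArrow

theorem src_mem_cyl {α β : FinPath A} {m : ℤ} {g : KArrow A B} (hg : g ∈ Z B α m β) :
    g.src ∈ cyl β := by
  obtain ⟨q, rfl, rfl, rfl, rfl⟩ := hg
  exact q.hx

/-- Lengthening a representative by one step uses the edge of the source at position `|β|`. To
prescribe this edge is therefore to choose a child of `t`. -/
theorem mem_Z_snoc {t : Triple A} {e : Edge A} (h : t.β.r = e.s) {g : KArrow A B} :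
    g ∈ Z B (t.snoc B e h).α (t.snoc B e h).m (t.snoc B e h).β
      ↔ g ∈ Z B t.α t.m t.β ∧ g.src.1 t.β.len = e := by
  constructor
  · intro hg
    obtain ⟨h1, h2⟩ := (mem_cyl_snoc h).1 (src_mem_cyl hg)
    refine ⟨?_, h2⟩
    let q : Quad A := ⟨t.α, t.m, t.β, g.src, t.hr, h1⟩
    refine Z_next q ?_
    have e1 : q.x.1 q.β.len = e := h2
    have hZ : Z B (q.next B).α (q.next B).m (q.next B).β
        = Z B (t.snoc B e h).α (t.snoc B e h).m (t.snoc B e h).β := by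
      congr 1
      · exact FinPath.snoc_congr (q.r_α B) (t.r_α B h) rfl (congrArg (Edge.act B t.m) e1)
      · exact congrArg (Edge.coc B t.m) e1
      · exact FinPath.snoc_congr q.r_β h rfl e1
    rw [hZ]
    exact hg
  · rintro ⟨⟨q, hα, hm, hβ, rfl⟩, he⟩
    have e1 : q.x.1 q.β.len = e := by
      rw [hβ]
      exact he
    refine ⟨q.next B, ?_, ?_, ?_, mk_next q⟩
    · refine FinPath.snoc_congr (q.r_α B) (t.r_α B h) hα ?_
      rw [e1, hm]
    · change Edge.coc B q.m (q.x.1 q.β.len) = Edge.coc B t.m e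
      rw [e1, hm]
    · exact FinPath.snoc_congr q.r_β h hβ e1

/-- Two representatives of one arrow become equal after `i` and `j` steps, and equal lengths force
`i = j`. By pseudo freeness `Quad.next` is injective, so the representatives themselves agree. This
makes the cells of one level disjoint. -/
theorem eq_of_mem_Z (hp : PseudoFree A B) {α α' β β' : FinPath A} {m m' : ℤ} {g : KArrow A B}
    (h : β.len = β'.len) (hg : g ∈ Z B α m β) (hg' : g ∈ Z B α' m' β') :
    α = α' ∧ m = m' ∧ β = β' := by
  obtain ⟨q, rfl, rfl, rfl, rfl⟩ := hg
  obtain ⟨q', rfl, rfl, rfl, e⟩ := hg'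
  obtain ⟨i, j, hij⟩ := mk_eq_mk e
  have hl := congrArg (fun q : Quad A => q.β.len) hij
  simp only [Quad.lenβ_iterate] at hl
  obtain rfl : i = j := by omega
  have := (next_injective hp).iterate i hij
  subst this
  exact ⟨rfl, rfl, rfl⟩

end KArrow

open KArrow

/-- The partitions of `ℋ_{A,B}` into the sets `Z(α, m, β; Z(β))` with `|α| = |β|`. -/
def arrowCells (hA : RowFinite A) (hrow : ∀ i, ∃ j, A i j ≠ 0) (hnn : ∀ i j, 0 ≤ A i j)
    (hp : PseudoFree A B) :
    Subdivision {g : KArrow A B // (rho hp).toFun g = 0} (Triple A) (Edge A) where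
  lev t := t.β.len
  cell t := Subtype.val ⁻¹' Z B t.α t.m t.β
  edges t := edgesFrom hA t.β.r
  child := Triple.extend B
  isCompact_cell t := by
    rw [Topology.IsEmbedding.subtypeVal.isCompact_iff]
    have h : Subtype.val '' (Subtype.val ⁻¹' Z B t.α t.m t.β
        : Set {g : KArrow A B // (rho hp).toFun g = 0}) = Z B t.α t.m t.β := by
      refine (Subtype.image_preimage_coe _ _).trans (inter_eq_right.2 ?_)
      rintro _ ⟨q, h1, _, h2, rfl⟩
      change (q.α.len : ℤ) - q.β.len = 0
      rw [h1, h2, t.hl, sub_self]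
    rw [h]
    exact isCompact_Z hA t.hr t.m
  isOpen_cell t := (isOpen_Z t.hr t.m).preimage continuous_subtype_val
  nonempty_cell t := by
    obtain ⟨x, hx⟩ := nonempty_cyl hrow hnn t.β
    refine ⟨⟨mk B ⟨t.α, t.m, t.β, x, t.hr, hx⟩, ?_⟩, ⟨_, rfl, rfl, rfl, rfl⟩⟩
    change (t.α.len : ℤ) - t.β.len = 0
    rw [t.hl, sub_self]
  eq_of_mem t t' g h hg hg' := by
    obtain ⟨h1, h2, h3⟩ := eq_of_mem_Z hp h hg hg'
    exact Triple.ext h1 h2 h3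
  lev_child t e he := by
    rw [Triple.extend_of_eq B ((mem_edgesFrom hA).1 he)]
    exact FinPath.len_snoc t.β e ((mem_edgesFrom hA).1 he)
  child_subset t e he := by
    rw [Triple.extend_of_eq B ((mem_edgesFrom hA).1 he)]
    exact fun g hg => ((mem_Z_snoc _).1 hg).1
  exists_child t g hg := by
    have h := FinPath.r_of_mem_cyl (src_mem_cyl hg)
    refine ⟨_, (mem_edgesFrom hA).2 h, ?_⟩
    rw [Triple.extend_of_eq B h]
    exact (mem_Z_snoc _).2 ⟨hg, rfl⟩
  child_unique t e he e' he' g hg hg' := by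
    rw [Triple.extend_of_eq B ((mem_edgesFrom hA).1 he)] at hg
    rw [Triple.extend_of_eq B ((mem_edgesFrom hA).1 he')] at hg'
    rw [← ((mem_Z_snoc _).1 hg).2, ← ((mem_Z_snoc _).1 hg').2]
  exists_cell g U hU := by
    obtain ⟨g, hg⟩ := g
    obtain ⟨N, hN, hNU⟩ := (mem_nhds_subtype {g : KArrow A B | (rho hp).toFun g = 0} _ U).1 hU
    obtain ⟨q, rfl⟩ := exists_mk g
    obtain ⟨n, hn⟩ := exists_Z_subset hN
    -- Each step lengthens both paths by one edge, so the long representative still has `|α| = |β|`.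
    refine ⟨⟨_, _, _, ((Quad.next B)^[n] q).hr, ?_⟩, ?_, (preimage_mono hn).trans hNU⟩
    · have h1 : (q.α.len : ℤ) - q.β.len = 0 := hg
      rw [Quad.lenα_iterate, Quad.lenβ_iterate]
      omega
    · have h1 := mk_mem_Z (B := B) ((Quad.next B)^[n] q)
      rw [mk_iterate] at h1
      exact h1

end Cells

/-! ### Additive functions on cells with values in the inductive limit. -/

namespace Subdivision

section LimValue

variable {X T E L : Type*} [TopologicalSpace X] [AddCommGroup L] (𝒮 : Subdivision X T E)

variable {𝒮} in
theorem Homog.hom_ext {n : ℕ} {F : T →₀ ℤ} (h : 𝒮.Homog n F) {a b : (T →₀ ℤ) →+ L}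
    (hab : ∀ t, 𝒮.lev t = n → a (Finsupp.single t 1) = b (Finsupp.single t 1)) : a F = b F := by
  rw [← F.sum_single, Finsupp.sum, map_sum, map_sum]
  refine Finset.sum_congr rfl fun t ht => ?_
  rw [← _root_.mul_one (F t), ← smul_eq_mul, ← Finsupp.smul_single, map_zsmul, map_zsmul,
    hab t (h t ht)]

variable (hM : RowFinite M) (w : T → V →₀ ℤ)

/-- The value `φ_{n,∞}(w(t))` of a cell `t` of level `n`, extended to formal sums. -/
def limValue : (T →₀ ℤ) →+ IndLim hM := freeLift fun t => toLim hM (𝒮.lev t) (w t)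

variable {w} (hw : ∀ t, ∑ e ∈ 𝒮.edges t, w (𝒮.child t e) = rowMap hM (w t))

include hw

/-- Passing to the children raises the level by one and applies `rowMap` to the weight; the limit
identifies the two values. -/
theorem limValue_comp_refine : (𝒮.limValue hM w).comp 𝒮.refine = 𝒮.limValue hM w := by
  refine freeHom_ext fun t => ?_
  rw [AddMonoidHom.comp_apply, refine, freeLift_single, one_smul, map_sum, limValue]
  simp only [freeLift_single, one_smul]
  rw [← toLim_rowMap, ← hw, map_sum]
  exact Finset.sum_congr rfl fun e he => by rw [𝒮.lev_child t e he]

theorem freeLift_refine_iterate (j : ℕ) (F : T →₀ ℤ) :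
    freeLift w (𝒮.refine^[j] F) = (rowMap hM ^ j) (freeLift w F) := by
  induction j with
  | zero => rfl
  | succ j ih =>
    rw [Function.iterate_succ_apply', pow_succ', Module.End.mul_apply, ← ih]
    have h : (freeLift w).comp 𝒮.refine = (rowMap hM).toAddMonoidHom.comp (freeLift w) := by
      refine freeHom_ext fun t => ?_
      rw [AddMonoidHom.comp_apply, AddMonoidHom.comp_apply, refine, freeLift_single, one_smul,
        map_sum, freeLift_single, one_smul]
      simp only [freeLift_single, one_smul]
      exact hw t
    exact DFunLike.congr_fun h _

/-- An element vanishes in the limit only if it vanishes at a finite stage. Going to that stage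
amounts to refining the formal sum, which does not change the function it represents. So zero in the
limit becomes total weight zero at a sufficiently fine level. -/
theorem exists_of_integral_eq_zero [T2Space X] {f : C_c(X, ℤ)}
    (hf : 𝒮.integral (𝒮.limValue_comp_refine hM hw) f = 0) :
    ∃ n F, 𝒮.Homog n F ∧ 𝒮.realize F = f ∧ freeLift w F = 0 := by
  obtain ⟨n, F, h, rfl⟩ := 𝒮.exists_homog_realize f
  rw [integral_realize] at hf
  have h1 : 𝒮.limValue hM w F = toLim hM n (freeLift w F) :=
    h.hom_ext (b := (toLim hM n).toAddMonoidHom.comp (freeLift w)) fun t ht => by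
      rw [limValue, freeLift_single, one_smul, AddMonoidHom.comp_apply, freeLift_single, one_smul, ht]
      rfl
  rw [h1] at hf
  obtain ⟨j, hj⟩ := exists_pow_eq_zero hM hf
  refine ⟨n + j, 𝒮.refine^[j] F, h.iterate j, comp_refine_iterate 𝒮.realize_comp_refine j F, ?_⟩
  rw [𝒮.freeLift_refine_iterate hM hw, hj]

end LimValue

end Subdivision

/-! ### Products, sources and ranges of the sets `Z(α, m, β)`. -/

namespace KArrow

theorem mul_mem_Z {α β γ : FinPath A} {m m' : ℤ} {g h : KArrow A B} (hg : g ∈ Z B α m β)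
    (hh : h ∈ Z B β m' γ) (p : g.src = h.rng) : mul g h p ∈ Z B α (m + m') γ := by
  obtain ⟨q, rfl, rfl, rfl, rfl⟩ := hg
  obtain ⟨q', h1, rfl, rfl, rfl⟩ := hh
  rw [mul_mk q q' p h1.symm]
  exact mk_mem_Z (q.mul q' h1.symm)

/-- Any path `β` with the right end can be inserted: the second factor carries the given source, and
its range is the source of the first. -/
theorem exists_mul_of_mem_Z {α β γ : FinPath A} (hβ : β.r = γ.r) {m m' : ℤ} {k : KArrow A B}
    (hk : k ∈ Z B α (m + m') γ) : ∃ g ∈ Z B α m β, ∃ h ∈ Z B β m' γ, ∃ p, mul g h p = k := by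
  obtain ⟨q, rfl, hm, rfl, rfl⟩ := hk
  let q' : Quad A := ⟨β, m', q.β, q.x, hβ, q.hx⟩
  let q'' : Quad A := ⟨q.α, m, β, q'.rng B, q.hr.trans hβ.symm, InfPath.take_append _ _ _⟩
  refine ⟨mk B q'', ⟨q'', rfl, rfl, rfl, rfl⟩, mk B q', ⟨q', rfl, rfl, rfl, rfl⟩, rfl, ?_⟩
  rw [mul_mk q'' q' rfl rfl]
  exact congrArg (mk B) (Quad.ext rfl hm.symm rfl rfl)

/-- Inversion sends `Z(α, m, β)` to `Z(β, -m, α)` and turns ranges into sources. -/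
theorem rng_injOn_Z (α : FinPath A) (m : ℤ) (β : FinPath A) : (Z B α m β).InjOn rng := by
  intro g hg k hk h
  rw [← inv_inv g, ← inv_inv k]
  refine congrArg inv (src_injOn_Z _ _ _ (inv_mem_Z hg) (inv_mem_Z hk) ?_)
  rw [src_inv, src_inv]
  exact h

theorem rng_image_Z {α β : FinPath A} (h : α.r = β.r) (m : ℤ) : rng '' Z B α m β = cyl α := by
  rw [← src_image_Z (B := B) h.symm (-m)]
  ext x
  constructor
  · rintro ⟨g, hg, rfl⟩
    exact ⟨g.inv, inv_mem_Z hg, src_inv g⟩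
  · rintro ⟨g, hg, rfl⟩
    have h1 := inv_mem_Z hg
    rw [neg_neg] at h1
    exact ⟨g.inv, h1, rng_inv g⟩

theorem exists_src_eq_rng {α β γ : FinPath A} (hβ : β.r = γ.r) (m : ℤ) {m' : ℤ} {g : KArrow A B}
    (hg : g ∈ Z B α m' β) : ∃ h ∈ Z B β m γ, g.src = h.rng := by
  have h1 := src_mem_cyl hg
  rw [← rng_image_Z (B := B) hβ m] at h1
  obtain ⟨h, hh, e⟩ := h1
  exact ⟨h, hh, e.symm⟩

theorem rng_mem_cyl {α β : FinPath A} {m : ℤ} {g : KArrow A B} (hg : g ∈ Z B α m β) :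
    g.rng ∈ cyl α := by
  rw [← src_inv]
  exact src_mem_cyl (inv_mem_Z hg)

theorem exists_rng_eq_src {α β γ : FinPath A} (hα : α.r = β.r) (m : ℤ) {m' : ℤ} {h : KArrow A B}
    (hh : h ∈ Z B β m' γ) : ∃ g ∈ Z B α m β, g.src = h.rng := by
  have h1 := rng_mem_cyl hh
  rwa [← src_image_Z (B := B) hα m] at h1

end KArrow

open KArrow

instance t2Space_kernel (hp : PseudoFree A B) :
    T2Space {g : KArrow A B // (rho hp).toFun g = 0} := (ℋ hp).t2_arrows

/-! ### Cycles and boundaries of `ℋ`. -/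

section Homology

variable (hA : RowFinite A) (hrow : ∀ i, ∃ j, A i j ≠ 0) (hnn : ∀ i j, 0 ≤ A i j)
  (hp : PseudoFree A B)

/-- The instance of `EtaleGroupoid.δ₂_pairs` for `Z(α, m, β) Z(β, m', γ) = Z(α, m + m', γ)`. It
makes classes modulo boundaries additive in such products. -/
theorem δ₂_arrowCells {t t' s : Triple A} (h : t.β = t'.α) (hα : s.α = t.α)
    (hm : s.m = t.m + t'.m) (hβ : s.β = t'.β) :
    (ℋ hp).δ₂ (ind ((ℋ hp).pairs ((arrowCells hA hrow hnn hp).cell t)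
        ((arrowCells hA hrow hnn hp).cell t'))
      ((ℋ hp).isCompact_pairs ((arrowCells hA hrow hnn hp).isCompact_cell t)
        ((arrowCells hA hrow hnn hp).isCompact_cell t'))
      ((ℋ hp).isOpen_pairs ((arrowCells hA hrow hnn hp).isOpen_cell t)
        ((arrowCells hA hrow hnn hp).isOpen_cell t')))
      = (arrowCells hA hrow hnn hp).cellInd t' - (arrowCells hA hrow hnn hp).cellInd s
        + (arrowCells hA hrow hnn hp).cellInd t := by
  obtain ⟨α, m, β, hr, hl⟩ := t
  obtain ⟨β', m', γ, hr', hl'⟩ := t'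
  obtain ⟨α'', m'', γ', hr'', hl''⟩ := s
  change β = β' at h
  change α'' = α at hα
  change m'' = m + m' at hm
  change γ' = γ at hβ
  subst h hα hm hβ
  have hlag : ∀ {α γ : FinPath A} {m : ℤ} {g : KArrow A B}, α.len = γ.len → g ∈ Z B α m γ →
      (rho hp).toFun g = 0 := by
    rintro α γ m _ hl ⟨q, rfl, rfl, rfl, rfl⟩
    change (q.α.len : ℤ) - q.β.len = 0
    rw [hl, sub_self]
  refine (ℋ hp).δ₂_pairs _ _ _ _ _ _ ?_ ?_ ?_ ?_ ?_ ?_ ?_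
  · exact fun g hg k hk e => Subtype.ext (src_injOn_Z _ _ _ hg hk e)
  · exact fun g hg k hk e => Subtype.ext (src_injOn_Z _ _ _ hg hk e)
  · exact fun g hg k hk e => Subtype.ext (rng_injOn_Z _ _ _ hg hk e)
  · intro g hg
    obtain ⟨h, hh, e⟩ := exists_src_eq_rng hr' m' (show g.1 ∈ Z B α'' m β from hg)
    exact ⟨⟨h, hlag hl' hh⟩, hh, e⟩
  · intro h hh
    obtain ⟨g, hg, e⟩ := exists_rng_eq_src hr m (show h.1 ∈ Z B β m' γ' from hh)
    exact ⟨⟨g, hlag hl hg⟩, hg, e⟩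
  · exact fun g hg h hh p => mul_mem_Z (show g.1 ∈ Z B α'' m β from hg) hh p
  · intro k hk
    obtain ⟨g, hg, h, hh, p, e⟩ := exists_mul_of_mem_Z hr' (show k.1 ∈ Z B α'' (m + m') γ' from hk)
    exact ⟨⟨g, hlag hl hg⟩, hg, ⟨h, hlag hl' hh⟩, hh, p, Subtype.ext e⟩

theorem δ₁_arrowCells (t : Triple A) :
    (ℋ hp).δ₁ ((arrowCells hA hrow hnn hp).cellInd t)
      = (pathCells hA hrow hnn).cellInd t.β - (pathCells hA hrow hnn).cellInd t.α := by
  have h1 : Subtype.val '' (arrowCells hA hrow hnn hp).cell t = Z B t.α t.m t.β := by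
    refine (Subtype.image_preimage_coe _ _).trans (inter_eq_right.2 ?_)
    rintro _ ⟨q, h1, _, h2, rfl⟩
    change (q.α.len : ℤ) - q.β.len = 0
    rw [h1, h2, t.hl, sub_self]
  refine (ℋ hp).δ₁_ind _ _ ?_ ?_ ?_ ?_ _ _ _ _
  · exact fun g hg k hk e => Subtype.ext (src_injOn_Z _ _ _ hg hk e)
  · exact fun g hg k hk e => Subtype.ext (rng_injOn_Z _ _ _ hg hk e)
  · exact (image_comp src Subtype.val _).trans (by rw [h1, src_image_Z t.hr]; rfl)
  · exact (image_comp rng Subtype.val _).trans (by rw [h1, rng_image_Z t.hr]; rfl)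

/-- The products of two cells with a common middle path form a basis of the space of composable
pairs. The middle path forces both factors to have the same level, so two such products compare in
the same direction in both coordinates, and hence are nested or disjoint. -/
theorem closure_pairs_eq_top :
    AddSubgroup.closure (range fun i : {i : Triple A × Triple A // i.1.β = i.2.α} =>
      ind ((ℋ hp).pairs ((arrowCells hA hrow hnn hp).cell i.1.1)
          ((arrowCells hA hrow hnn hp).cell i.1.2))
        ((ℋ hp).isCompact_pairs ((arrowCells hA hrow hnn hp).isCompact_cell i.1.1)
          ((arrowCells hA hrow hnn hp).isCompact_cell i.1.2))
        ((ℋ hp).isOpen_pairs ((arrowCells hA hrow hnn hp).isOpen_cell i.1.1)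
          ((arrowCells hA hrow hnn hp).isOpen_cell i.1.2))) = ⊤ := by
  set 𝒮 := arrowCells hA hrow hnn hp
  refine closure_ind_eq_top (S := fun i : {i : Triple A × Triple A // i.1.β = i.2.α} =>
    (ℋ hp).pairs (𝒮.cell i.1.1) (𝒮.cell i.1.2)) _ _ ?_ ?_
  · have hn : ∀ i j : {i : Triple A × Triple A // i.1.β = i.2.α}, 𝒮.lev i.1.1 ≤ 𝒮.lev j.1.1 →
        (ℋ hp).pairs (𝒮.cell j.1.1) (𝒮.cell j.1.2) ⊆ (ℋ hp).pairs (𝒮.cell i.1.1) (𝒮.cell i.1.2) ∨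
        Disjoint ((ℋ hp).pairs (𝒮.cell i.1.1) (𝒮.cell i.1.2))
          ((ℋ hp).pairs (𝒮.cell j.1.1) (𝒮.cell j.1.2)) := by
      rintro ⟨⟨t, t'⟩, h⟩ ⟨⟨s, s'⟩, h'⟩ hl
      have e1 : t'.β.len = t.β.len := by rw [← t'.hl, ← show t.β = t'.α from h]
      have e2 : s'.β.len = s.β.len := by rw [← s'.hl, ← show s.β = s'.α from h']
      have hl' : 𝒮.lev t' ≤ 𝒮.lev s' := by
        change t'.β.len ≤ s'.β.len
        rw [e1, e2]
        exact hl
      rcases 𝒮.subset_or_disjoint_of_le hl with h1 | h1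
      · rcases 𝒮.subset_or_disjoint_of_le hl' with h2 | h2
        · exact Or.inl fun p hp => ⟨h1 hp.1, h2 hp.2⟩
        · exact Or.inr (Set.disjoint_left.2 fun p hp hp' => Set.disjoint_left.1 h2 hp'.2 hp.2)
      · exact Or.inr (Set.disjoint_left.2 fun p hp hp' => Set.disjoint_left.1 h1 hp'.1 hp.1)
    intro i j
    rcases le_total (𝒮.lev i.1.1) (𝒮.lev j.1.1) with h | h
    · rcases hn i j h with h' | h'
      · exact Or.inr (Or.inl h')
      · exact Or.inr (Or.inr h')
    · rcases hn j i h with h' | h'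
      · exact Or.inl h'
      · exact Or.inr (Or.inr h'.symm)
  · rintro ⟨⟨⟨g, hg⟩, ⟨h, hh⟩⟩, p⟩ U hU
    have p : g.src = h.rng := p
    obtain ⟨W, hW, hWU⟩ := (mem_nhds_subtype {p : {g : KArrow A B // (rho hp).toFun g = 0} ×
      {g : KArrow A B // (rho hp).toFun g = 0} | (ℋ hp).src p.1 = (ℋ hp).rng p.2} _ U).1 hU
    obtain ⟨N₁, hN₁, N₂, hN₂, hN⟩ := mem_nhds_prod_iff.1 hW
    obtain ⟨M₁, hM₁, hMN₁⟩ := (mem_nhds_subtype {g : KArrow A B | (rho hp).toFun g = 0} _ N₁).1 hN₁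
    obtain ⟨M₂, hM₂, hMN₂⟩ := (mem_nhds_subtype {g : KArrow A B | (rho hp).toFun g = 0} _ N₂).1 hN₂
    obtain ⟨q, q', rfl, rfl, hqq⟩ := exists_reps g h p
    obtain ⟨n, hn⟩ := exists_Z_subset hM₁
    obtain ⟨n', hn'⟩ := exists_Z_subset hM₂
    -- Lengthening both factors by the same number of steps keeps the middle paths equal, and `n +
    -- n'` steps suffice for both neighbourhoods.
    obtain ⟨e, -⟩ := Quad.mul_iterate B q q' hqq p (n + n')
    have l1 : (q.α.len : ℤ) - q.β.len = 0 := hg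
    have l2 : (q'.α.len : ℤ) - q'.β.len = 0 := hh
    have m1 := mk_mem_Z (B := B) ((Quad.next B)^[n + n'] q)
    have m2 := mk_mem_Z (B := B) ((Quad.next B)^[n + n'] q')
    have s1 := Z_iterate (B := B) ((Quad.next B)^[n] q) n'
    have s2 := Z_iterate (B := B) ((Quad.next B)^[n'] q') n
    rw [← Function.iterate_add_apply, add_comm n' n] at s1
    rw [← Function.iterate_add_apply] at s2
    rw [mk_iterate] at m1 m2
    refine ⟨⟨(⟨_, _, _, ((Quad.next B)^[n + n'] q).hr, ?_⟩,
      ⟨_, _, _, ((Quad.next B)^[n + n'] q').hr, ?_⟩), e⟩, ⟨m1, m2⟩, ?_⟩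
    · rw [Quad.lenα_iterate, Quad.lenβ_iterate]
      omega
    · rw [Quad.lenα_iterate, Quad.lenβ_iterate]
      omega
    · intro z hz
      exact hWU (hN ⟨hMN₁ (hn (s1 hz.1)), hMN₂ (hn' (s2 hz.2))⟩)

theorem sum_children_r (α : FinPath A) : ∑ e ∈ (pathCells hA hrow hnn).edges α,
    Finsupp.single ((pathCells hA hrow hnn).child α e).r (1 : ℤ)
      = rowMap hA (Finsupp.single α.r 1) := by
  rw [← sum_single_r hA hnn]
  refine Finset.sum_congr rfl fun e he => ?_
  have h : α.extend e = _ := FinPath.extend_of_eq ((mem_edgesFrom hA).1 he)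
  change Finsupp.single (α.extend e).r 1 = _
  rw [h, FinPath.r_snoc]

/-- The homomorphism `1_{Z(α)} ↦ φ_{n,∞}(1_{r(α)})`, `n = |α|`. -/
def pathIntegral : C_c(InfPath A, ℤ) →+ IndLim hA :=
  (pathCells hA hrow hnn).integral ((pathCells hA hrow hnn).limValue_comp_refine hA
    (w := fun α => Finsupp.single α.r 1) (sum_children_r hA hrow hnn))

theorem pathIntegral_cellInd (α : FinPath A) :
    pathIntegral hA hrow hnn ((pathCells hA hrow hnn).cellInd α)
      = toLim hA α.len (Finsupp.single α.r 1) := by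
  rw [pathIntegral, Subdivision.integral_cellInd, Subdivision.limValue, freeLift_single, one_smul]
  rfl

variable (hB : RowFinite B) (hAB : ∀ i j, A i j = 0 → B i j = 0)

include hAB in
theorem sum_children_m (t : Triple A) : ∑ e ∈ (arrowCells hA hrow hnn hp).edges t,
    ((arrowCells hA hrow hnn hp).child t e).m
      • Finsupp.single ((arrowCells hA hrow hnn hp).child t e).β.r (1 : ℤ)
      = rowMap hB (t.m • Finsupp.single t.β.r 1) := by
  rw [map_zsmul, ← sum_coc_single_r hA hB hnn hAB]
  refine Finset.sum_congr rfl fun e he => ?_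
  have h : t.extend B e = _ := Triple.extend_of_eq B ((mem_edgesFrom hA).1 he)
  change (t.extend B e).m • Finsupp.single (t.extend B e).β.r 1 = _
  rw [h]
  have h' : (t.β.snoc e ((mem_edgesFrom hA).1 he)).r = e.r := FinPath.r_snoc _ _ _
  exact congrArg (fun v => e.coc B t.m • Finsupp.single v (1 : ℤ)) h'

/-- The homomorphism `1_{Z(α, m, β; Z(β))} ↦ m φ_{n,∞}(1_{r(β)})`, `n = |β|`. -/
def arrowIntegral : C_c({g : KArrow A B // (rho hp).toFun g = 0}, ℤ) →+ IndLim hB :=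
  (arrowCells hA hrow hnn hp).integral ((arrowCells hA hrow hnn hp).limValue_comp_refine hB
    (w := fun t => t.m • Finsupp.single t.β.r 1) (sum_children_m hA hrow hnn hp hB hAB))

theorem arrowIntegral_cellInd (t : Triple A) :
    arrowIntegral hA hrow hnn hp hB hAB ((arrowCells hA hrow hnn hp).cellInd t)
      = toLim hB t.β.len (t.m • Finsupp.single t.β.r 1) := by
  rw [arrowIntegral, Subdivision.integral_cellInd, Subdivision.limValue, freeLift_single, one_smul]
  rfl

/-- The source and the range of `Z(α, m, β)` are cylinders of paths with the same length and the
same end, so they have the same value. -/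
theorem pathIntegral_δ₁ (f) : pathIntegral hA hrow hnn ((ℋ hp).δ₁ f) = 0 := by
  obtain ⟨F, rfl⟩ := (arrowCells hA hrow hnn hp).realize_surjective f
  have h : ((pathIntegral hA hrow hnn).comp (ℋ hp).δ₁).comp (arrowCells hA hrow hnn hp).realize
      = 0 := by
    refine freeHom_ext fun t => ?_
    rw [AddMonoidHom.comp_apply, AddMonoidHom.comp_apply, Subdivision.realize_single,
      δ₁_arrowCells, map_sub, pathIntegral_cellInd, pathIntegral_cellInd, t.hr, t.hl, sub_self]
    rfl
  exact DFunLike.congr_fun h F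

/-- On the generators from `closure_pairs_eq_top` all three faces have the same level and end
vertex, and their weights cancel as `m' - (m + m') + m`. -/
theorem arrowIntegral_δ₂ (f) : arrowIntegral hA hrow hnn hp hB hAB ((ℋ hp).δ₂ f) = 0 := by
  have h : f ∈ ((arrowIntegral hA hrow hnn hp hB hAB).comp (ℋ hp).δ₂).ker := by
    have h1 : f ∈ (⊤ : AddSubgroup _) := trivial
    rw [← closure_pairs_eq_top hA hrow hnn hp] at h1
    refine (AddSubgroup.closure_le _).2 ?_ h1
    rintro _ ⟨⟨⟨t, t'⟩, ht⟩, rfl⟩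
    have ht : t.β = t'.α := ht
    have hr : t.β.r = t'.β.r := by rw [ht, t'.hr]
    have hl : t.β.len = t'.β.len := by rw [ht, t'.hl]
    refine (AddMonoidHom.mem_ker).2 ?_
    rw [AddMonoidHom.comp_apply, δ₂_arrowCells hA hrow hnn hp ht
      (s := ⟨t.α, t.m + t'.m, t'.β, t.hr.trans hr, t.hl.trans hl⟩) rfl rfl rfl, map_add, map_sub,
      arrowIntegral_cellInd, arrowIntegral_cellInd, arrowIntegral_cellInd]
    change toLim hB t'.β.len (t'.m • Finsupp.single t'.β.r 1)
      - toLim hB t'.β.len ((t.m + t'.m) • Finsupp.single t'.β.r 1)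
      + toLim hB t.β.len (t.m • Finsupp.single t.β.r 1) = 0
    rw [← hr, ← hl, add_smul, map_add]
    abel
  exact h

/-- Base paths, one for each vertex at which a path of length `n` ends. At the other vertices the
empty path is a default value to which the conclusion never applies. -/
theorem exists_base (A : Matrix V V ℤ) (n : ℕ) : ∃ b : V → FinPath A, ∀ α : FinPath A,
    α.len = n → (b α.r).len = n ∧ (b α.r).r = α.r := by
  have h : ∀ v, ∃ β : FinPath A, ∀ α : FinPath A, α.len = n → α.r = v → β.len = n ∧ β.r = v := by
    intro v
    by_cases hv : ∃ α : FinPath A, α.len = n ∧ α.r = v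
    · obtain ⟨α, hα⟩ := hv
      exact ⟨α, fun _ _ _ => hα⟩
    · exact ⟨⟨v, [], fun h => absurd h (by simp), fun i h => absurd h (by simp)⟩,
        fun α h1 h2 => absurd ⟨α, h1, h2⟩ hv⟩
  choose b hb using h
  exact ⟨b, fun α hα => hb _ α hα rfl⟩

/-- If `b` is the base path at `r(α)`, the bisection `Z(α, 0, b)` makes `1_{Z(α)}` and `1_{Z(b)}`
homologous. So the class of `F` depends only on its total weight in `ℤ^(V)`. -/
theorem realize_mem_range_δ₁ {n : ℕ} {F : FinPath A →₀ ℤ} (h : (pathCells hA hrow hnn).Homog n F)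
    (h0 : freeLift (fun α : FinPath A => Finsupp.single α.r (1 : ℤ)) F = 0) :
    (pathCells hA hrow hnn).realize F ∈ (ℋ hp).δ₁.range := by
  obtain ⟨b, hb⟩ := exists_base A n
  rw [← QuotientAddGroup.eq_zero_iff]
  have h1 := h.hom_ext
    (a := (QuotientAddGroup.mk' (ℋ hp).δ₁.range).comp (pathCells hA hrow hnn).realize)
    (b := (QuotientAddGroup.mk' (ℋ hp).δ₁.range).comp
      ((freeLift fun v => (pathCells hA hrow hnn).cellInd (b v)).comp
        (freeLift fun α : FinPath A => Finsupp.single α.r (1 : ℤ)))) (by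
      intro α hα
      obtain ⟨hl, hr⟩ := hb α hα
      simp only [AddMonoidHom.comp_apply, freeLift_single, one_smul, Subdivision.realize_single]
      refine (QuotientAddGroup.eq (s := (ℋ hp).δ₁.range)).2 ⟨(arrowCells hA hrow hnn hp).cellInd
        ⟨α, 0, b α.r, hr.symm, Eq.trans hα hl.symm⟩, ?_⟩
      rw [δ₁_arrowCells]
      abel)
  simp only [AddMonoidHom.comp_apply, h0, map_zero] at h1
  exact h1

open Classical in
/-- The class of `1_{Z(α, m, β; Z(β))}` modulo the image of `δ_2`. -/
def arrowCls (α : FinPath A) (m : ℤ) (β : FinPath A) :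
    C_c({g : KArrow A B // (rho hp).toFun g = 0}, ℤ) ⧸ (ℋ hp).δ₂.range :=
  if h : α.r = β.r ∧ α.len = β.len then
    QuotientAddGroup.mk ((arrowCells hA hrow hnn hp).cellInd ⟨α, m, β, h.1, h.2⟩) else 0

theorem arrowCls_of_eq {α β : FinPath A} (h : α.r = β.r) (l : α.len = β.len) (m : ℤ) :
    arrowCls hA hrow hnn hp α m β
      = QuotientAddGroup.mk ((arrowCells hA hrow hnn hp).cellInd ⟨α, m, β, h, l⟩) := dif_pos ⟨h, l⟩

theorem arrowCls_add {α β γ : FinPath A} (h₁ : α.r = β.r) (h₂ : β.r = γ.r) (l₁ : α.len = β.len)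
    (l₂ : β.len = γ.len) (m m' : ℤ) : arrowCls hA hrow hnn hp α (m + m') γ
      = arrowCls hA hrow hnn hp α m β + arrowCls hA hrow hnn hp β m' γ := by
  rw [arrowCls_of_eq hA hrow hnn hp h₁ l₁, arrowCls_of_eq hA hrow hnn hp h₂ l₂,
    arrowCls_of_eq hA hrow hnn hp (h₁.trans h₂) (l₁.trans l₂)]
  have e := congrArg (QuotientAddGroup.mk' (ℋ hp).δ₂.range) (δ₂_arrowCells hA hrow hnn hp
    (t := ⟨α, m, β, h₁, l₁⟩) (t' := ⟨β, m', γ, h₂, l₂⟩)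
    (s := ⟨α, m + m', γ, h₁.trans h₂, l₁.trans l₂⟩) rfl rfl rfl rfl)
  rw [(AddMonoidHom.mem_ker (f := QuotientAddGroup.mk' (ℋ hp).δ₂.range)).1 (by
    rw [QuotientAddGroup.ker_mk']
    exact ⟨_, rfl⟩), map_add, map_sub, sub_add_eq_add_sub] at e
  exact (sub_eq_zero.1 e.symm).symm.trans (add_comm _ _)

/-- Factor `(α, m, β)` as `(α, 0, b)(b, m, b)(b, 0, β)`. By additivity the middle class is linear in
`m`, and the class of `(b, 0, β)` is minus that of `(β, 0, b)`. -/
theorem arrowCls_eq {α β b : FinPath A} (h₁ : α.r = b.r) (h₂ : β.r = b.r) (l₁ : α.len = b.len)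
    (l₂ : β.len = b.len) (m : ℤ) : arrowCls hA hrow hnn hp α m β
      = arrowCls hA hrow hnn hp α 0 b - arrowCls hA hrow hnn hp β 0 b
        + m • arrowCls hA hrow hnn hp b 1 b := by
  let φ : ℤ →+ _ := AddMonoidHom.mk' (fun m => arrowCls hA hrow hnn hp b m b)
    fun m m' => arrowCls_add hA hrow hnn hp rfl rfl rfl rfl m m'
  have h3 : arrowCls hA hrow hnn hp b m b = m • arrowCls hA hrow hnn hp b 1 b := by
    have := map_zsmul φ m 1
    rwa [smul_eq_mul, _root_.mul_one] at this
  have h4 := arrowCls_add hA hrow hnn hp h₁ (h₂.symm) l₁ l₂.symm 0 m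
  have h5 := arrowCls_add hA hrow hnn hp (α := b) rfl (h₂.symm) rfl l₂.symm m 0
  have h6 := arrowCls_add hA hrow hnn hp (α := b) h₂.symm h₂ l₂.symm l₂ 0 0
  have h7 : arrowCls hA hrow hnn hp b 0 b = 0 := map_zero φ
  rw [zero_add] at h4
  rw [add_zero] at h5 h6
  rw [h7] at h6
  rw [h4, h5, h3, eq_neg_of_add_eq_zero_left h6.symm]
  abel

/-- By `arrowCls_eq` the class of `F` is a sum of two parts, one depending only on the formal
boundary `D F` and one only on the total weight. The second is zero by assumption. Since `D F`
represents minus the boundary of the cycle and representation at one level is unique, `D F` is zero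
already as a formal sum. -/
theorem realize_mem_range_δ₂ {n : ℕ} {F : Triple A →₀ ℤ}
    (h : (arrowCells hA hrow hnn hp).Homog n F)
    (h0 : freeLift (fun t : Triple A => t.m • Finsupp.single t.β.r (1 : ℤ)) F = 0)
    (h1 : (ℋ hp).δ₁ ((arrowCells hA hrow hnn hp).realize F) = 0) :
    (arrowCells hA hrow hnn hp).realize F ∈ (ℋ hp).δ₂.range := by
  obtain ⟨b, hb⟩ := exists_base A n
  let D : (Triple A →₀ ℤ) →+ (FinPath A →₀ ℤ) :=
    freeLift fun t => Finsupp.single t.α 1 - Finsupp.single t.β 1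
  have hD : D F = 0 := by
    refine (pathCells hA hrow hnn).eq_zero_of_realize (n := n) ?_ ?_
    · refine Subdivision.homog_sum _ fun t ht => Subdivision.Homog.zsmul ?_ _
      have hβ : t.β.len = n := h t ht
      have hα : t.α.len = n := t.hl.trans hβ
      refine Subdivision.Homog.sub ?_ ?_
      · rw [← hα]
        exact Subdivision.homog_single (𝒮 := pathCells hA hrow hnn) t.α 1
      · rw [← hβ]
        exact Subdivision.homog_single (𝒮 := pathCells hA hrow hnn) t.β 1
    · have h2 : (pathCells hA hrow hnn).realize.comp D
          = -((ℋ hp).δ₁.comp (arrowCells hA hrow hnn hp).realize) := by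
        refine freeHom_ext fun t => ?_
        rw [AddMonoidHom.neg_apply, AddMonoidHom.comp_apply, AddMonoidHom.comp_apply,
          Subdivision.realize_single, δ₁_arrowCells]
        simp only [D, freeLift_single, one_smul, map_sub, Subdivision.realize_single]
        abel
      have h3 := DFunLike.congr_fun h2 F
      rw [AddMonoidHom.neg_apply, AddMonoidHom.comp_apply, AddMonoidHom.comp_apply, h1, neg_zero]
        at h3
      exact h3
  rw [← QuotientAddGroup.eq_zero_iff]
  have h2 := h.hom_ext
    (a := (QuotientAddGroup.mk' (ℋ hp).δ₂.range).comp (arrowCells hA hrow hnn hp).realize)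
    (b := (freeLift fun α => arrowCls hA hrow hnn hp α 0 (b α.r)).comp D
      + (freeLift fun v => arrowCls hA hrow hnn hp (b v) 1 (b v)).comp
        (freeLift fun t : Triple A => t.m • Finsupp.single t.β.r (1 : ℤ))) (by
      intro t ht
      have hβ : t.β.len = n := ht
      obtain ⟨hl, hr⟩ := hb t.β hβ
      simp only [AddMonoidHom.comp_apply, AddMonoidHom.add_apply, freeLift_single, one_smul,
        Subdivision.realize_single, D, map_sub, map_zsmul]
      rw [t.hr, ← arrowCls_eq hA hrow hnn hp (t.hr.trans hr.symm) hr.symm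
        (t.hl.trans (hβ.trans hl.symm)) (hβ.trans hl.symm), 
        arrowCls_of_eq hA hrow hnn hp t.hr t.hl]
      rfl)
  simp only [AddMonoidHom.comp_apply, AddMonoidHom.add_apply, h0, hD, map_zero, add_zero] at h2
  exact h2

theorem mem_range_δ₁_of_pathIntegral {f : C_c(InfPath A, ℤ)} (hf : pathIntegral hA hrow hnn f = 0) :
    f ∈ (ℋ hp).δ₁.range := by
  obtain ⟨n, F, h, rfl, h0⟩ := (pathCells hA hrow hnn).exists_of_integral_eq_zero _
    (w := fun α => Finsupp.single α.r 1) (sum_children_r hA hrow hnn) hf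
  exact realize_mem_range_δ₁ hA hrow hnn hp h h0

theorem mem_range_δ₂_of_arrowIntegral {f : C_c({g : KArrow A B // (rho hp).toFun g = 0}, ℤ)}
    (hf : arrowIntegral hA hrow hnn hp hB hAB f = 0) (hf' : (ℋ hp).δ₁ f = 0) :
    f ∈ (ℋ hp).δ₂.range := by
  obtain ⟨n, F, h, rfl, h0⟩ := (arrowCells hA hrow hnn hp).exists_of_integral_eq_zero _
    (w := fun t => t.m • Finsupp.single t.β.r 1) (sum_children_m hA hrow hnn hp hB hAB) hf
  exact realize_mem_range_δ₂ hA hrow hnn hp h h0 hf'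

end Homology

/-! ### Vertices at the end of paths of given length. -/

section Reach

/-- The ranges of the paths of length `n`. -/
def reach (A : Matrix V V ℤ) (n : ℕ) : Set V := {v | ∃ α : FinPath A, α.len = n ∧ α.r = v}

theorem reach_zero : reach A 0 = univ := eq_univ_of_forall fun v =>
  ⟨⟨v, [], fun h => absurd h (by simp), fun i h => absurd h (by simp)⟩, rfl, rfl⟩

theorem mem_reach_succ (hnn : ∀ i j, 0 ≤ A i j) {v w : V} {n : ℕ} (hv : v ∈ reach A n)
    (h : A v w ≠ 0) : w ∈ reach A (n + 1) := by
  obtain ⟨α, rfl, rfl⟩ := hv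
  let e : Edge A := ⟨α.r, w, 0, le_rfl, lt_of_le_of_ne (hnn _ _) h.symm⟩
  exact ⟨α.snoc e rfl, FinPath.len_snoc α e rfl, FinPath.r_snoc α e rfl⟩

theorem InfPath.mem_reach (x : InfPath A) (n : ℕ) : (x.1 n).s ∈ reach A n :=
  ⟨x.take n, x.len_take n, x.r_take n⟩

/-- Deleting the first edge of a path shortens it by one and keeps its end. The deletion is carried
out on an infinite path that extends it. -/
theorem antitone_reach (hrow : ∀ i, ∃ j, A i j ≠ 0) (hnn : ∀ i j, 0 ≤ A i j) :
    Antitone (reach A) := by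
  refine antitone_nat_of_succ_le fun n => ?_
  rintro _ ⟨α, hα, rfl⟩
  obtain ⟨x, hx⟩ := nonempty_cyl hrow hnn α
  rw [FinPath.r_of_mem_cyl hx, hα, add_comm]
  exact (x.drop 1).mem_reach n

/-- The vertices at the end of sufficiently long paths are at the end of paths of any length. -/
theorem exists_reach_subset (hrow : ∀ i, ∃ j, A i j ≠ 0) (hnn : ∀ i j, 0 ≤ A i j)
    (hcol : Finite V ∨ ∀ j, ∃ i, A i j ≠ 0) : ∃ N, ∀ n, reach A N ⊆ reach A n := by
  have hanti := antitone_reach hrow hnn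
  rcases hcol with hV | hcol
  -- A decreasing sequence of subsets of a finite set becomes stationary.
  · let f : ℕ →o (Set V)ᵒᵈ := ⟨fun n => OrderDual.toDual (reach A n), hanti.dual_right⟩
    obtain ⟨N, hN⟩ := WellFoundedGT.monotone_chain_condition f
    refine ⟨N, fun n => ?_⟩
    rcases le_total N n with h | h
    · exact (show reach A N = reach A n from hN n h) ▸ le_rfl
    · exact hanti h
  -- Without zero columns every vertex receives an edge, so every vertex is at the end of paths of
  -- any length.
  · refine ⟨0, fun n v _ => ?_⟩
    induction n generalizing v with
    | zero =>
      rw [reach_zero]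
      trivial
    | succ n ih =>
      obtain ⟨i, hi⟩ := hcol v
      exact mem_reach_succ hnn (ih i (by rw [reach_zero]; trivial)) hi

/-- A nonzero entry of `M` lies over a nonzero entry of `A`, so each application of `rowMap` moves
the support along edges. -/
theorem support_rowMap_pow (hnn : ∀ i j, 0 ≤ A i j) (hM : RowFinite M)
    (hAM : ∀ i j, A i j = 0 → M i j = 0) (x : V →₀ ℤ) (n : ℕ) :
    ∀ w ∈ ((rowMap hM ^ n) x).support, w ∈ reach A n := by
  induction n with
  | zero =>
    intro w _
    rw [reach_zero]
    trivial
  | succ n ih =>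
    intro w hw
    rw [pow_succ', Module.End.mul_apply, rowMap, Finsupp.linearCombination_apply, Finsupp.sum,
      Finsupp.mem_support_iff, Finsupp.finsetSum_apply] at hw
    obtain ⟨v, hv, hvw⟩ := Finset.exists_ne_zero_of_sum_ne_zero hw
    refine mem_reach_succ hnn (ih v hv) fun h => hvw ?_
    rw [Finsupp.smul_apply, smul_eq_mul]
    exact mul_eq_zero_of_right _ (hAM v w h)

/-- Compatible families of homomorphisms on the terms of the inductive limit are equal if they agree
on the vertices that are at the end of paths of any length. -/
theorem compatible_ext {L : Type*} [AddCommGroup L] (hrow : ∀ i, ∃ j, A i j ≠ 0)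
    (hnn : ∀ i j, 0 ≤ A i j) (hcol : Finite V ∨ ∀ j, ∃ i, A i j ≠ 0) (hM : RowFinite M)
    (hAM : ∀ i j, A i j = 0 → M i j = 0) {a b : ℕ → (V →₀ ℤ) →+ L}
    (ha : ∀ n x, a (n + 1) (rowMap hM x) = a n x) (hb : ∀ n x, b (n + 1) (rowMap hM x) = b n x)
    (hab : ∀ n w, (∀ k, w ∈ reach A k) → a n (Finsupp.single w 1) = b n (Finsupp.single w 1))
    (n : ℕ) (x : V →₀ ℤ) : a n x = b n x := by
  have hpow : ∀ {c : ℕ → (V →₀ ℤ) →+ L}, (∀ n x, c (n + 1) (rowMap hM x) = c n x) →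
      ∀ j, c (n + j) ((rowMap hM ^ j) x) = c n x := by
    intro c hc j
    induction j with
    | zero => rfl
    | succ j ih => rw [pow_succ', Module.End.mul_apply, ← add_assoc, hc, ih]
  -- Both families are unchanged when `x` is pushed forward by `N` steps, after which its support
  -- consists of vertices at the end of paths of every length.
  obtain ⟨N, hN⟩ := exists_reach_subset hrow hnn hcol
  have hs := support_rowMap_pow hnn hM hAM x N
  rw [← hpow ha N, ← hpow hb N]
  generalize (rowMap hM ^ N) x = y at hs
  rw [← y.sum_single, Finsupp.sum, map_sum, map_sum]
  refine Finset.sum_congr rfl fun w hw => ?_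
  rw [← _root_.mul_one (y w), ← smul_eq_mul, ← Finsupp.smul_single, map_zsmul, map_zsmul,
    hab _ w fun k => hN k (hs w hw)]

end Reach

/-! ### A transversal for the skew product of the Katsura-Exel-Pardo groupoid. -/

section Transversal

open KArrow

/-- Arrows from all units `(x, k)` of the skew product to units `(y, 0)`, which replace an initial
segment of `x` by a path that is longer by `k`. -/
theorem nonempty_transversal (hrow : ∀ i, ∃ j, A i j ≠ 0) (hnn : ∀ i j, 0 ≤ A i j)
    (hcol : Finite V ∨ ∀ j, ∃ i, A i j ≠ 0) (hp : PseudoFree A B) :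
    Nonempty (Transversal (rho hp)) := by
  obtain ⟨N, hN⟩ := exists_reach_subset hrow hnn hcol
  have hanti := antitone_reach hrow hnn
  have hP : ∀ (j : ℕ) (v : reach A N), ∃ α : FinPath A, α.len = j ∧ α.r = v := fun j v => hN j v.2
  choose P hPl hPr using hP
  -- The length of the replaced segment. As `b k ≥ N`, its end is the end of paths of any length; as
  -- `b k + k ≥ 0`, the length of the new path survives `toNat`.
  let b : ℤ → ℕ := fun k => N + k.natAbs
  have hb : ∀ (x : InfPath A) k, (x.take (b k)).r ∈ reach A N := fun x k => by
    rw [x.r_take]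
    exact hanti (Nat.le_add_right N k.natAbs) (x.mem_reach _)
  let q : InfPath A × ℤ → Quad A := fun y =>
    ⟨P (b y.2 + y.2).toNat ⟨_, hb y.1 y.2⟩, 0, y.1.take (b y.2), y.1, hPr _ _, by
      change y.1.take (y.1.take (b y.2)).len = _
      rw [InfPath.len_take]⟩
  refine ⟨⟨fun y => mk B (q y), ?_, fun y => rfl, ?_⟩⟩
  · rw [continuous_iff_continuousAt]
    rintro ⟨x, k⟩ W hW
    have h1 := isLocalHomeomorph_src.isOpenMap.image_mem_nhds
      (Filter.inter_mem hW (Z_mem_nhds (B := B) (q (x, k))))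
    rw [Filter.mem_map, nhds_prod_eq, nhds_discrete ℤ, Filter.prod_pure, Filter.mem_map]
    filter_upwards [h1, x.eventually_take (b k)] with y hy hyx
    obtain ⟨g, ⟨hgW, hgZ⟩, hg⟩ := hy
    -- Near `x` the initial segment is constant, and so is the path that replaces it. The arrow at
    -- `(y, k)` is therefore the unique one with source `y` in the bisection of the arrow at `(x,
    -- k)`.
    have h2 : mk B (q (y, k)) ∈ Z B (q (x, k)).α (q (x, k)).m (q (x, k)).β := by
      refine ⟨q (y, k), ?_, rfl, hyx, rfl⟩
      change P _ _ = P _ _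
      congr 2
      rw [hyx]
    have h3 : g = mk B (q (y, k)) := src_injOn_Z _ _ _ hgZ h2 hg
    rw [h3] at hgW
    exact hgW
  · rintro ⟨x, k⟩
    change ((P (b k + k).toNat _).len : ℤ) - (x.take (b k)).len = k
    rw [hPl, InfPath.len_take]
    simp only [b]
    omega

end Transversal

/-! ### The dual action on the classes of paths and loops. -/

section Skew

open KArrow

variable (hA : RowFinite A) (hp : PseudoFree A B)

theorem lag_of_mem_Z {α β : FinPath A} {m : ℤ} {g : KArrow A B} (hg : g ∈ Z B α m β) :
    (rho hp).toFun g = α.len - β.len := by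
  obtain ⟨q, rfl, rfl, rfl, rfl⟩ := hg
  rfl

/-- The indicator function of `Z(α, m, β; Z(β)) × {k}`. -/
def skewInd {α β : FinPath A} (h : α.r = β.r) (m k : ℤ) : C_c(KArrow A B × ℤ, ℤ) :=
  haveI := (skew (rho hp)).t2_arrows
  ind (Z B α m β ×ˢ {k}) ((isCompact_Z hA h m).prod isCompact_singleton)
    ((isOpen_Z h m).prod (isOpen_discrete _))

/-- On `Z(α, m, β)` the cocycle is constant with value `|α| - |β|`, so all sources lie at the one
height `l`. -/
theorem δ₁_skewInd {α β : FinPath A} (h : α.r = β.r) (m : ℤ) {k l : ℤ}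
    (hk : k + (α.len - β.len) = l) :
    (skew (rho hp)).δ₁ (skewInd hA hp h m k)
      = ind (cyl β ×ˢ {l}) ((isCompact_cyl hA β).prod isCompact_singleton)
          ((isOpen_cyl β).prod (isOpen_discrete _))
        - ind (cyl α ×ˢ {k}) ((isCompact_cyl hA α).prod isCompact_singleton)
          ((isOpen_cyl α).prod (isOpen_discrete _)) := by
  have := (skew (rho hp)).t2_arrows
  refine (skew (rho hp)).δ₁_ind _ _ ?_ ?_ ?_ ?_ _ _ _ _
  · rintro ⟨g, k⟩ ⟨hg, rfl⟩ ⟨g', k'⟩ ⟨hg', rfl⟩ e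
    exact Prod.ext (src_injOn_Z _ _ _ hg hg' (congrArg Prod.fst e)) rfl
  · rintro ⟨g, k⟩ ⟨hg, rfl⟩ ⟨g', k'⟩ ⟨hg', rfl⟩ e
    exact Prod.ext (rng_injOn_Z _ _ _ hg hg' (congrArg Prod.fst e)) rfl
  · rw [← src_image_Z (B := B) h m]
    ext ⟨x, i⟩
    constructor
    · rintro ⟨⟨g, k'⟩, ⟨hg, rfl⟩, e⟩
      obtain ⟨rfl, rfl⟩ := Prod.mk.inj e
      exact ⟨⟨g, hg, rfl⟩, by rw [lag_of_mem_Z hp hg]; exact hk⟩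
    · rintro ⟨⟨g, hg, rfl⟩, rfl⟩
      exact ⟨(g, k), ⟨hg, rfl⟩, Prod.ext rfl (by
        change k + (rho hp).toFun g = _
        rw [lag_of_mem_Z hp hg]
        exact hk)⟩
  · rw [← rng_image_Z (B := B) h m]
    ext ⟨x, i⟩
    constructor
    · rintro ⟨⟨g, k'⟩, ⟨hg, rfl⟩, e⟩
      obtain ⟨rfl, rfl⟩ := Prod.mk.inj e
      exact ⟨⟨g, hg, rfl⟩, rfl⟩
    · rintro ⟨⟨g, hg, rfl⟩, rfl⟩
      exact ⟨(g, _), ⟨hg, rfl⟩, rfl⟩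

/-- The boundary relation of the product of `Z(α, m, β) × {k}` and `Z(β, m', γ) × {l}`: the choice
of `l` makes the sources of the first factor the ranges of the second. -/
theorem skewInd_mem_range {α β γ : FinPath A} (h : α.r = β.r) (h' : β.r = γ.r) {m m' n : ℤ}
    (hn : n = m + m') {k l : ℤ} (hk : k + (α.len - β.len) = l) :
    skewInd hA hp h' m' l - skewInd hA hp (h.trans h') n k + skewInd hA hp h m k
      ∈ (skew (rho hp)).δ₂.range := by
  subst hn
  have := (skew (rho hp)).t2_arrows
  have hs : ∀ g ∈ Z B α m β, k + (rho hp).toFun g = l := fun g hg => by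
    rw [lag_of_mem_Z hp hg, hk]
  have hc : ∀ g ∈ Z B α m β ×ˢ {k}, ∀ h : KArrow A B × ℤ, h.2 = l → g.1.src = h.1.rng →
      (skew (rho hp)).src g = (skew (rho hp)).rng h := by
    rintro ⟨g, k'⟩ ⟨hg, rfl⟩ ⟨h, l'⟩ rfl e
    exact Prod.ext e (hs g hg)
  refine ⟨_, (skew (rho hp)).δ₂_pairs (U := Z B α m β ×ˢ {k}) (W := Z B β m' γ ×ˢ {l})
    (P := Z B α (m + m') γ ×ˢ {k}) ((isCompact_Z hA h m).prod isCompact_singleton)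
    ((isOpen_Z h m).prod (isOpen_discrete _)) ((isCompact_Z hA h' m').prod isCompact_singleton)
    ((isOpen_Z h' m').prod (isOpen_discrete _))
    ((isCompact_Z hA (h.trans h') (m + m')).prod isCompact_singleton)
    ((isOpen_Z (h.trans h') (m + m')).prod (isOpen_discrete _))
    ?_ ?_ ?_ ?_ ?_ ?_ ?_⟩
  · rintro g ⟨hg, hk⟩ g' ⟨hg', hk'⟩ e
    exact Prod.ext (src_injOn_Z _ _ _ hg hg' (congrArg Prod.fst e)) (Eq.trans hk hk'.symm)
  · rintro g ⟨hg, hk⟩ g' ⟨hg', hk'⟩ e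
    exact Prod.ext (src_injOn_Z _ _ _ hg hg' (congrArg Prod.fst e)) (Eq.trans hk hk'.symm)
  · rintro g ⟨hg, hk⟩ g' ⟨hg', hk'⟩ e
    exact Prod.ext (rng_injOn_Z _ _ _ hg hg' (congrArg Prod.fst e)) (Eq.trans hk hk'.symm)
  · intro g hg
    obtain ⟨h, hh, e⟩ := exists_src_eq_rng h' m' hg.1
    exact ⟨(h, l), ⟨hh, rfl⟩, hc g hg _ rfl e⟩
  · intro h₁ hh
    obtain ⟨g, hg, e⟩ := exists_rng_eq_src h m hh.1
    exact ⟨(g, k), ⟨hg, rfl⟩, hc (g, k) ⟨hg, rfl⟩ h₁ hh.2 e⟩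
  · intro g hg h hh p
    exact ⟨mul_mem_Z hg.1 hh.1 (congrArg Prod.fst p), hg.2⟩
  · intro z hz
    obtain ⟨g, hg, h, hh, p, e⟩ := exists_mul_of_mem_Z h' hz.1
    exact ⟨(g, k), ⟨hg, rfl⟩, (h, l), ⟨hh, rfl⟩, hc (g, k) ⟨hg, rfl⟩ (h, l) rfl p,
      Prod.ext e (Eq.symm hz.2)⟩

/-- The dual action lifts `Z(α) × {0}` to `Z(α) × {1}`. The bisection `Z(α', 0, α) × {0}` has this
set as its source, since `ρ` is `1` on it, and `Z(α') × {0}` as its range. -/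
theorem dual_incl_pathClass {α α' : FinPath A} (hr : α'.r = α.r) (hl : α'.len = α.len + 1) :
    (dual (rho hp) 1).mapH₀ ((incl (rho hp)).mapH₀ (pathClass hA hp α))
      = (incl (rho hp)).mapH₀ (pathClass hA hp α') := by
  have h1 : ∀ β : FinPath A, (incl (rho hp)).chain₀ (ind (cyl β) (isCompact_cyl hA β) (isOpen_cyl β))
      = ind (cyl β ×ˢ {0}) ((isCompact_cyl hA β).prod isCompact_singleton)
          ((isOpen_cyl β).prod (isOpen_discrete _)) := fun β =>
    push_ind _ _ _ (isOpenEmbedding_prodMk_zero _).injective.injOn (by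
      ext ⟨x, i⟩
      constructor
      · rintro ⟨y, hy, e⟩
        obtain ⟨rfl, rfl⟩ := Prod.mk.inj e
        exact ⟨hy, rfl⟩
      · rintro ⟨hx, rfl⟩
        exact ⟨x, hx, rfl⟩) _ _
  have h2 : (dual (rho hp) 1).chain₀ ((incl (rho hp)).chain₀
        (ind (cyl α) (isCompact_cyl hA α) (isOpen_cyl α)))
      = ind (cyl α ×ˢ {1}) ((isCompact_cyl hA α).prod isCompact_singleton)
          ((isOpen_cyl α).prod (isOpen_discrete _)) := by
    rw [h1]
    refine push_ind _ _ _ ?_ ?_ _ _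
    · rintro ⟨x, i⟩ ⟨_, rfl⟩ ⟨y, j⟩ ⟨_, rfl⟩ e
      have e : (x, (1 : ℤ) + 0) = (y, 1 + 0) := e
      exact Prod.ext (Prod.mk.inj e).1 rfl
    · ext ⟨x, i⟩
      constructor
      · rintro ⟨⟨y, j⟩, ⟨hy, rfl⟩, e⟩
        obtain ⟨rfl, rfl⟩ := Prod.mk.inj e
        exact ⟨hy, rfl⟩
      · rintro ⟨hx, rfl⟩
        exact ⟨(x, 0), ⟨hx, rfl⟩, rfl⟩
  refine (QuotientAddGroup.eq (s := (skew (rho hp)).δ₁.range)).2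
    ⟨-skewInd hA hp hr 0 0, ?_⟩
  rw [map_neg, δ₁_skewInd hA hp hr 0 (l := 1) (by rw [hl]; push_cast; ring), h2, h1]
  abel

/-- The bisection `Z(α', 1, α) × {0}` factors both as `Z(α', 0, α) × {0}` times `Z(α, 1, α) × {1}`
and as `Z(α', 1, α') × {0}` times `Z(α', 0, α) × {0}`. In the difference of the two boundary
relations only the two loops remain. -/
theorem dual_incl_loopClass {α α' : FinPath A} (hr : α'.r = α.r) (hl : α'.len = α.len + 1) :
    (dual (rho hp) 1).mapH₁ ((incl (rho hp)).mapH₁ (loopClass hA hp α))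
      = (incl (rho hp)).mapH₁ (loopClass hA hp α') := by
  have := (skew (rho hp)).t2_arrows
  have h1 : ∀ β : FinPath A, (incl (rho hp)).chain₁ (loopInd hA hp β 1)
      = skewInd hA hp (rfl : β.r = β.r) 1 0 := fun β =>
    push_ind _ _ _ (fun g _ k _ e => Subtype.ext (congrArg Prod.fst e)) (by
      rw [← val_image_loopSet hp]
      ext ⟨x, i⟩
      constructor
      · rintro ⟨y, hy, e⟩
        obtain ⟨rfl, rfl⟩ := Prod.mk.inj e
        exact ⟨⟨y, hy, rfl⟩, rfl⟩
      · rintro ⟨⟨y, hy, rfl⟩, rfl⟩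
        exact ⟨y, hy, rfl⟩) _ _
  have h2 : (dual (rho hp) 1).chain₁ ((incl (rho hp)).chain₁ (loopInd hA hp α 1))
      = skewInd hA hp (rfl : α.r = α.r) 1 1 := by
    rw [h1]
    refine push_ind _ _ _ ?_ ?_ _ _
    · rintro ⟨x, i⟩ ⟨_, rfl⟩ ⟨y, j⟩ ⟨_, rfl⟩ e
      have e : (x, (1 : ℤ) + 0) = (y, 1 + 0) := e
      exact Prod.ext (Prod.mk.inj e).1 rfl
    · ext ⟨x, i⟩
      constructor
      · rintro ⟨⟨y, j⟩, ⟨hy, rfl⟩, e⟩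
        obtain ⟨rfl, rfl⟩ := Prod.mk.inj e
        exact ⟨hy, rfl⟩
      · rintro ⟨hx, rfl⟩
        exact ⟨(x, 0), ⟨hx, rfl⟩, rfl⟩
  have e1 := skewInd_mem_range hA hp hr (rfl : α.r = α.r) (m := 0) (m' := 1) (n := 1) rfl (k := 0)
    (l := 1) (by rw [hl]; push_cast; ring)
  have e2 := skewInd_mem_range hA hp (rfl : α'.r = α'.r) hr (m := 1) (m' := 0) (n := 1) rfl (k := 0)
    (l := 0) (by ring)
  refine (QuotientAddGroup.eq
    (s := (skew (rho hp)).δ₂.range.addSubgroupOf (skew (rho hp)).δ₁.ker)).2 ?_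
  change -((dual (rho hp) 1).chain₁ ((incl (rho hp)).chain₁ (loopInd hA hp α 1)))
    + (incl (rho hp)).chain₁ (loopInd hA hp α' 1) ∈ (skew (rho hp)).δ₂.range
  rw [h2, h1]
  convert sub_mem e2 e1 using 1
  abel

theorem tilde₀_pathClass (h : Function.Bijective (incl (rho hp)).mapH₀) {α α' : FinPath A}
    (hr : α'.r = α.r) (hl : α'.len = α.len + 1) :
    tilde₀ (rho hp) h 1 (pathClass hA hp α) = pathClass hA hp α' :=
  (AddEquiv.symm_apply_eq (AddEquiv.ofBijective (incl (rho hp)).mapH₀ h)).2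
    (dual_incl_pathClass hA hp hr hl)

theorem tilde₁_loopClass (h : Function.Bijective (incl (rho hp)).mapH₁) {α α' : FinPath A}
    (hr : α'.r = α.r) (hl : α'.len = α.len + 1) :
    tilde₁ (rho hp) h 1 (loopClass hA hp α) = loopClass hA hp α' :=
  (AddEquiv.symm_apply_eq (AddEquiv.ofBijective (incl (rho hp)).mapH₁ h)).2
    (dual_incl_loopClass hA hp hr hl)

end Skew

/-! ### The isomorphisms and the shift. -/

section Isomorphisms

variable (hA : RowFinite A) (hrow : ∀ i, ∃ j, A i j ≠ 0) (hnn : ∀ i j, 0 ≤ A i j)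
  (hcol : Finite V ∨ ∀ j, ∃ i, A i j ≠ 0) (hp : PseudoFree A B)

include hrow hnn hcol

/-- A vertex that is not the end of a path of length `n` gives no class at level `n`, so generators
cannot be hit one by one. Modulo the range of `Φ`, however, the canonical maps are a compatible
family that vanishes at the vertices required by `compatible_ext`. -/
theorem surjective_of_toLim {L : Type*} [AddCommGroup L] (hM : RowFinite M)
    (hAM : ∀ i j, A i j = 0 → M i j = 0) (Φ : L →+ IndLim hM)
    (hΦ : ∀ α : FinPath A, toLim hM α.len (Finsupp.single α.r 1) ∈ Φ.range) :
    Function.Surjective Φ := by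
  intro y
  obtain ⟨n, x, rfl⟩ := exists_toLim hM y
  have h := compatible_ext hrow hnn hcol hM hAM
    (a := fun n => (QuotientAddGroup.mk' Φ.range).comp (toLim hM n).toAddMonoidHom) (b := fun _ => 0)
    (fun n x => congrArg (QuotientAddGroup.mk' Φ.range) (toLim_rowMap hM n x)) (fun _ _ => rfl)
    (fun n w hw => by
      obtain ⟨α, rfl, rfl⟩ := hw n
      exact (QuotientAddGroup.eq_zero_iff _).2 (hΦ α)) n x
  exact (QuotientAddGroup.eq_zero_iff _).1 h

/-- Both sides are compatible families in `i`, so only vertices at the end of paths of every length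
matter. For such a vertex, paths `α` and `α'` of lengths `n` and `n + 1` ending there reduce the
claim to `τ (c α) = c α'`. The abstract form covers both degrees. -/
theorem eq_toLim_succ {L : Type*} [AddCommGroup L] (hM : RowFinite M)
    (hAM : ∀ i j, A i j = 0 → M i j = 0) (Φ : L ≃+ IndLim hM) (τ : L →+ L) (c : FinPath A → L)
    (hΦ : ∀ α, Φ (c α) = toLim hM α.len (Finsupp.single α.r 1))
    (hτ : ∀ α α' : FinPath A, α'.r = α.r → α'.len = α.len + 1 → τ (c α) = c α')
    (i : ℕ) (x : V →₀ ℤ) : Φ (τ (Φ.symm (toLim hM i x))) = toLim hM (i + 1) x := by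
  refine compatible_ext hrow hnn hcol hM hAM
    (a := fun i => ((Φ.toAddMonoidHom.comp τ).comp Φ.symm.toAddMonoidHom).comp
      (toLim hM i).toAddMonoidHom) (b := fun i => (toLim hM (i + 1)).toAddMonoidHom)
    (fun n x => congrArg (fun y => Φ (τ (Φ.symm y))) (toLim_rowMap hM n x))
    (fun n x => toLim_rowMap hM (n + 1) x) (fun n w hw => ?_) i x
  obtain ⟨α, rfl, rfl⟩ := hw n
  obtain ⟨α', hl, hr⟩ := hw (α.len + 1)
  change Φ (τ (Φ.symm (toLim hM α.len (Finsupp.single α.r 1))))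
    = toLim hM (α.len + 1) (Finsupp.single α.r 1)
  rw [← hΦ, AddEquiv.symm_apply_apply, hτ α α' hr hl, hΦ, hl, hr]

theorem exists_isPhiA : ∃ Φ : (ℋ hp).H₀ ≃+ IndLim hA, IsPhiA hA hp Φ := by
  let φ : (ℋ hp).H₀ →+ IndLim hA := QuotientAddGroup.lift _ (pathIntegral hA hrow hnn) (by
    rintro _ ⟨f, rfl⟩
    exact pathIntegral_δ₁ hA hrow hnn hp f)
  have hφ : ∀ α, φ (pathClass hA hp α) = toLim hA α.len (Finsupp.single α.r 1) :=
    pathIntegral_cellInd hA hrow hnn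
  have hi : Function.Injective φ := by
    rw [injective_iff_map_eq_zero]
    intro ξ
    induction ξ using QuotientAddGroup.induction_on with
    | H f =>
      intro hf
      exact (QuotientAddGroup.eq_zero_iff _).2 (mem_range_δ₁_of_pathIntegral hA hrow hnn hp hf)
  have hs : Function.Surjective φ := surjective_of_toLim hrow hnn hcol hA (fun _ _ h => h) φ
    fun α => ⟨_, hφ α⟩
  exact ⟨AddEquiv.ofBijective φ ⟨hi, hs⟩, hφ⟩

theorem exists_isPhiB (hB : RowFinite B) (hAB : ∀ i j, A i j = 0 → B i j = 0) :
    ∃ Φ : (ℋ hp).H₁ ≃+ IndLim hB, IsPhiB hA hB hp Φ := by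
  let φ : (ℋ hp).H₁ →+ IndLim hB := QuotientAddGroup.lift _
    ((arrowIntegral hA hrow hnn hp hB hAB).comp (ℋ hp).δ₁.ker.subtype) (by
      rintro ⟨_, _⟩ ⟨f, rfl⟩
      exact arrowIntegral_δ₂ hA hrow hnn hp hB hAB f)
  have hφ : ∀ α, φ (loopClass hA hp α) = toLim hB α.len (Finsupp.single α.r 1) := by
    intro α
    have h := arrowIntegral_cellInd hA hrow hnn hp hB hAB ⟨α, 1, α, rfl, rfl⟩
    rw [one_smul] at h
    exact h
  have hi : Function.Injective φ := by
    rw [injective_iff_map_eq_zero]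
    intro ξ
    induction ξ using QuotientAddGroup.induction_on with
    | H f =>
      intro hf
      exact (QuotientAddGroup.eq_zero_iff _).2
        (mem_range_δ₂_of_arrowIntegral hA hrow hnn hp hB hAB hf f.2)
  have hs : Function.Surjective φ := surjective_of_toLim hrow hnn hcol hB hAB φ
    fun α => ⟨_, hφ α⟩
  exact ⟨AddEquiv.ofBijective φ ⟨hi, hs⟩, hφ⟩

end Isomorphisms

end KEP

end

theorem mainTheorem5 {V : Type*} [Countable V] (A B : Matrix V V ℤ)
    (hA : KEP.RowFinite A) (hB : KEP.RowFinite B)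
    (hA_nonneg : ∀ i j, 0 ≤ A i j)
    (hA_row : ∀ i, ∃ j, A i j ≠ 0)
    (hAB : ∀ i j, A i j = 0 → B i j = 0)
    (hA_col : Finite V ∨ ∀ j, ∃ i, A i j ≠ 0)
    (hp : KEP.PseudoFree A B) :
    ∃ (h₀ : Function.Bijective (KEP.incl (KEP.rho hp)).mapH₀)
      (h₁ : Function.Bijective (KEP.incl (KEP.rho hp)).mapH₁),
      ((∃ ΦA : (KEP.ℋ hp).H₀ ≃+ KEP.IndLim hA, KEP.IsPhiA hA hp ΦA) ∧
        ∀ ΦA : (KEP.ℋ hp).H₀ ≃+ KEP.IndLim hA, KEP.IsPhiA hA hp ΦA →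
          ∀ (i : ℕ) (x : V →₀ ℤ),
            ΦA (KEP.tilde₀ (KEP.rho hp) h₀ 1 (ΦA.symm (KEP.toLim hA i x)))
              = KEP.toLim hA (i + 1) x) ∧
      ((∃ ΦB : (KEP.ℋ hp).H₁ ≃+ KEP.IndLim hB, KEP.IsPhiB hA hB hp ΦB) ∧
        ∀ ΦB : (KEP.ℋ hp).H₁ ≃+ KEP.IndLim hB, KEP.IsPhiB hA hB hp ΦB →
          ∀ (i : ℕ) (x : V →₀ ℤ),
            ΦB (KEP.tilde₁ (KEP.rho hp) h₁ 1 (ΦB.symm (KEP.toLim hB i x)))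
              = KEP.toLim hB (i + 1) x) := by
  obtain ⟨θ⟩ := KEP.nonempty_transversal hA_row hA_nonneg hA_col hp
  refine ⟨θ.bijective_mapH₀, θ.bijective_mapH₁,
    ⟨KEP.exists_isPhiA hA hA_row hA_nonneg hA_col hp, fun ΦA hΦ => ?_⟩,
    ⟨KEP.exists_isPhiB hA hA_row hA_nonneg hA_col hp hB hAB, fun ΦB hΦ => ?_⟩⟩
  · exact KEP.eq_toLim_succ hA_row hA_nonneg hA_col hA (fun _ _ h => h) ΦA _ (KEP.pathClass hA hp)
      hΦ fun α α' => KEP.tilde₀_pathClass hA hp _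
  · exact KEP.eq_toLim_succ hA_row hA_nonneg hA_col hB hAB ΦB _ (KEP.loopClass hA hp)
      hΦ fun α α' => KEP.tilde₁_loopClass hA hp _
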